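/- **Setting.** Let $\mathcal P=(Q,A,O,\mathbf T)$ be a POMDP with finite sets $Q$ of states, $A\neq\emptyset$ of actions and $O$ of observations, where $\mathbf T(o,q'\mid q,a)$ is the probability of observing $o$ and moving to $q'$ when action $a$ is taken in state $q$; write $\mathbf T(o\mid q,a)=\sum_{q'}\mathbf T(o,q'\mid q,a)$. Assume that $\mathcal P$ is *posterior-deterministic*: for all $q,a,o$ there is at most one $q'$ with $\mathbf T(o,q'\mid q,a)>0$. For a (randomised, observation-based) strategy $\sigma\colon (A\times O)^*\to\mathrm{Dist}(A)$ and a sub-belief $b$ (that is, $b\colon Q\to[0,1]$ with $\|b\|_1=\sum_q b(q)\le 1$), let $\mathbb P_b^\sigma$ be the induced measure on runs, and $\mathrm{Val}(b)=\sup_\sigma\mathbb P^\sigma_b(\text{some visited state is }\top)$ for the target state $\top\in Q$. Assume further that $\bot\in Q$ is the only state of value $0$ and that $\top$ and $\bot$ are absorbing (once reached, never left) and observable (some observation is received exactly when the state is entered). Let $\mathrm{supp}(b)=\{q: b(q)>0\}$. For $a\in A$, $o\in O$ put $\mathbf T(o\mid b,a)=\frac1{\|b\|_1}\sum_q b(q)\mathbf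 T(o\mid q,a)$, and, if this is positive, let $$b_{a,o}(q)=\|b\|_1\cdot\frac{\sum_{q'}b(q')\mathbf T(o,q\mid q',a)}{\sum_{q''}\sum_{q'}b(q')\mathbf T(o,q''\mid q',a)}.$$ For $\emptyset\ne S\subseteq Q$ let $\delta(S,a,o)=\{q':\exists q\in S,\ \mathbf T(o,q'\mid q,a)>0\}$, and let $\delta^*(S,h)$ be its extension to $h\in(A\times O)^*$. **Support end components.** For a partial function $f$ from non-empty subsets of $Q$ to subsets of $A$, a history $h=a_1o_1\cdots a_ko_k$ is *inside $f$ from $S$* if, with $S_i=\delta^*(S,a_1o_1\cdots a_io_i)$, all $S_i$ are non-empty and $a_{i+1}\in f(S_i)$ for all $i<k$. An *SEC* is such an $f$ with: $f(S)\ne\emptyset$ for $S\in\mathrm{dom}f$; $\delta(S,a,o)\in\mathrm{dom} f$ whenever $S\in\mathrm{dom} f$, $a\in f(S)$ and $\delta(S,a,o)\neq\emptyset$; and for all $S,T\in\mathrm{dom}f$ there is a history $h$ inside $f$ from $S$ with $\delta^*(S,h)=T$. An SEC is *maximal* if it is maximal for containment ($\mathrm{dom} f\subseteq\mathrm{dom}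 f'$ and $f(S)\subseteq f'(S)$ for all $S\in\mathrm{dom} f$); a set $S$ lies in the domain of at most one maximal SEC. For $S\in\mathrm{dom}f$ and $q,q'\in S$, write $q\equiv_{f,S}q'$ if for every history $h$ inside $f$ from $S$, every $a\in f(\delta^*(S,h))$ and every $o\in O$, the states $x,x'$ reached from $q,q'$ by $h$ satisfy $\mathbf T(o\mid x,a)=\mathbf T(o\mid x',a)$. The SEC $f$ is *distinguishing* if $q\not\equiv_{f,S}q'$ for some $S\in\mathrm{dom}f$ and $q,q'\in S$. $\mathrm{Reach}_f(b)$ is the set of sub-beliefs obtained from $b$ by the updates along histories inside $f$ from $\mathrm{supp}(b)$. **The tree.** Fix $\varepsilon>0$ and $\eta=\frac{\varepsilon}{2|Q|}$. Starting with a root labelled by a sub-belief $b$, nodes are unfolded by the first applicable rule: 1. a node $(b,a)$ is a *sum node* with one child $b_{a,o}$, with edge weight $\mathbf T(o\mid b,a)$, for each $o$ with $\mathbf T(o\mid b,a)>0$; 2. a node $b$ with $\mathrm{supp}(b)\in\{\{\top\},\{\bot\}\}$ is a leaf; 3. a node $b$ with some non-zero entry smaller than $\eta$ is a *cut node*, whose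 only child is obtained from $b$ by setting all entries smaller than $\eta$ to $0$; 4. if $\mathrm{supp}(b)$ is in the domain of a distinguishing maximal SEC $f$, then $b$ is a *sum node* with, for each class $C$ of $\equiv_{f,\mathrm{supp}(b)}$, one child $\frac{\|b\|_1}{\|b|_C\|_1}\,b|_C$ with edge weight $\frac{\|b|_C\|_1}{\|b\|_1}$; 5. if $\mathrm{supp}(b)$ is in the domain of a non-distinguishing maximal SEC $f$, then $b$ is a *max node* whose children are all $(b',a)$ with $b'\in\mathrm{Reach}_f(b)$ and $a\notin f(\mathrm{supp}(b'))$; 6. otherwise $b$ is a *max node* with children $(b,a)$, $a\in A$. Let $\widehat{\mathrm T}_n(b)$ be the truncation of this tree at depth $n$. Let $\widehat{\mathrm{Val}}_n$ and $\widehat{\mathrm{rank}}_n$ be the statistics of its nodes computed by backward induction, by weighted sums at sum nodes, copying at cut nodes and maxima at max nodes, from the leaf values: at a leaf with sub-belief $b'$, $\widehat{\mathrm{Val}}_n$ is $\|b'\|_1$ if $\mathrm{supp}(b')=\{\top\}$ and $0$ otherwise, and $\widehat{\mathrm{rank}}_n$ is $\|b'\|_1\cdot\mathrm{rank}(\mathrm{supp}(b'))$.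 Here $\mathrm{rank}(S)$ is the height of $S$ (the largest length of a strictly increasing chain that ends in $S$) among the non-empty subsets of $Q$ for the quasi-order: $S\sqsubseteq T$ iff $S=\delta^*(T,h)$ for some $h$, or $|S|<|T|$. **Theorem (Termination).** Let $p_{\min}$ be the smallest non-zero value of $\mathbf T(o,q'\mid q,a)$, $N=2^{|Q|+1}$ and $c=\frac{(p_{\min}\cdot\eta)^N}{2^{|Q|}}$. Then for every sub-belief $b$ (in particular for every belief), with $r_n$ the root of $\widehat{\mathrm T}_n(b)$: (i) for every natural number $n\ge\frac Nc\left((|Q|+1)\ln 2+\ln\frac1\varepsilon\right)$, $$\widehat{\mathrm{Val}}_n(r_n)\ \le\ \mathrm{Val}(b)\ \le\ \widehat{\mathrm{Val}}_n(r_n)+\varepsilon;$$ (ii) if $c\le 1$ (which holds whenever $\varepsilon\le 1$), then for every $n\in\mathbb N$, $$\widehat{\mathrm{rank}}_{n+N}(r_{n+N})\ \le\ (1-c)\cdot\widehat{\mathrm{rank}}_n(r_n).$$ -/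

import Mathlib

universe u

open MeasureTheory

/-- A partially observable Markov decision process with states `Q`, actions `A`, observations `O`:
taking action `a` in state `q` yields a random pair (observation, next state). -/
structure POMDP (Q A O : Type u) where
  trans : Q → A → PMF (O × Q)

namespace POMDP

variable {Q A O : Type u}

/-! ### Transition probabilities -/

/-- `T(o, q' ∣ q, a)`. -/
noncomputable def prob (P : POMDP Q A O) (q : Q) (a : A) (o : O) (q' : Q) : ℝ :=
  (P.trans q a (o, q')).toReal

/-- `T(o ∣ q, a)`. -/
noncomputable def obsProb [Fintype Q] (P : POMDP Q A O) (q : Q) (a : A) (o : O) : ℝ :=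
  ∑ q', P.prob q a o q'

/-- The smallest non-zero transition probability. -/
noncomputable def pMin (P : POMDP Q A O) : ℝ :=
  sInf {p : ℝ | ∃ q a o q', p = P.prob q a o q' ∧ 0 < P.prob q a o q'}

/-- The state, the action and the observation determine the next state. -/
def PosteriorDeterministic (P : POMDP Q A O) : Prop :=
  ∀ q a o q₁ q₂, 0 < P.prob q a o q₁ → 0 < P.prob q a o q₂ → q₁ = q₂

/-! ### Runs, strategies, and the probability of a set of runs -/

/-- A sequence `q₀ a₁ o₁ q₁ a₂ o₂ …`: the state `qᵢ` is `state i`, and the pair `(aᵢ₊₁, oᵢ₊₁)` is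
`move i`. -/
@[ext] structure Run (Q A O : Type u) : Type u where
  state : ℕ → Q
  move : ℕ → A × O

/-- The cylinder of the history `q₀ a₁ o₁ q₁ … aₙ oₙ qₙ` formed by the first `n` steps of `h`. -/
def cyl (h : Run Q A O) (n : ℕ) : Set (Run Q A O) :=
  {ρ | (∀ i ≤ n, ρ.state i = h.state i) ∧ ∀ i < n, ρ.move i = h.move i}

/-- The `σ`-algebra generated by the cylinders. -/
instance : MeasurableSpace (Run Q A O) :=
  MeasurableSpace.generateFrom {C | ∃ h n, C = cyl h n}

/-- Observation-based randomised strategies. -/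
abbrev Strategy (A O : Type u) : Type u := List (A × O) → PMF A

/-- The observable history `a₁ o₁ … aₙ oₙ` of `h`. -/
def obsHist (h : Run Q A O) (n : ℕ) : List (A × O) := List.ofFn fun i : Fin n => h.move i

/-- The probability, under the strategy `σ` and from the (sub-)belief `b`, of the history formed by
the first `n` steps of `h`. -/
noncomputable def histProb (P : POMDP Q A O) (σ : Strategy A O) (b : Q → ℝ) (h : Run Q A O) : ℕ → ℝ
  | 0 => b (h.state 0)
  | n + 1 => P.histProb σ b h n * (σ (obsHist h n) (h.move n).1).toReal *
      P.prob (h.state n) (h.move n).1 (h.move n).2 (h.state (n + 1))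

/-- `μ` gives each cylinder the probability of its history. -/
def IsRunMeasure (P : POMDP Q A O) (σ : Strategy A O) (b : Q → ℝ) (μ : Measure (Run Q A O)) : Prop :=
  ∀ h n, μ (cyl h n) = ENNReal.ofReal (P.histProb σ b h n)

/-! The following facts, up to `IsRunMeasure.unique`, show that such a measure exists, by the
Ionescu-Tulcea theorem, and is unique. -/

/-- One step of a run: action, observation, next state. -/
structure Step (Q A O : Type u) : Type u where
  move : A × O
  state : Q

instance : MeasurableSpace (Step Q A O) := ⊤

instance : DiscreteMeasurableSpace (Step Q A O) := ⟨fun _ => trivial⟩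

instance [Finite Q] [Finite A] [Finite O] : Finite (Step Q A O) :=
  Finite.of_injective (fun e : Step Q A O => (e.move, e.state)) (by
    rintro ⟨m, s⟩ ⟨m', s'⟩ h
    simpa using h)

/-- The law of the next step after the observable history `w`, in the state `q`. -/
noncomputable def stepPMF (P : POMDP Q A O) (σ : Strategy A O) (w : List (A × O)) (q : Q) :
    PMF (Step Q A O) :=
  (σ w).bind fun a => (P.trans q a).bind fun oq => PMF.pure ⟨(a, oq.1), oq.2⟩

theorem stepPMF_apply (P : POMDP Q A O) (σ : Strategy A O) (w : List (A × O)) (q : Q)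
    (e : Step Q A O) :
    P.stepPMF σ w q e = σ w e.move.1 * P.trans q e.move.1 (e.move.2, e.state) := by
  classical
  obtain ⟨⟨a, o⟩, q'⟩ := e
  simp only [stepPMF, PMF.bind_apply, PMF.pure_apply]
  rw [tsum_eq_single a, tsum_eq_single (o, q')]
  · simp
  · rintro ⟨o', q''⟩ h
    rw [if_neg, mul_zero]
    intro h'
    simp only [Step.mk.injEq, Prod.mk.injEq] at h'
    exact h (by rw [h'.1.2, h'.2])
  · intro a' h
    rw [ENNReal.tsum_eq_zero.2, mul_zero]
    intro x
    rw [if_neg, mul_zero]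
    intro h'
    simp only [Step.mk.injEq, Prod.mk.injEq] at h'
    exact h h'.1.1.symm

/-- The observable history in the first `n + 1` steps, the move of the initial step being void. -/
def stepHist (n : ℕ) (x : Finset.Iic n → Step Q A O) : List (A × O) :=
  List.ofFn fun i : Fin n => (x ⟨i + 1, Finset.mem_Iic.2 i.2⟩).move

/-- The step kernels fed to the Ionescu-Tulcea theorem. -/
noncomputable def stepKernel [Finite Q] [Finite A] [Finite O] (P : POMDP Q A O) (σ : Strategy A O)
    (n : ℕ) : ProbabilityTheory.Kernel (Finset.Iic n → Step Q A O) (Step Q A O) where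
  toFun x := (P.stepPMF σ (stepHist n x) (x ⟨n, Finset.mem_Iic.2 le_rfl⟩).state).toMeasure
  measurable' := Measurable.of_discrete

instance [Finite Q] [Finite A] [Finite O] (P : POMDP Q A O) (σ : Strategy A O) (n : ℕ) :
    ProbabilityTheory.IsMarkovKernel (P.stepKernel σ n) :=
  ⟨fun x => by
    change IsProbabilityMeasure (PMF.toMeasure _)
    infer_instance⟩

/-- The run read off from a sequence of steps. -/
def runOf (y : ℕ → Step Q A O) : Run Q A O where
  state i := (y i).state
  move i := (y (i + 1)).move

theorem measurable_runOf [Finite Q] [Finite A] [Finite O] :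
    Measurable (runOf : (ℕ → Step Q A O) → Run Q A O) := by
  refine measurable_generateFrom ?_
  rintro _ ⟨h, n, rfl⟩
  have : runOf ⁻¹' cyl h n = (⋂ i : ℕ, {y : ℕ → Step Q A O | i ≤ n → (y i).state = h.state i}) ∩
      ⋂ i : ℕ, {y : ℕ → Step Q A O | i < n → (y (i + 1)).move = h.move i} := by
    ext y; simp [runOf, cyl]
  rw [this]
  have h₁ (i : ℕ) (E : Set (Step Q A O)) : MeasurableSet {y : ℕ → Step Q A O | y i ∈ E} :=
    measurable_pi_apply i MeasurableSet.of_discrete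
  exact (MeasurableSet.iInter fun i => h₁ i {e | i ≤ n → e.state = h.state i}).inter
    (MeasurableSet.iInter fun i => h₁ (i + 1) {e | i < n → e.move = h.move i})

theorem traj_cyl [Finite Q] [Finite A] [Finite O] (P : POMDP Q A O) (σ : Strategy A O)
    (e₀ : Step Q A O) (b : Q → ℝ) (h : Run Q A O) (hb₁ : e₀.state = h.state 0 → b (h.state 0) = 1)
    (hb₀ : e₀.state ≠ h.state 0 → b (h.state 0) = 0) (n : ℕ) :
    ProbabilityTheory.Kernel.traj (X := fun _ => Step Q A O) (P.stepKernel σ) 0 (fun _ => e₀) (runOf ⁻¹' cyl h n) =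
    ENNReal.ofReal (P.histProb σ b h n) := by
  set μ := ProbabilityTheory.Kernel.traj (X := fun _ => Step Q A O) (P.stepKernel σ) 0 (fun _ => e₀) with hμ
  induction n with
  | zero =>
    let B : Set (Finset.Iic 0 → Step Q A O) := {x | (x ⟨0, Finset.mem_Iic.2 le_rfl⟩).state = h.state 0}
    have h1 : runOf ⁻¹' cyl h 0 = Preorder.frestrictLe 0 ⁻¹' B := by
      ext y; simp [runOf, cyl, B]
    have hB : MeasurableSet B := MeasurableSet.of_discrete
    rw [h1, hμ, ← Measure.map_apply (by fun_prop) hB,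
      ProbabilityTheory.Kernel.traj_map_frestrictLe_apply,
      ProbabilityTheory.Kernel.partialTraj_self, ProbabilityTheory.Kernel.id_apply,
      Measure.dirac_apply' _ hB, histProb]
    by_cases h₀ : e₀.state = h.state 0
    · rw [hb₁ h₀, Set.indicator_of_mem]
      · simp
      · exact h₀
    · rw [hb₀ h₀, Set.indicator_of_notMem]
      · simp
      · exact h₀
  | succ n ih =>
    let B : Set (Finset.Iic n → Step Q A O) :=
      {x | (∀ i (hi : i ≤ n), (x ⟨i, Finset.mem_Iic.2 hi⟩).state = h.state i) ∧
        ∀ i (hi : i < n), (x ⟨i + 1, Finset.mem_Iic.2 hi⟩).move = h.move i}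
    let e : Step Q A O := ⟨h.move n, h.state (n + 1)⟩
    have h1 : runOf ⁻¹' cyl h n = Preorder.frestrictLe n ⁻¹' B := by
      ext y; simp [runOf, cyl, B]
    have h2 : runOf ⁻¹' cyl h (n + 1) =
        (fun y : ℕ → Step Q A O => (Preorder.frestrictLe n y, y (n + 1))) ⁻¹' (B ×ˢ {e}) := by
      ext y
      obtain ⟨m, s, hy⟩ : ∃ m s, y (n + 1) = ⟨m, s⟩ := ⟨_, _, rfl⟩
      simp only [runOf, cyl, B, e, Set.mem_preimage, Set.mem_ofPred_eq, Set.mem_prod,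
        Set.mem_singleton_iff, hy, Step.mk.injEq]
      constructor
      · rintro ⟨ha, hb⟩
        refine ⟨⟨fun i hi => ha i (by omega), fun i hi => hb i (by omega)⟩, ?_, ?_⟩
        · rw [← hb n (by omega), hy]
        · rw [← ha (n + 1) le_rfl, hy]
      · rintro ⟨⟨ha, hb⟩, hc, hd⟩
        refine ⟨fun i hi => ?_, fun i hi => ?_⟩
        · rcases Nat.lt_or_ge n i with h' | h'
          · obtain rfl : i = n + 1 := by omega
            rw [hy, ← hd]
          · exact ha i h'
        · rcases Nat.lt_or_ge i n with h' | h'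
          · exact hb i h'
          · obtain rfl : i = n := by omega
            rw [hy, ← hc]
    have hB : MeasurableSet B := MeasurableSet.of_discrete
    have h3 := congrArg (fun ν => ν (B ×ˢ {e}))
      (ProbabilityTheory.Kernel.partialTraj_compProd_eq_map_traj
        (X := fun _ => Step Q A O) (κ := P.stepKernel σ) (Nat.zero_le n) (x₀ := fun _ => e₀))
    simp only [← hμ] at h3
    rw [← ProbabilityTheory.Kernel.traj_map_frestrictLe_apply, ← hμ] at h3
    rw [Measure.map_apply (by fun_prop) (hB.prod (measurableSet_singleton e)), ← h2,
      Measure.compProd_apply_prod hB (measurableSet_singleton e)] at h3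
    rw [← h3, setLIntegral_congr_fun (g := fun _ => σ (obsHist h n) (h.move n).1 *
      P.trans (h.state n) (h.move n).1 ((h.move n).2, h.state (n + 1))) hB, setLIntegral_const,
      Measure.map_apply (by fun_prop) hB, ← h1, ih, histProb, prob]
    · rw [ENNReal.ofReal_mul' ENNReal.toReal_nonneg, ENNReal.ofReal_mul' ENNReal.toReal_nonneg,
        ENNReal.ofReal_toReal (PMF.apply_ne_top _ _), ENNReal.ofReal_toReal (PMF.apply_ne_top _ _)]
      ring
    · intro x hx
      change (PMF.toMeasure _) {e} = _
      rw [PMF.toMeasure_apply_singleton _ _ (measurableSet_singleton e), stepPMF_apply]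
      have : stepHist n x = obsHist h n := by
        unfold stepHist obsHist
        congr 1
        funext i
        exact hx.2 i i.2
      rw [this, hx.1 n le_rfl]

theorem exists_isRunMeasure [Fintype Q] [Finite A] [Finite O] (P : POMDP Q A O) (σ : Strategy A O)
    (b : Q → ℝ) (hb : ∀ q, 0 ≤ b q) : ∃ μ, P.IsRunMeasure σ b μ := by
  classical
  obtain ⟨a, -⟩ := (σ []).support_nonempty
  have hd (q : Q) : Nonempty O := (P.trans q a).support_nonempty.elim fun x _ => ⟨x.1⟩
  let ν (q : Q) : Measure (Run Q A O) :=
    (ProbabilityTheory.Kernel.traj (X := fun _ => Step Q A O) (P.stepKernel σ) 0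
      fun _ => ⟨(a, (hd q).some), q⟩).map runOf
  have hν (q : Q) : P.IsRunMeasure σ (Pi.single q 1) (ν q) := by
    intro h n
    rw [Measure.map_apply measurable_runOf (MeasurableSpace.measurableSet_generateFrom ⟨h, n, rfl⟩)]
    refine P.traj_cyl σ _ _ h (fun hq => ?_) (fun hq => ?_) n
    · rw [← hq]; simp
    · exact Pi.single_eq_of_ne (Ne.symm hq) _
  have hlin (c : Q → ℝ) (h : Run Q A O) (n : ℕ) :
      P.histProb σ c h n = c (h.state 0) * P.histProb σ (fun _ => 1) h n := by
    induction n with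
    | zero => simp [histProb]
    | succ n ih => rw [histProb, histProb, ih]; ring
  refine ⟨∑ q, ENNReal.ofReal (b q) • ν q, fun h n => ?_⟩
  rw [Measure.finsetSum_apply, Finset.sum_eq_single (h.state 0)]
  · rw [Measure.smul_apply, hν, hlin b, hlin (Pi.single _ _), Pi.single_eq_same, one_mul,
      smul_eq_mul, ENNReal.ofReal_mul (hb _)]
  · intro q _ hq
    rw [Measure.smul_apply, hν, hlin (Pi.single _ _), Pi.single_eq_of_ne (Ne.symm hq)]
    simp
  · simp

theorem IsRunMeasure.unique [Fintype Q] {P : POMDP Q A O} {σ : Strategy A O} {b : Q → ℝ}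
    {μ ν : Measure (Run Q A O)} (hμ : P.IsRunMeasure σ b μ) (hν : P.IsRunMeasure σ b ν) : μ = ν := by
  obtain ⟨a, -⟩ := (σ []).support_nonempty
  rcases isEmpty_or_nonempty Q with hQ | ⟨⟨q₀⟩⟩
  · have : IsEmpty (Run Q A O) := ⟨fun r => hQ.elim (r.state 0)⟩
    exact Subsingleton.elim _ _
  obtain ⟨o, -⟩ := (P.trans q₀ a).support_nonempty
  let r (q : Q) : Run Q A O := ⟨fun _ => q, fun _ => (a, o.1)⟩
  have hm (h : Run Q A O) (n : ℕ) : MeasurableSet (cyl h n) :=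
    MeasurableSpace.measurableSet_generateFrom ⟨h, n, rfl⟩
  have hu : (Set.univ : Set (Run Q A O)) = ⋃ q, cyl (r q) 0 := by
    ext ρ; simp [cyl, r]
  have hd : Pairwise (Function.onFun Disjoint fun q => cyl (r q) 0) := by
    intro q q' h
    rw [Function.onFun, Set.disjoint_left]
    intro x hx hx'
    exact h ((hx.1 0 le_rfl).symm.trans (hx'.1 0 le_rfl))
  have hmu (μ : Measure (Run Q A O)) (hμ : P.IsRunMeasure σ b μ) :
      μ Set.univ = ∑ q, ENNReal.ofReal (b q) := by
    rw [hu, measure_iUnion hd (fun q => hm _ _), tsum_fintype]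
    exact Finset.sum_congr rfl fun q _ => hμ _ _
  have : IsFiniteMeasure μ := ⟨by
    rw [hmu μ hμ]
    exact ENNReal.sum_lt_top.2 fun _ _ => ENNReal.ofReal_lt_top⟩
  refine ext_of_generate_finite _ rfl ?_ ?_ (by rw [hmu μ hμ, hmu ν hν])
  · rintro _ ⟨h, n, rfl⟩ _ ⟨h', n', rfl⟩ ⟨ρ, hρ, hρ'⟩
    refine ⟨ρ, max n n', ?_⟩
    ext x
    simp only [cyl, Set.mem_inter_iff, Set.mem_ofPred_eq] at *
    constructor
    · rintro ⟨⟨h1,h2⟩,h3,h4⟩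
      constructor
      · intro i hi
        rcases le_max_iff.1 hi with h5 | h5
        · rw [h1 i h5, hρ.1 i h5]
        · rw [h3 i h5, hρ'.1 i h5]
      · intro i hi
        rcases lt_max_iff.1 hi with h5 | h5
        · rw [h2 i h5, hρ.2 i h5]
        · rw [h4 i h5, hρ'.2 i h5]
    · rintro ⟨h1,h2⟩
      refine ⟨⟨fun i hi => ?_, fun i hi => ?_⟩, fun i hi => ?_, fun i hi => ?_⟩
      · rw [h1 i (by omega), hρ.1 i hi]
      · rw [h2 i (by omega), hρ.2 i hi]
      · rw [h1 i (by omega), hρ'.1 i hi]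
      · rw [h2 i (by omega), hρ'.2 i hi]
  · rintro _ ⟨h, n, rfl⟩
    rw [hμ, hν]

open Classical in
/-- The measure on runs induced by the strategy `σ` and the (sub-)belief `b`. It is determined by
its values on the cylinders (`IsRunMeasure.unique`). -/
noncomputable def runMeasure (P : POMDP Q A O) (σ : Strategy A O) (b : Q → ℝ) :
    Measure (Run Q A O) :=
  if h : ∃ μ, P.IsRunMeasure σ b μ then h.choose else 0

theorem isRunMeasure_runMeasure [Fintype Q] [Finite A] [Finite O] (P : POMDP Q A O)
    (σ : Strategy A O) (b : Q → ℝ) (hb : ∀ q, 0 ≤ b q) :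
    P.IsRunMeasure σ b (P.runMeasure σ b) := by
  have h := P.exists_isRunMeasure σ b hb
  rw [runMeasure, dif_pos h]
  exact h.choose_spec

/-- The runs that visit `T`. -/
def reach (T : Set Q) : Set (Run Q A O) := {ρ | ∃ i, ρ.state i ∈ T}

/-- The (reachability) value of the (sub-)belief `b`, for the set `T` of target states. -/
noncomputable def val (P : POMDP Q A O) (T : Set Q) (b : Q → ℝ) : ℝ :=
  ⨆ σ : Strategy A O, (P.runMeasure σ b).real (reach T)

/-! ### Target and sink -/

/-- Once in `s`, the agent stays in `s`. -/
def Absorbing (P : POMDP Q A O) (s : Q) : Prop :=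
  ∀ a o q, 0 < P.prob s a o q → q = s

/-- Some observation is received exactly when `s` is entered. -/
def Observable (P : POMDP Q A O) (s : Q) : Prop :=
  ∃ o₀, ∀ q a o q', 0 < P.prob q a o q' → (o = o₀ ↔ q' = s)

open Classical in
/-- `top` is the target, `bot` is the only state of value `0`, and both are absorbing and
observable. -/
structure IsStandard (P : POMDP Q A O) (top bot : Q) : Prop where
  absorbing_top : P.Absorbing top
  observable_top : P.Observable top
  absorbing_bot : P.Absorbing bot
  observable_bot : P.Observable bot
  val_eq_zero_iff : ∀ q, P.val {top} (Pi.single q 1) = 0 ↔ q = bot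

/-! ### Sub-beliefs, their supports, and their updates -/

/-- The total mass `‖b‖₁` of a sub-belief. -/
noncomputable def mass [Fintype Q] (b : Q → ℝ) : ℝ := ∑ q, b q

structure IsSubBelief [Fintype Q] (b : Q → ℝ) : Prop where
  nonneg : ∀ q, 0 ≤ b q
  mass_le_one : mass b ≤ 1

/-- The support of a sub-belief. -/
def supp (b : Q → ℝ) : Set Q := {q | 0 < b q}

/-- The probability of observing `o` after taking action `a` from `b`, that is, `T(o ∣ b, a)`, which
is divided by `‖b‖₁` to be a probability also when `b` is a sub-belief. -/
noncomputable def belObsProb [Fintype Q] (P : POMDP Q A O) (b : Q → ℝ) (a : A) (o : O) : ℝ :=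
  (∑ q, b q * P.obsProb q a o) / mass b

/-- The updated (sub-)belief after action `a` and observation `o`; it is normalised to have the same
mass as `b`. -/
noncomputable def update [Fintype Q] (P : POMDP Q A O) (b : Q → ℝ) (a : A) (o : O) : Q → ℝ :=
  fun q => mass b * ((∑ q', b q' * P.prob q' a o q) / ∑ q'', ∑ q', b q' * P.prob q' a o q'')

/-- The updated (sub-)belief after an observable history. -/
noncomputable def updates [Fintype Q] (P : POMDP Q A O) (b : Q → ℝ) (h : List (A × O)) : Q → ℝ :=
  h.foldl (fun c ao => P.update c ao.1 ao.2) b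

/-- `δ(S, a, o)`. -/
def succ (P : POMDP Q A O) (S : Set Q) (a : A) (o : O) : Set Q :=
  {q' | ∃ q ∈ S, 0 < P.prob q a o q'}

/-- `δ*(S, h)`. -/
def succs (P : POMDP Q A O) (S : Set Q) (h : List (A × O)) : Set Q :=
  h.foldl (fun T ao => P.succ T ao.1 ao.2) S

/-- The sub-belief `Cut_η(b)`, in which the probabilities below `η` are removed. -/
noncomputable def cut (η : ℝ) (b : Q → ℝ) : Q → ℝ := fun q => if b q < η then 0 else b q

open Classical in
/-- The restriction of `b` to `C`. -/
noncomputable def restrict (b : Q → ℝ) (C : Set Q) : Q → ℝ := fun q => if q ∈ C then b q else 0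

/-! ### Support end components

A partial function from belief supports to sets of actions with non-empty values is encoded as a
total function `f : Set Q → Set A` with `f S = ∅` for every `S` outside of its domain. -/

/-- The domain of `f`. -/
def dom (f : Set Q → Set A) : Set (Set Q) := {S | (f S).Nonempty}

/-- The observable history is possible from `S` and takes only actions allowed by `f`. -/
def Follows (P : POMDP Q A O) (f : Set Q → Set A) : Set Q → List (A × O) → Prop
  | _, [] => True
  | S, (a, o) :: h => a ∈ f S ∧ (P.succ S a o).Nonempty ∧ P.Follows f (P.succ S a o) h

/-- The supports that can be reached from the support `S` with actions allowed by `f`. -/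
def reachSupp (P : POMDP Q A O) (f : Set Q → Set A) (S : Set Q) : Set (Set Q) :=
  {T | ∃ h, P.Follows f S h ∧ P.succs S h = T}

/-- The (sub-)beliefs that can be reached from `b` with actions allowed by `f`. -/
def reachBel [Fintype Q] (P : POMDP Q A O) (f : Set Q → Set A) (b : Q → ℝ) : Set (Q → ℝ) :=
  {c | ∃ h, P.Follows f (supp b) h ∧ P.updates b h = c}

/-- Support end components (SECs). -/
structure IsSEC (P : POMDP Q A O) (f : Set Q → Set A) : Prop where
  nonempty : ∀ S ∈ dom f, S.Nonempty
  closed : ∀ S ∈ dom f, ∀ a ∈ f S, ∀ o, (P.succ S a o).Nonempty → P.succ S a o ∈ dom f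
  connected : ∀ S ∈ dom f, ∀ T ∈ dom f, T ∈ P.reachSupp f S

/-- SECs that are maximal for containment. -/
def IsMaxSEC (P : POMDP Q A O) (f : Set Q → Set A) : Prop :=
  P.IsSEC f ∧ ∀ f', P.IsSEC f' → (∀ S, f S ⊆ f' S) → f = f'

/-- `(f, S)`-indistinguishability of `q` and `q'`. -/
def Indist [Fintype Q] (P : POMDP Q A O) (f : Set Q → Set A) (S : Set Q) (q q' : Q) : Prop :=
  ∀ h, P.Follows f S h → ∀ x ∈ P.succs {q} h, ∀ x' ∈ P.succs {q'} h,
    ∀ a ∈ f (P.succs S h), ∀ o, P.obsProb x a o = P.obsProb x' a o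

def Distinguishing [Fintype Q] (P : POMDP Q A O) (f : Set Q → Set A) : Prop :=
  ∃ S ∈ dom f, ∃ q ∈ S, ∃ q' ∈ S, ¬ P.Indist f S q q'

/-- The equivalence classes of `(f, S)`-indistinguishability. -/
def classes [Fintype Q] (P : POMDP Q A O) (f : Set Q → Set A) (S : Set Q) : Set (Set Q) :=
  {C | ∃ q ∈ S, C = {q' ∈ S | P.Indist f S q q'}}

/-! ### The tree unfolding -/

/-- Labels of nodes: a (sub-)belief, or a (sub-)belief with an action. -/
inductive Label (Q A : Type u) : Type u
  | bel (b : Q → ℝ)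
  | act (b : Q → ℝ) (a : A)

/-- The (sub-)belief in a label. -/
def Label.belief : Label Q A → Q → ℝ
  | .bel b => b
  | .act b _ => b

/-- Finite-depth trees whose nodes are labelled and whose inner nodes are sum nodes (with weighted
edges to their children), cut nodes, or max nodes. The children of a node are indexed by `ι`. -/
inductive UTree (Q A : Type u) : Type (u + 1)
  | leaf (x : Label Q A)
  | sum (x : Label Q A) (ι : Type u) [Fintype ι] (weight : ι → ℝ) (child : ι → UTree Q A)
  | cut (x : Label Q A) (child : UTree Q A)
  | max (x : Label Q A) (ι : Type u) (child : ι → UTree Q A)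

open Classical in
/-- The truncation at depth `n` of the unfolding, with cut threshold `η`, of a node labelled `x`. -/
noncomputable def unfolding [Fintype Q] [Fintype O] (P : POMDP Q A O) (top bot : Q) (η : ℝ) :
    ℕ → Label Q A → UTree Q A
  | 0, x => .leaf x
  | n + 1, .act b a =>
      .sum (.act b a) {o : O // 0 < P.belObsProb b a o} (fun o => P.belObsProb b a o)
        fun o => P.unfolding top bot η n (.bel (P.update b a o))
  | n + 1, .bel b =>
      if supp b = {top} ∨ supp b = {bot} then .leaf (.bel b)
      else if ∃ q, b q ≠ 0 ∧ b q < η then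
        .cut (.bel b) (P.unfolding top bot η n (.bel (POMDP.cut η b)))
      else if h : ∃ f, P.IsMaxSEC f ∧ supp b ∈ dom f then
        if P.Distinguishing h.choose then
          .sum (.bel b) {C : Set Q // C ∈ P.classes h.choose (supp b)}
            (fun C => mass (restrict b C) / mass b)
            fun C => P.unfolding top bot η n
              (.bel ((mass b / mass (restrict b C)) • restrict b C))
        else
          .max (.bel b) {y : (Q → ℝ) × A // y.1 ∈ P.reachBel h.choose b ∧ y.2 ∉ h.choose (supp y.1)}
            fun y => P.unfolding top bot η n (.act y.1.1 y.1.2)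
      else .max (.bel b) A fun a => P.unfolding top bot η n (.act b a)

open Classical in
/-- The statistic `Val` of the root of a tree. -/
noncomputable def UTree.value [Fintype Q] (top : Q) : UTree Q A → ℝ
  | .leaf x => if supp x.belief = {top} then mass x.belief else 0
  | @UTree.sum _ _ _ _ _ weight child => ∑ i, weight i * (child i).value top
  | .cut _ child => child.value top
  | .max _ _ child => ⨆ i, (child i).value top

/-! ### Rank -/

/-- `S ⪯ T`: the support `S` can be reached from `T`. -/
def Below (P : POMDP Q A O) (S T : Set Q) : Prop := ∃ h, P.succs T h = S

/-- The extension of `⪯` by comparing cardinalities. -/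
def BelowTot (P : POMDP Q A O) (S T : Set Q) : Prop := P.Below S T ∨ S.ncard < T.ncard

/-- The rank of a support: its height in the quasi-order `BelowTot` on supports, that is, the largest
length of a strictly increasing chain that ends in `S`. -/
noncomputable def rankSupp (P : POMDP Q A O) (S : Set Q) : ℕ :=
  sSup {n | ∃ s : ℕ → Set Q, s n = S ∧ (∀ i ≤ n, (s i).Nonempty) ∧
    ∀ i < n, P.BelowTot (s i) (s (i + 1)) ∧ ¬ P.BelowTot (s (i + 1)) (s i)}

/-- The rank of a sub-belief. -/
noncomputable def rank [Fintype Q] (P : POMDP Q A O) (b : Q → ℝ) : ℝ := mass b * P.rankSupp (supp b)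

/-- The statistic `rank` of the root of a tree. -/
noncomputable def UTree.rank [Fintype Q] (P : POMDP Q A O) : UTree Q A → ℝ
  | .leaf x => P.rank x.belief
  | @UTree.sum _ _ _ _ _ weight child => ∑ i, weight i * (child i).rank P
  | .cut _ child => child.rank P
  | .max _ _ child => ⨆ i, (child i).rank P

end POMDP

/-! Since `top` is absorbing, the value of a sub-belief is the supremum over `k` of the optimal
probability `horizonVal` of being in `top` after `k` steps (`isLUB_val`). This quantity is defined
through the unnormalised update `push`, which is linear, so the value is monotone, positively
homogeneous, subadditive, and obeys the Bellman inequalities. Measures on runs play no role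
afterwards.

The rules of the tree respect values for the following reasons. Inside an SEC supports cannot
shrink, because they must be able to return; by posterior determinism every history inside it is
then injective on states, and some continuation puts each state back in its place
(`IsSEC.exists_return`). If the states of a support are indistinguishable, observations carry no
information: updates only move the masses around, finitely many beliefs are reachable, and they all
have the same value (`IsSEC.val_updates`), by looking at one of minimal value. So a max node may
jump to any exit for free. If there are several classes, playing uniformly inside the SEC reveals
the class in the limit and costs nothing, so the value is the sum of the values of the restrictions
(`IsSEC.sum_val_restrict`). The cost of stopping after `n` steps is controlled by Bhattacharyya
coefficients, which tend to 0 for distinguishable states (`IsSEC.iInf_bhat_eq_zero`).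

Truncation and cuts are the only sources of error. At a truncated node that is not a leaf the rank
is at least the mass, so the rank statistic dominates the error there; a cut loses at most `η` per
state removed from the support. Together, value ≤ truncated value + truncated rank + `η` times the
size of the support (`labelVal_le_stat`), and the last term is at most `ε / 2`.

It remains to see that the rank statistic decays geometrically. No rule increases it, while cuts and
splits lower the rank of a support by at least 1 and leaves have rank 0. One cannot exit maximal
SECs forever without meeting one of these events: otherwise the supports visited would contain an
SEC that contradicts maximality (`eq_empty_of_exits`). Hence, whatever is played, within `2 ^ |Q|`
rounds such an event has probability at least a power of `pMin * η`
(`stat_leafRank_le_of_notMem_avoid`). -/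

set_option linter.unusedSectionVars false

namespace POMDP

variable {Q A O : Type u} [Fintype Q] [Fintype A] [Fintype O]

/-! ### Unnormalised updates -/

/-- The unnormalised update of `b` after action `a` and observation `o`. -/
noncomputable def push (P : POMDP Q A O) (b : Q → ℝ) (a : A) (o : O) : Q → ℝ :=
  fun q => ∑ q', b q' * P.prob q' a o q

theorem prob_nonneg (P : POMDP Q A O) (q : Q) (a : A) (o : O) (q' : Q) : 0 ≤ P.prob q a o q' :=
  ENNReal.toReal_nonneg

theorem sum_prob (P : POMDP Q A O) (q : Q) (a : A) : ∑ o, ∑ q', P.prob q a o q' = 1 := by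
  rw [← Fintype.sum_prod_type' (f := fun o q' => P.prob q a o q')]
  have h := (P.trans q a).tsum_coe
  rw [tsum_fintype] at h
  unfold prob
  rw [← ENNReal.toReal_sum (fun x _ => PMF.apply_ne_top _ _), h, ENNReal.toReal_one]

theorem push_add (P : POMDP Q A O) (b c : Q → ℝ) (a : A) (o : O) :
    P.push (b + c) a o = P.push b a o + P.push c a o := by
  ext q
  simp [push, add_mul, Finset.sum_add_distrib]

theorem push_smul (P : POMDP Q A O) (r : ℝ) (b : Q → ℝ) (a : A) (o : O) :
    P.push (r • b) a o = r • P.push b a o := by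
  ext q
  simp [push, mul_assoc, Finset.mul_sum]

theorem push_zero (P : POMDP Q A O) (a : A) (o : O) : P.push 0 a o = 0 := by
  ext q
  simp [push]

theorem push_sum {ι : Type*} (s : Finset ι) (P : POMDP Q A O) (d : ι → Q → ℝ) (a : A) (o : O) :
    P.push (∑ i ∈ s, d i) a o = ∑ i ∈ s, P.push (d i) a o := by
  classical
  induction s using Finset.induction_on with
  | empty => simp [push_zero]
  | insert i s hi ih => rw [Finset.sum_insert hi, Finset.sum_insert hi, push_add, ih]

theorem push_nonneg (P : POMDP Q A O) {b : Q → ℝ} (hb : 0 ≤ b) (a : A) (o : O) :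
    0 ≤ P.push b a o :=
  fun _ => Finset.sum_nonneg fun q' _ => mul_nonneg (hb q') (P.prob_nonneg _ _ _ _)

theorem push_mono (P : POMDP Q A O) {b c : Q → ℝ} (h : b ≤ c) (a : A) (o : O) :
    P.push b a o ≤ P.push c a o :=
  fun _ => Finset.sum_le_sum fun q' _ => mul_le_mul_of_nonneg_right (h q') (P.prob_nonneg _ _ _ _)

theorem mass_nonneg {b : Q → ℝ} (hb : 0 ≤ b) : 0 ≤ mass b :=
  Finset.sum_nonneg fun q _ => hb q

theorem mass_zero : mass (0 : Q → ℝ) = 0 := by simp [mass]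

theorem mass_smul (r : ℝ) (b : Q → ℝ) : mass (r • b) = r * mass b := by
  simp [mass, Finset.mul_sum]

theorem mass_sum {ι : Type*} (s : Finset ι) (d : ι → Q → ℝ) :
    mass (∑ i ∈ s, d i) = ∑ i ∈ s, mass (d i) := by
  simp only [mass, Finset.sum_apply]
  rw [Finset.sum_comm]

theorem le_mass {b : Q → ℝ} (hb : 0 ≤ b) (q : Q) : b q ≤ mass b :=
  Finset.single_le_sum (fun q _ => hb q) (Finset.mem_univ q)

theorem eq_zero_of_mass_eq_zero {b : Q → ℝ} (hb : 0 ≤ b) (h : mass b = 0) : b = 0 := by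
  ext q
  exact le_antisymm ((le_mass hb q).trans_eq h) (hb q)

theorem mass_pos {b : Q → ℝ} (hb : 0 ≤ b) (h : b ≠ 0) : 0 < mass b :=
  (mass_nonneg hb).lt_of_ne fun h' => h (eq_zero_of_mass_eq_zero hb h'.symm)

theorem mass_push (P : POMDP Q A O) (b : Q → ℝ) (a : A) (o : O) :
    mass (P.push b a o) = ∑ q, b q * P.obsProb q a o := by
  simp only [mass, push, obsProb, Finset.mul_sum]
  rw [Finset.sum_comm]

theorem sum_mass_push (P : POMDP Q A O) (b : Q → ℝ) (a : A) :
    ∑ o, mass (P.push b a o) = mass b := by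
  simp only [mass_push]
  rw [Finset.sum_comm]
  refine Finset.sum_congr rfl fun q _ => ?_
  simp only [obsProb]
  rw [← Finset.mul_sum, P.sum_prob, mul_one]

theorem belObsProb_eq (P : POMDP Q A O) (b : Q → ℝ) (a : A) (o : O) :
    P.belObsProb b a o = mass (P.push b a o) / mass b := by
  rw [belObsProb, mass_push]

theorem belObsProb_nonneg (P : POMDP Q A O) {b : Q → ℝ} (hb : 0 ≤ b) (a : A) (o : O) :
    0 ≤ P.belObsProb b a o := by
  rw [belObsProb_eq]
  exact div_nonneg (mass_nonneg (P.push_nonneg hb a o)) (mass_nonneg hb)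

theorem sum_belObsProb (P : POMDP Q A O) {b : Q → ℝ} (hb : mass b ≠ 0) (a : A) :
    ∑ o, P.belObsProb b a o = 1 := by
  simp only [belObsProb_eq]
  rw [← Finset.sum_div, sum_mass_push, div_self hb]

theorem update_eq (P : POMDP Q A O) (b : Q → ℝ) (a : A) (o : O) :
    P.update b a o = (mass b / mass (P.push b a o)) • P.push b a o := by
  ext q
  simp only [update, Pi.smul_apply, smul_eq_mul, push, mass]
  ring

theorem update_nonneg (P : POMDP Q A O) {b : Q → ℝ} (hb : 0 ≤ b) (a : A) (o : O) :
    0 ≤ P.update b a o := by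
  rw [update_eq]
  exact smul_nonneg (div_nonneg (mass_nonneg hb) (mass_nonneg (P.push_nonneg hb a o)))
    (P.push_nonneg hb a o)

theorem mass_update (P : POMDP Q A O) (b : Q → ℝ) (a : A) (o : O)
    (h : mass (P.push b a o) ≠ 0) : mass (P.update b a o) = mass b := by
  rw [update_eq, mass_smul, div_mul_cancel₀ _ h]

/-- Normalisation cancels, also when the observation is impossible or the belief is zero. This turns
the weighted sums of the tree into sums over the linear maps `push`. -/
theorem belObsProb_smul_update (P : POMDP Q A O) {b : Q → ℝ} (hb : 0 ≤ b) (a : A) (o : O) :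
    P.belObsProb b a o • P.update b a o = P.push b a o := by
  rw [belObsProb_eq, update_eq, smul_smul]
  by_cases h : mass (P.push b a o) = 0
  · rw [eq_zero_of_mass_eq_zero (P.push_nonneg hb a o) h, smul_zero]
  · have hm : mass b ≠ 0 := by
      intro h'
      rw [eq_zero_of_mass_eq_zero hb h', push_zero, mass_zero] at h
      exact h rfl
    rw [div_mul_div_cancel₀ hm, div_self h, one_smul]

/-! ### Finite-horizon values -/

/-- The optimal probability of being in `top` after `k` steps. -/
noncomputable def horizonVal (P : POMDP Q A O) (top : Q) : ℕ → (Q → ℝ) → ℝ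
  | 0, b => b top
  | k + 1, b => ⨆ a, ∑ o, P.horizonVal top k (P.push b a o)

theorem le_horizonVal_succ (P : POMDP Q A O) (top : Q) (k : ℕ) (b : Q → ℝ) (a : A) :
    ∑ o, P.horizonVal top k (P.push b a o) ≤ P.horizonVal top (k + 1) b :=
  le_ciSup (f := fun a => ∑ o, P.horizonVal top k (P.push b a o)) (Set.finite_range _).bddAbove a

theorem horizonVal_succ_le [Nonempty A] (P : POMDP Q A O) {top : Q} {k : ℕ} {b : Q → ℝ} {M : ℝ}
    (h : ∀ a, ∑ o, P.horizonVal top k (P.push b a o) ≤ M) : P.horizonVal top (k + 1) b ≤ M :=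
  ciSup_le h

theorem horizonVal_smul (P : POMDP Q A O) (top : Q) (k : ℕ) {r : ℝ} (hr : 0 ≤ r) (b : Q → ℝ) :
    P.horizonVal top k (r • b) = r * P.horizonVal top k b := by
  induction k generalizing b with
  | zero => simp [horizonVal]
  | succ k ih => simp only [horizonVal, push_smul, ih, ← Finset.mul_sum, Real.mul_iSup_of_nonneg hr]

variable [Nonempty A]

theorem horizonVal_add_le (P : POMDP Q A O) (top : Q) (k : ℕ) (b c : Q → ℝ) :
    P.horizonVal top k (b + c) ≤ P.horizonVal top k b + P.horizonVal top k c := by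
  induction k generalizing b c with
  | zero => simp [horizonVal]
  | succ k ih =>
    refine P.horizonVal_succ_le fun a => ?_
    refine le_trans ?_ (add_le_add (P.le_horizonVal_succ top k b a) (P.le_horizonVal_succ top k c a))
    rw [← Finset.sum_add_distrib]
    exact Finset.sum_le_sum fun o _ => by rw [push_add]; exact ih _ _

theorem horizonVal_mono (P : POMDP Q A O) (top : Q) (k : ℕ) {b c : Q → ℝ} (h : b ≤ c) :
    P.horizonVal top k b ≤ P.horizonVal top k c := by
  induction k generalizing b c with
  | zero => exact h top
  | succ k ih =>
    exact P.horizonVal_succ_le fun a => le_trans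
      (Finset.sum_le_sum fun o _ => ih (P.push_mono h a o)) (P.le_horizonVal_succ top k c a)

theorem horizonVal_zero (P : POMDP Q A O) (top : Q) (k : ℕ) : P.horizonVal top k 0 = 0 := by
  have := P.horizonVal_smul top k le_rfl 0
  simpa using this

theorem horizonVal_nonneg (P : POMDP Q A O) (top : Q) (k : ℕ) {b : Q → ℝ} (hb : 0 ≤ b) :
    0 ≤ P.horizonVal top k b := by
  rw [← P.horizonVal_zero top k]
  exact P.horizonVal_mono top k hb

theorem horizonVal_le_mass (P : POMDP Q A O) (top : Q) (k : ℕ) {b : Q → ℝ} (hb : 0 ≤ b) :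
    P.horizonVal top k b ≤ mass b := by
  induction k generalizing b with
  | zero => exact le_mass hb top
  | succ k ih =>
    refine P.horizonVal_succ_le fun a => ?_
    rw [← P.sum_mass_push b a]
    exact Finset.sum_le_sum fun o _ => ih (P.push_nonneg hb a o)

theorem Absorbing.sum_prob_self {P : POMDP Q A O} {s : Q} (hs : P.Absorbing s) (a : A) :
    ∑ o, P.prob s a o s = 1 := by
  rw [← P.sum_prob s a]
  refine Finset.sum_congr rfl fun o _ => ?_
  rw [Finset.sum_eq_single s (fun q _ hq => ?_) (by simp)]
  by_contra h
  exact hq (hs a o q ((P.prob_nonneg _ _ _ _).lt_of_ne (Ne.symm h)))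

/-- Mass that sits in `top` remains there under any action, which gives the base case; the recursion
preserves the inequality. -/
theorem horizonVal_le_succ {P : POMDP Q A O} {top : Q} (ht : P.Absorbing top) (k : ℕ) {b : Q → ℝ}
    (hb : 0 ≤ b) : P.horizonVal top k b ≤ P.horizonVal top (k + 1) b := by
  induction k generalizing b with
  | zero =>
    obtain ⟨a⟩ := ‹Nonempty A›
    refine le_trans ?_ (P.le_horizonVal_succ top 0 b a)
    calc b top = ∑ o, b top * P.prob top a o top := by
          rw [← Finset.mul_sum, ht.sum_prob_self, mul_one]
      _ ≤ _ := Finset.sum_le_sum fun o _ => Finset.single_le_sum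
          (f := fun q => b q * P.prob q a o top)
          (fun q _ => mul_nonneg (hb q) (P.prob_nonneg _ _ _ _)) (Finset.mem_univ top)
  | succ k ih =>
    exact P.horizonVal_succ_le fun a => le_trans
      (Finset.sum_le_sum fun o _ => ih (P.push_nonneg hb a o)) (P.le_horizonVal_succ top (k + 1) b a)

theorem monotone_horizonVal {P : POMDP Q A O} {top : Q} (ht : P.Absorbing top) {b : Q → ℝ}
    (hb : 0 ≤ b) : Monotone fun k => P.horizonVal top k b :=
  monotone_nat_of_le_succ fun k => horizonVal_le_succ ht k hb

/-! ### The probability of being in `top` after `k` steps, under a strategy -/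

/-- The strategy `σ` after its first action and observation. -/
def Strategy.tail (σ : Strategy A O) (m : A × O) : Strategy A O := fun w => σ (m :: w)

/-- The probability, under `σ`, of being in `top` after `k` steps. -/
noncomputable def stratVal (P : POMDP Q A O) (top : Q) : ℕ → Strategy A O → (Q → ℝ) → ℝ
  | 0, _, b => b top
  | k + 1, σ, b => ∑ a, (σ [] a).toReal * ∑ o, P.stratVal top k (Strategy.tail σ (a, o)) (P.push b a o)

theorem sum_strategy (σ : Strategy A O) (w : List (A × O)) : ∑ a, (σ w a).toReal = 1 := by
  have h := (σ w).tsum_coe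
  rw [tsum_fintype] at h
  rw [← ENNReal.toReal_sum (fun x _ => PMF.apply_ne_top _ _), h, ENNReal.toReal_one]

theorem stratVal_smul (P : POMDP Q A O) (top : Q) (k : ℕ) (σ : Strategy A O) (r : ℝ) (b : Q → ℝ) :
    P.stratVal top k σ (r • b) = r * P.stratVal top k σ b := by
  induction k generalizing σ b with
  | zero => simp [stratVal]
  | succ k ih =>
    simp only [stratVal, push_smul, ih, ← Finset.mul_sum]
    rw [Finset.mul_sum]
    exact Finset.sum_congr rfl fun a _ => by ring

theorem stratVal_nonneg (P : POMDP Q A O) (top : Q) (k : ℕ) (σ : Strategy A O) {b : Q → ℝ}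
    (hb : 0 ≤ b) : 0 ≤ P.stratVal top k σ b := by
  induction k generalizing σ b with
  | zero => exact hb top
  | succ k ih =>
    exact Finset.sum_nonneg fun a _ => mul_nonneg ENNReal.toReal_nonneg
      (Finset.sum_nonneg fun o _ => ih _ (P.push_nonneg hb a o))

theorem stratVal_le (P : POMDP Q A O) (top : Q) (k : ℕ) (σ : Strategy A O) (b : Q → ℝ) :
    P.stratVal top k σ b ≤ P.horizonVal top k b := by
  induction k generalizing σ b with
  | zero => exact le_rfl
  | succ k ih =>
    calc P.stratVal top (k + 1) σ b
        ≤ ∑ a, (σ [] a).toReal * P.horizonVal top (k + 1) b :=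
          Finset.sum_le_sum fun a _ => mul_le_mul_of_nonneg_left
            ((Finset.sum_le_sum fun o _ => ih _ _).trans (P.le_horizonVal_succ top k b a))
            ENNReal.toReal_nonneg
      _ = _ := by rw [← Finset.sum_mul, sum_strategy, one_mul]

/-- An optimal first action is followed by optimal strategies for the updated sub-beliefs. They can
be glued because the observation, being seen, may select the strategy. -/
theorem exists_stratVal_eq (P : POMDP Q A O) (top : Q) (k : ℕ) (b : Q → ℝ) :
    ∃ σ, P.stratVal top k σ b = P.horizonVal top k b := by
  classical
  induction k generalizing b with
  | zero =>
    obtain ⟨a⟩ := ‹Nonempty A›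
    exact ⟨fun _ => PMF.pure a, rfl⟩
  | succ k ih =>
    obtain ⟨a, ha⟩ := exists_eq_ciSup_of_finite
      (f := fun a => ∑ o, P.horizonVal top k (P.push b a o))
    choose τ hτ using fun o => ih (P.push b a o)
    let σ : Strategy A O := fun w => match w with
      | [] => PMF.pure a
      | (_, o) :: w => τ o w
    refine ⟨σ, ?_⟩
    have hσ (a' : A) : (σ [] a').toReal = if a' = a then 1 else 0 := by
      simp only [σ, PMF.pure_apply]
      split_ifs <;> simp
    rw [stratVal, horizonVal, ← ha]
    simp only [hσ, ite_mul, one_mul, zero_mul, Finset.sum_ite_eq', Finset.mem_univ, if_true]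
    exact Finset.sum_congr rfl fun o _ => hτ o

/-! ### Values of beliefs as limits of finite-horizon values -/

/-- The run `ρ` without its first step. -/
def Run.tail (ρ : Run Q A O) : Run Q A O := ⟨fun i => ρ.state (i + 1), fun i => ρ.move (i + 1)⟩

/-- The run `ρ`, preceded by the state `q` and the move `m`. -/
def Run.cons (q : Q) (m : A × O) (ρ : Run Q A O) : Run Q A O :=
  ⟨fun i => Nat.casesOn i q ρ.state, fun i => Nat.casesOn i m ρ.move⟩

theorem measurableSet_cyl (h : Run Q A O) (n : ℕ) : MeasurableSet (cyl h n) :=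
  MeasurableSpace.measurableSet_generateFrom ⟨h, n, rfl⟩

theorem mem_cyl_cons {q : Q} {m : A × O} {h ρ : Run Q A O} {n : ℕ} :
    ρ ∈ cyl (Run.cons q m h) (n + 1) ↔ ρ.state 0 = q ∧ ρ.move 0 = m ∧ ρ.tail ∈ cyl h n := by
  constructor
  · rintro ⟨h1, h2⟩
    exact ⟨h1 0 (by omega), h2 0 (by omega), fun i hi => h1 (i + 1) (by omega),
      fun i hi => h2 (i + 1) (by omega)⟩
  · rintro ⟨h1, h2, h3, h4⟩
    refine ⟨fun i hi => ?_, fun i hi => ?_⟩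
    · cases i with
      | zero => exact h1
      | succ i => exact h3 i (by omega)
    · cases i with
      | zero => exact h2
      | succ i => exact h4 i (by omega)

theorem preimage_tail_cyl (h : Run Q A O) (n : ℕ) (m : A × O) :
    Run.tail ⁻¹' cyl h n ∩ {ρ | ρ.move 0 = m} = ⋃ q, cyl (Run.cons q m h) (n + 1) := by
  ext ρ
  simp only [Set.mem_inter_iff, Set.mem_preimage, Set.mem_iUnion, mem_cyl_cons, Set.mem_ofPred_eq]
  tauto

theorem measurable_tail : Measurable (Run.tail : Run Q A O → Run Q A O) := by
  refine measurable_generateFrom ?_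
  rintro _ ⟨h, n, rfl⟩
  have : Run.tail ⁻¹' cyl h n = ⋃ m : A × O, ⋃ q, cyl (Run.cons q m h) (n + 1) := by
    ext ρ
    simp only [Set.mem_preimage, Set.mem_iUnion, mem_cyl_cons]
    exact ⟨fun h => ⟨_, _, rfl, rfl, h⟩, fun ⟨_, _, _, _, h⟩ => h⟩
  rw [this]
  exact MeasurableSet.iUnion fun m => MeasurableSet.iUnion fun q => measurableSet_cyl _ _

theorem measurableSet_state_zero (q : Q) : MeasurableSet {ρ : Run Q A O | ρ.state 0 = q} := by
  rcases isEmpty_or_nonempty (Run Q A O) with h | ⟨⟨ρ₀⟩⟩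
  · exact Subsingleton.measurableSet
  · convert measurableSet_cyl (⟨fun _ => q, ρ₀.move⟩ : Run Q A O) 0
    ext ρ
    simp [cyl]

theorem measurableSet_move_zero (m : A × O) : MeasurableSet {ρ : Run Q A O | ρ.move 0 = m} := by
  rcases isEmpty_or_nonempty (Run Q A O) with h | ⟨⟨ρ₀⟩⟩
  · exact Subsingleton.measurableSet
  · have : {ρ : Run Q A O | ρ.move 0 = m} =
        ⋃ q, ⋃ q', cyl (Run.cons q m ⟨fun _ => q', ρ₀.move⟩) (0 + 1) := by
      ext ρ
      simp only [Set.mem_ofPred_eq, Set.mem_iUnion, mem_cyl_cons]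
      refine ⟨fun h => ⟨ρ.state 0, ρ.state 1, rfl, h, ?_, ?_⟩, fun ⟨_, _, _, h, _⟩ => h⟩
      · intro i hi
        obtain rfl : i = 0 := by omega
        rfl
      · intro i hi
        omega
    rw [this]
    exact MeasurableSet.iUnion fun q => MeasurableSet.iUnion fun q' => measurableSet_cyl _ _

theorem histProb_cons (P : POMDP Q A O) (σ : Strategy A O) (b : Q → ℝ) (q : Q) (m : A × O)
    (h : Run Q A O) (n : ℕ) :
    P.histProb σ b (Run.cons q m h) (n + 1) =
      P.histProb (Strategy.tail σ m) (fun q' => (σ [] m.1).toReal * (b q * P.prob q m.1 m.2 q')) h n := by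
  induction n with
  | zero =>
    simp only [histProb, obsHist, List.ofFn_zero]
    change b q * (σ [] m.1).toReal * P.prob q m.1 m.2 (h.state 0) = _
    ring
  | succ n ih =>
    rw [histProb, ih, histProb]
    have : obsHist (Run.cons q m h) (n + 1) = m :: obsHist h n := by
      simp only [obsHist, List.ofFn_succ]
      rfl
    rw [this]
    rfl

theorem histProb_sum (P : POMDP Q A O) (σ : Strategy A O) (b : Q → Q → ℝ) (h : Run Q A O) (n : ℕ) :
    P.histProb σ (fun q' => ∑ q, b q q') h n = ∑ q, P.histProb σ (b q) h n := by
  induction n with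
  | zero => simp [histProb]
  | succ n ih => simp only [histProb, ih, Finset.sum_mul]

theorem histProb_nonneg (P : POMDP Q A O) (σ : Strategy A O) {b : Q → ℝ} (hb : 0 ≤ b)
    (h : Run Q A O) (n : ℕ) : 0 ≤ P.histProb σ b h n := by
  induction n with
  | zero => exact hb _
  | succ n ih => exact mul_nonneg (mul_nonneg ih ENNReal.toReal_nonneg) (P.prob_nonneg _ _ _ _)

/-- Markov property: restricting to a first move and deleting it yields again a run measure, from
the unnormalised update weighted by the probability of choosing the action. Inductions on time rest
on it. -/
theorem IsRunMeasure.tail {P : POMDP Q A O} {σ : Strategy A O} {b : Q → ℝ} (hb : 0 ≤ b)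
    {μ : Measure (Run Q A O)} (hμ : P.IsRunMeasure σ b μ) (a : A) (o : O) :
    P.IsRunMeasure (Strategy.tail σ (a, o)) ((σ [] a).toReal • P.push b a o)
      ((μ.restrict {ρ | ρ.move 0 = (a, o)}).map Run.tail) := by
  intro h n
  rw [Measure.map_apply measurable_tail (measurableSet_cyl _ _),
    Measure.restrict_apply (measurable_tail (measurableSet_cyl _ _)), preimage_tail_cyl,
    measure_iUnion, tsum_fintype]
  · simp only [hμ _ _, histProb_cons]
    rw [← ENNReal.ofReal_sum_of_nonneg, ← histProb_sum]
    · congr 2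
      ext q
      simp [push, Finset.mul_sum]
    · exact fun q _ => P.histProb_nonneg _ (fun q' => mul_nonneg ENNReal.toReal_nonneg
        (mul_nonneg (hb q) (P.prob_nonneg _ _ _ _))) _ _
  · intro q q' hqq
    rw [Function.onFun, Set.disjoint_left]
    intro ρ h1 h2
    exact hqq ((mem_cyl_cons.1 h1).1.symm.trans (mem_cyl_cons.1 h2).1)
  · exact fun q => measurableSet_cyl _ _

theorem measure_preimage_tail (μ : Measure (Run Q A O)) {E : Set (Run Q A O)}
    (hE : MeasurableSet E) :
    μ (Run.tail ⁻¹' E) = ∑ a, ∑ o, (μ.restrict {ρ | ρ.move 0 = (a, o)}).map Run.tail E := by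
  rw [← Fintype.sum_prod_type' (f := fun a o => (μ.restrict {ρ | ρ.move 0 = (a, o)}).map Run.tail E)]
  have h : Run.tail ⁻¹' E = ⋃ m : A × O, Run.tail ⁻¹' E ∩ {ρ | ρ.move 0 = m} := by
    ext ρ
    simp
  have hE' := measurable_tail hE
  conv_lhs => rw [h]
  rw [measure_iUnion, tsum_fintype]
  · exact Finset.sum_congr rfl fun m _ => by
      rw [Measure.map_apply measurable_tail hE, Measure.restrict_apply hE']
  · intro m m' hmm
    rw [Function.onFun, Set.disjoint_left]
    intro ρ h1 h2
    exact hmm (h1.2.symm.trans h2.2)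
  · exact fun m => hE'.inter (measurableSet_move_zero m)

theorem measurableSet_state (k : ℕ) (q : Q) : MeasurableSet {ρ : Run Q A O | ρ.state k = q} := by
  induction k with
  | zero => exact measurableSet_state_zero q
  | succ k ih => exact measurable_tail ih

theorem IsRunMeasure.measure_state {P : POMDP Q A O} {σ : Strategy A O} {b : Q → ℝ} (hb : 0 ≤ b)
    {μ : Measure (Run Q A O)} (hμ : P.IsRunMeasure σ b μ) (top : Q) (k : ℕ) :
    μ {ρ | ρ.state k = top} = ENNReal.ofReal (P.stratVal top k σ b) := by
  induction k generalizing σ b μ with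
  | zero =>
    obtain ⟨a⟩ := ‹Nonempty A›
    obtain ⟨x, -⟩ := (P.trans top a).support_nonempty
    have := hμ ⟨fun _ => top, fun _ => (a, x.1)⟩ 0
    simpa [cyl, histProb, stratVal] using this
  | succ k ih =>
    have h1 := measure_preimage_tail μ (measurableSet_state k top)
    have h2 (a : A) (o : O) := ih (smul_nonneg ENNReal.toReal_nonneg (P.push_nonneg hb a o))
      (hμ.tail hb a o)
    have h3 (a : A) (o : O) : 0 ≤ (σ [] a).toReal *
        P.stratVal top k (Strategy.tail σ (a, o)) (P.push b a o) :=
      mul_nonneg ENNReal.toReal_nonneg (P.stratVal_nonneg _ _ _ (P.push_nonneg hb a o))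
    change μ (Run.tail ⁻¹' {ρ | ρ.state k = top}) = _
    simp only [h1, h2, stratVal_smul]
    rw [stratVal, ENNReal.ofReal_sum_of_nonneg fun a _ => by
      rw [Finset.mul_sum]; exact Finset.sum_nonneg fun o _ => h3 a o]
    refine Finset.sum_congr rfl fun a _ => ?_
    rw [Finset.mul_sum, ENNReal.ofReal_sum_of_nonneg fun o _ => h3 a o]

theorem IsRunMeasure.measure_leave {P : POMDP Q A O} {σ : Strategy A O} {b : Q → ℝ} (hb : 0 ≤ b)
    {μ : Measure (Run Q A O)} (hμ : P.IsRunMeasure σ b μ) {top : Q} (ht : P.Absorbing top) (k : ℕ) :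
    μ ({ρ | ρ.state k = top} \ {ρ | ρ.state (k + 1) = top}) = 0 := by
  induction k generalizing σ b μ with
  | zero =>
    have h : {ρ : Run Q A O | ρ.state 0 = top} \ {ρ | ρ.state (0 + 1) = top} ⊆
        ⋃ m : A × O, ⋃ q : {q // q ≠ top},
          cyl (Run.cons top m ⟨fun _ => q.1, fun _ => m⟩) (0 + 1) := by
      rintro ρ ⟨h1, h2⟩
      simp only [Set.mem_iUnion, mem_cyl_cons]
      refine ⟨ρ.move 0, ⟨ρ.state 1, h2⟩, h1, rfl, fun i hi => ?_, fun i hi => ?_⟩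
      · obtain rfl : i = 0 := by omega
        rfl
      · omega
    refine measure_mono_null h (measure_iUnion_null fun m => measure_iUnion_null fun q => ?_)
    rw [hμ, histProb_cons, histProb, ENNReal.ofReal_eq_zero]
    have : P.prob top m.1 m.2 q = 0 := by
      by_contra h'
      exact q.2 (ht _ _ _ ((P.prob_nonneg _ _ _ _).lt_of_ne (Ne.symm h')))
    simp [this]
  | succ k ih =>
    have hm : MeasurableSet ({ρ : Run Q A O | ρ.state k = top} \ {ρ | ρ.state (k + 1) = top}) :=
      (measurableSet_state k top).diff (measurableSet_state (k + 1) top)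
    change μ (Run.tail ⁻¹' ({ρ | ρ.state k = top} \ {ρ | ρ.state (k + 1) = top})) = 0
    rw [measure_preimage_tail μ hm]
    exact Finset.sum_eq_zero fun a _ => Finset.sum_eq_zero fun o _ =>
      ih (smul_nonneg ENNReal.toReal_nonneg (P.push_nonneg hb a o)) (hμ.tail hb a o)

theorem IsRunMeasure.measure_reach {P : POMDP Q A O} {σ : Strategy A O} {b : Q → ℝ} (hb : 0 ≤ b)
    {μ : Measure (Run Q A O)} (hμ : P.IsRunMeasure σ b μ) {top : Q} (ht : P.Absorbing top) :
    μ (reach {top}) = ⨆ k, ENNReal.ofReal (P.stratVal top k σ b) := by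
  have h : reach {top} = ⋃ k, {ρ : Run Q A O | ρ.state k = top} := by
    ext ρ
    simp [reach]
  rw [h]
  refine le_antisymm ?_ (iSup_le fun k => ?_)
  · rw [measure_iUnion_eq_iSup_accumulate]
    refine iSup_mono fun k => ?_
    rw [← hμ.measure_state hb]
    -- The events "in `top` at time `k`" increase with `k` up to the null set of runs that leave
    -- `top`.
    have hsub : Set.accumulate (fun k => {ρ : Run Q A O | ρ.state k = top}) k ⊆
        {ρ | ρ.state k = top} ∪
          ⋃ i, {ρ : Run Q A O | ρ.state i = top} \ {ρ | ρ.state (i + 1) = top} := by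
      intro ρ hρ
      obtain ⟨i, hik, hi⟩ := Set.mem_accumulate.1 hρ
      by_contra hc
      simp only [Set.mem_union, Set.mem_iUnion, Set.mem_sdiff, Set.mem_ofPred_eq, not_or, not_exists,
        not_and, not_not] at hc
      exact hc.1 (Nat.le_induction (P := fun j _ => ρ.state j = top) hi (fun j _ => hc.2 j) k hik)
    refine (measure_mono hsub).trans ((measure_union_le _ _).trans_eq ?_)
    rw [measure_iUnion_null fun i => hμ.measure_leave hb ht i, add_zero]
  · rw [← hμ.measure_state hb]
    exact measure_mono (Set.subset_iUnion (fun k => {ρ : Run Q A O | ρ.state k = top}) k)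

theorem reach_real_le {P : POMDP Q A O} {top : Q} (ht : P.Absorbing top) {b : Q → ℝ} (hb : 0 ≤ b)
    {M : ℝ} (hM : ∀ k, P.horizonVal top k b ≤ M) (σ : Strategy A O) :
    (P.runMeasure σ b).real (reach {top}) ≤ M := by
  refine ENNReal.toReal_le_of_le_ofReal ((P.horizonVal_nonneg top 0 hb).trans (hM 0)) ?_
  rw [(P.isRunMeasure_runMeasure σ b hb).measure_reach hb ht]
  exact iSup_le fun k => ENNReal.ofReal_le_ofReal ((P.stratVal_le top k σ b).trans (hM k))

/-- The suprema over strategies and over horizons commute: every strategy is dominated at each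
horizon, and each finite-horizon optimum is attained. -/
theorem isLUB_val {P : POMDP Q A O} {top : Q} (ht : P.Absorbing top) {b : Q → ℝ} (hb : 0 ≤ b) :
    IsLUB (Set.range fun k => P.horizonVal top k b) (P.val {top} b) := by
  have : Nonempty (Strategy A O) := ⟨fun _ => PMF.pure (Classical.arbitrary A)⟩
  constructor
  · rintro _ ⟨k, rfl⟩
    obtain ⟨σ, hσ⟩ := P.exists_stratVal_eq top k b
    have hle := reach_real_le ht hb fun k => P.horizonVal_le_mass top k hb
    refine le_trans ?_ (le_ciSup (f := fun σ => (P.runMeasure σ b).real (reach {top}))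
      ⟨mass b, by rintro _ ⟨σ, rfl⟩; exact hle σ⟩ σ)
    have h := (P.isRunMeasure_runMeasure σ b hb).measure_reach hb ht
    have hfin : P.runMeasure σ b (reach {top}) ≠ ⊤ := by
      rw [h]
      exact ne_top_of_le_ne_top ENNReal.ofReal_ne_top (iSup_le fun k => ENNReal.ofReal_le_ofReal
        ((P.stratVal_le top k σ b).trans (P.horizonVal_le_mass top k hb)))
    refine (ENNReal.ofReal_le_iff_le_toReal hfin).1 ?_
    rw [h]
    change ENNReal.ofReal (P.horizonVal top k b) ≤ _
    rw [← hσ]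
    exact le_iSup (fun k => ENNReal.ofReal (P.stratVal top k σ b)) k
  · exact fun M hM => ciSup_le fun σ => reach_real_le ht hb (fun k => hM ⟨k, rfl⟩) σ

/-! ### Sublinearity and Bellman inequalities of the value -/

section Val

variable {P : POMDP Q A O} {top : Q} (ht : P.Absorbing top)
include ht

theorem horizonVal_le_val {b : Q → ℝ} (hb : 0 ≤ b) (k : ℕ) :
    P.horizonVal top k b ≤ P.val {top} b :=
  (isLUB_val ht hb).1 ⟨k, rfl⟩

theorem val_le_of_horizonVal_le {b : Q → ℝ} (hb : 0 ≤ b) {M : ℝ}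
    (hM : ∀ k, P.horizonVal top k b ≤ M) : P.val {top} b ≤ M :=
  (isLUB_val ht hb).2 (by rintro _ ⟨k, rfl⟩; exact hM k)

theorem tendsto_horizonVal {b : Q → ℝ} (hb : 0 ≤ b) :
    Filter.Tendsto (fun k => P.horizonVal top k b) Filter.atTop (nhds (P.val {top} b)) :=
  tendsto_atTop_isLUB (monotone_horizonVal ht hb) (isLUB_val ht hb)

theorem val_nonneg {b : Q → ℝ} (hb : 0 ≤ b) : 0 ≤ P.val {top} b :=
  (P.horizonVal_nonneg top 0 hb).trans (horizonVal_le_val ht hb 0)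

theorem val_le_mass {b : Q → ℝ} (hb : 0 ≤ b) : P.val {top} b ≤ mass b :=
  val_le_of_horizonVal_le ht hb fun k => P.horizonVal_le_mass top k hb

theorem val_mono {b c : Q → ℝ} (hb : 0 ≤ b) (h : b ≤ c) : P.val {top} b ≤ P.val {top} c :=
  val_le_of_horizonVal_le ht hb fun k =>
    (P.horizonVal_mono top k h).trans (horizonVal_le_val ht (hb.trans h) k)

theorem val_smul {b : Q → ℝ} (hb : 0 ≤ b) {r : ℝ} (hr : 0 ≤ r) :
    P.val {top} (r • b) = r * P.val {top} b := by
  refine tendsto_nhds_unique (tendsto_horizonVal ht (smul_nonneg hr hb)) ?_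
  simp only [P.horizonVal_smul top _ hr]
  exact (tendsto_horizonVal ht hb).const_mul r

theorem val_zero : P.val {top} 0 = 0 := by
  have := val_smul ht (P := P) (le_refl (0 : Q → ℝ)) (le_refl (0 : ℝ))
  simpa using this

theorem val_add_le {b c : Q → ℝ} (hb : 0 ≤ b) (hc : 0 ≤ c) :
    P.val {top} (b + c) ≤ P.val {top} b + P.val {top} c :=
  val_le_of_horizonVal_le ht (add_nonneg hb hc) fun k => (P.horizonVal_add_le top k b c).trans
    (add_le_add (horizonVal_le_val ht hb k) (horizonVal_le_val ht hc k))

theorem val_sum_le {ι : Type*} (s : Finset ι) {d : ι → Q → ℝ} (hd : ∀ i, 0 ≤ d i) :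
    P.val {top} (∑ i ∈ s, d i) ≤ ∑ i ∈ s, P.val {top} (d i) := by
  classical
  induction s using Finset.induction_on with
  | empty => simp [val_zero ht]
  | insert i s hi ih =>
    rw [Finset.sum_insert hi, Finset.sum_insert hi]
    exact (val_add_le ht (hd i) (Finset.sum_nonneg fun i _ => hd i)).trans (by gcongr)

theorem sum_val_push_le {b : Q → ℝ} (hb : 0 ≤ b) (a : A) :
    ∑ o, P.val {top} (P.push b a o) ≤ P.val {top} b :=
  le_of_tendsto' (tendsto_finsetSum _ fun o _ => tendsto_horizonVal ht (P.push_nonneg hb a o))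
    fun k => (P.le_horizonVal_succ top k b a).trans (horizonVal_le_val ht hb (k + 1))

theorem val_le_of_sum_val_push_le {b : Q → ℝ} (hb : 0 ≤ b) {M : ℝ}
    (hM : ∀ a, ∑ o, P.val {top} (P.push b a o) ≤ M) : P.val {top} b ≤ M := by
  refine val_le_of_horizonVal_le ht hb fun k => (horizonVal_le_succ ht k hb).trans ?_
  exact P.horizonVal_succ_le fun a => le_trans
    (Finset.sum_le_sum fun o _ => horizonVal_le_val ht (P.push_nonneg hb a o) k) (hM a)

theorem val_eq_mass_of_supp_eq {b : Q → ℝ} (hb : 0 ≤ b) (h : supp b ⊆ {top}) :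
    P.val {top} b = mass b := by
  refine le_antisymm (val_le_mass ht hb) (le_trans ?_ (horizonVal_le_val ht hb 0))
  rw [mass, Finset.sum_eq_single top _ (by simp)]
  · rfl
  · intro q _ hq
    by_contra h'
    exact hq (h ((hb q).lt_of_ne (Ne.symm h')))

end Val

/-! ### Supports -/

theorem supp_zero : supp (0 : Q → ℝ) = ∅ := by
  ext q
  simp [supp]

theorem eq_zero_of_notMem_supp {b : Q → ℝ} (hb : 0 ≤ b) {q : Q} (h : q ∉ supp b) : b q = 0 := by
  by_contra h'
  exact h ((hb q).lt_of_ne (Ne.symm h'))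

theorem eq_zero_of_supp_eq_empty {b : Q → ℝ} (hb : 0 ≤ b) (h : supp b = ∅) : b = 0 := by
  ext q
  exact eq_zero_of_notMem_supp hb (by simp [h])

theorem supp_smul {r : ℝ} (hr : 0 < r) (b : Q → ℝ) : supp (r • b) = supp b := by
  ext q
  simp [supp, mul_pos_iff_of_pos_left hr]

theorem supp_push (P : POMDP Q A O) {b : Q → ℝ} (hb : 0 ≤ b) (a : A) (o : O) :
    supp (P.push b a o) = P.succ (supp b) a o := by
  ext q
  simp only [supp, push, succ, Set.mem_ofPred_eq]
  rw [Finset.sum_pos_iff_of_nonneg fun q' _ => mul_nonneg (hb q') (P.prob_nonneg _ _ _ _)]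
  simp only [Finset.mem_univ, true_and]
  refine exists_congr fun q' => ⟨fun h => ?_, fun h => mul_pos h.1 h.2⟩
  exact ⟨pos_of_mul_pos_left h (P.prob_nonneg _ _ _ _), pos_of_mul_pos_right h (hb q')⟩

theorem supp_update (P : POMDP Q A O) {b : Q → ℝ} (hb : 0 ≤ b) (a : A) (o : O) :
    supp (P.update b a o) = P.succ (supp b) a o := by
  rw [← supp_push P hb, update_eq]
  by_cases h : P.push b a o = 0
  · rw [h, smul_zero]
  · have hb' : b ≠ 0 := by
      rintro rfl
      exact h (P.push_zero a o)
    exact supp_smul (div_pos (mass_pos hb hb') (mass_pos (P.push_nonneg hb a o) h)) _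

theorem updates_nonneg (P : POMDP Q A O) {b : Q → ℝ} (hb : 0 ≤ b) (h : List (A × O)) :
    0 ≤ P.updates b h := by
  induction h generalizing b with
  | nil => exact hb
  | cons m h ih => exact ih (P.update_nonneg hb _ _)

theorem supp_updates (P : POMDP Q A O) {b : Q → ℝ} (hb : 0 ≤ b) (h : List (A × O)) :
    supp (P.updates b h) = P.succs (supp b) h := by
  induction h generalizing b with
  | nil => rfl
  | cons m h ih =>
    change supp (P.updates (P.update b m.1 m.2) h) = P.succs (P.succ (supp b) m.1 m.2) h
    rw [ih (P.update_nonneg hb _ _), supp_update P hb]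

theorem updates_append (P : POMDP Q A O) (b : Q → ℝ) (h g : List (A × O)) :
    P.updates b (h ++ g) = P.updates (P.updates b h) g :=
  List.foldl_append

theorem succs_append (P : POMDP Q A O) (S : Set Q) (h g : List (A × O)) :
    P.succs S (h ++ g) = P.succs (P.succs S h) g :=
  List.foldl_append

theorem succs_cons (P : POMDP Q A O) (S : Set Q) (a : A) (o : O) (h : List (A × O)) :
    P.succs S ((a, o) :: h) = P.succs (P.succ S a o) h :=
  rfl

theorem succ_mono (P : POMDP Q A O) {S T : Set Q} (h : S ⊆ T) (a : A) (o : O) :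
    P.succ S a o ⊆ P.succ T a o :=
  fun _ ⟨q, hq, hp⟩ => ⟨q, h hq, hp⟩

theorem succs_mono (P : POMDP Q A O) {S T : Set Q} (hST : S ⊆ T) (h : List (A × O)) :
    P.succs S h ⊆ P.succs T h := by
  induction h generalizing S T with
  | nil => exact hST
  | cons m h ih => exact ih (P.succ_mono hST _ _)

theorem succs_subset_of_absorbing {P : POMDP Q A O} {s : Q} (hs : P.Absorbing s)
    (h : List (A × O)) : P.succs {s} h ⊆ {s} := by
  induction h with
  | nil => exact subset_rfl
  | cons m h ih =>
    refine (P.succs_mono ?_ h).trans ih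
    rintro q ⟨_, rfl, hq⟩
    exact hs _ _ _ hq

/-! ### The next state, under posterior determinism -/

open Classical in
/-- The next state after `q`, `a` and `o` (`q` itself if the observation is impossible). -/
noncomputable def next (P : POMDP Q A O) (q : Q) (a : A) (o : O) : Q :=
  if h : ∃ q', 0 < P.prob q a o q' then h.choose else q

/-- The state that is reached from `q` after an observable history. -/
noncomputable def nexts (P : POMDP Q A O) (q : Q) (h : List (A × O)) : Q :=
  h.foldl (fun q ao => P.next q ao.1 ao.2) q

theorem nexts_append (P : POMDP Q A O) (q : Q) (h g : List (A × O)) :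
    P.nexts q (h ++ g) = P.nexts (P.nexts q h) g :=
  List.foldl_append

theorem nexts_cons (P : POMDP Q A O) (q : Q) (a : A) (o : O) (h : List (A × O)) :
    P.nexts q ((a, o) :: h) = P.nexts (P.next q a o) h :=
  rfl

section PosteriorDeterministic

variable {P : POMDP Q A O} (hP : P.PosteriorDeterministic)
include hP

theorem next_eq {q : Q} {a : A} {o : O} {q' : Q} (h : 0 < P.prob q a o q') : P.next q a o = q' := by
  have h' : ∃ q', 0 < P.prob q a o q' := ⟨q', h⟩
  rw [next, dif_pos h']
  exact hP _ _ _ _ _ h'.choose_spec h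

theorem obsProb_eq {q : Q} {a : A} {o : O} {q' : Q} (h : 0 < P.prob q a o q') :
    P.obsProb q a o = P.prob q a o q' := by
  refine Finset.sum_eq_single q' (fun x _ hx => ?_) (by simp)
  by_contra h'
  exact hx (hP _ _ _ _ _ ((P.prob_nonneg _ _ _ _).lt_of_ne (Ne.symm h')) h)

theorem succ_singleton {q : Q} {a : A} {o : O} {q' : Q} (h : 0 < P.prob q a o q') :
    P.succ {q} a o = {q'} := by
  ext x
  constructor
  · rintro ⟨_, rfl, hx⟩
    exact hP _ _ _ _ _ hx h
  · rintro rfl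
    exact ⟨q, rfl, h⟩

theorem ncard_succ_le (S : Set Q) (a : A) (o : O) : (P.succ S a o).ncard ≤ S.ncard := by
  have h : P.succ S a o ⊆ (fun q => P.next q a o) '' S := by
    rintro x ⟨q, hq, hx⟩
    exact ⟨q, hq, next_eq hP hx⟩
  exact (Set.ncard_le_ncard h).trans (Set.ncard_image_le)

theorem ncard_succs_le (S : Set Q) (h : List (A × O)) : (P.succs S h).ncard ≤ S.ncard := by
  induction h generalizing S with
  | nil => exact le_rfl
  | cons m h ih => exact (ih _).trans (ncard_succ_le hP _ _ _)

/-- The successor support is the image of `S` under a partial function. If it is not smaller than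
`S`, that function is total and injective on `S`. -/
theorem image_next_of_ncard_le {S : Set Q} {a : A} {o : O} (h : S.ncard ≤ (P.succ S a o).ncard) :
    (∀ q ∈ S, 0 < P.prob q a o (P.next q a o)) ∧ Set.InjOn (fun q => P.next q a o) S := by
  let S₀ : Set Q := {q ∈ S | ∃ q', 0 < P.prob q a o q'}
  have h₀ : P.succ S a o = (fun q => P.next q a o) '' S₀ := by
    ext x
    constructor
    · rintro ⟨q, hq, hx⟩
      exact ⟨q, ⟨hq, x, hx⟩, next_eq hP hx⟩
    · rintro ⟨q, ⟨hq, x', hx'⟩, rfl⟩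
      refine ⟨q, hq, ?_⟩
      change 0 < P.prob q a o (P.next q a o)
      rwa [next_eq hP hx']
  have h₁ : (P.succ S a o).ncard ≤ S₀.ncard := h₀ ▸ Set.ncard_image_le
  have h₂ : S₀ = S := Set.eq_of_subset_of_ncard_le (fun q hq => hq.1) (h.trans h₁)
  refine ⟨fun q hq => ?_, ?_⟩
  · rw [← h₂] at hq
    obtain ⟨x, hx⟩ := hq.2
    rwa [next_eq hP hx]
  · rw [← h₂]
    refine Set.injOn_of_ncard_image_eq ?_
    rw [← h₀]
    exact le_antisymm h₁ (h₂ ▸ h)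

end PosteriorDeterministic

/-! ### Histories inside a support end component -/

theorem follows_append (P : POMDP Q A O) (f : Set Q → Set A) (S : Set Q) (h g : List (A × O)) :
    P.Follows f S (h ++ g) ↔ P.Follows f S h ∧ P.Follows f (P.succs S h) g := by
  induction h generalizing S with
  | nil => simp [Follows, succs]
  | cons m h ih =>
    obtain ⟨a, o⟩ := m
    simp only [List.cons_append, Follows, ih, succs_cons]
    tauto

theorem Follows.mono {P : POMDP Q A O} {f g : Set Q → Set A} (hfg : ∀ S, f S ⊆ g S) {S : Set Q}
    {h : List (A × O)} (hf : P.Follows f S h) : P.Follows g S h := by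
  induction h generalizing S with
  | nil => trivial
  | cons m h ih => exact ⟨hfg _ hf.1, hf.2.1, ih hf.2.2⟩

theorem IsSEC.succs_mem {P : POMDP Q A O} {f : Set Q → Set A} (hf : P.IsSEC f) {S : Set Q}
    (hS : S ∈ dom f) {h : List (A × O)} (hh : P.Follows f S h) : P.succs S h ∈ dom f := by
  induction h generalizing S with
  | nil => exact hS
  | cons m h ih => exact ih (hf.closed S hS _ hh.1 _ hh.2.1) hh.2.2

section SEC

variable {P : POMDP Q A O} (hP : P.PosteriorDeterministic) {f : Set Q → Set A} (hf : P.IsSEC f)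
include hP hf

/-- Connectedness leads from the successor back to `S`, and no update enlarges a support, so this
step did not shrink it. -/
theorem IsSEC.image_next {S : Set Q} (hS : S ∈ dom f) {a : A} (ha : a ∈ f S) {o : O}
    (hne : (P.succ S a o).Nonempty) :
    (∀ q ∈ S, 0 < P.prob q a o (P.next q a o)) ∧ Set.InjOn (fun q => P.next q a o) S := by
  refine image_next_of_ncard_le hP ?_
  obtain ⟨h, -, hh⟩ := hf.connected _ (hf.closed S hS a ha o hne) S hS
  conv_lhs => rw [← hh]
  exact ncard_succs_le hP _ _

theorem IsSEC.next_mem {S : Set Q} (hS : S ∈ dom f) {a : A} (ha : a ∈ f S) {o : O}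
    (hne : (P.succ S a o).Nonempty) {q : Q} (hq : q ∈ S) : P.next q a o ∈ P.succ S a o :=
  ⟨q, hq, (hf.image_next hP hS ha hne).1 q hq⟩

theorem IsSEC.succs_singleton {S : Set Q} (hS : S ∈ dom f) {h : List (A × O)}
    (hh : P.Follows f S h) {q : Q} (hq : q ∈ S) : P.succs {q} h = {P.nexts q h} := by
  induction h generalizing S q with
  | nil => rfl
  | cons m h ih =>
    obtain ⟨a, o⟩ := m
    rw [succs_cons, nexts_cons, succ_singleton hP ((hf.image_next hP hS hh.1 hh.2.1).1 q hq)]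
    exact ih (hf.closed S hS a hh.1 o hh.2.1) hh.2.2 (hf.next_mem hP hS hh.1 hh.2.1 hq)

theorem IsSEC.nexts_mem {S : Set Q} (hS : S ∈ dom f) {h : List (A × O)}
    (hh : P.Follows f S h) {q : Q} (hq : q ∈ S) : P.nexts q h ∈ P.succs S h := by
  refine P.succs_mono (Set.singleton_subset_iff.2 hq) h ?_
  rw [hf.succs_singleton hP hS hh hq]
  rfl

theorem IsSEC.injOn_nexts {S : Set Q} (hS : S ∈ dom f) {h : List (A × O)}
    (hh : P.Follows f S h) : Set.InjOn (fun q => P.nexts q h) S := by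
  induction h generalizing S with
  | nil => exact Function.injective_id.injOn
  | cons m h ih =>
    obtain ⟨a, o⟩ := m
    intro q hq q' hq' he
    have h1 {x : Q} (hx : x ∈ S) := hf.next_mem hP hS hh.1 hh.2.1 hx
    exact (hf.image_next hP hS hh.1 hh.2.1).2 hq hq'
      (ih (hf.closed S hS a hh.1 o hh.2.1) hh.2.2 (h1 hq) (h1 hq') he)

/-- A history inside a support end component can be continued until every state is back at its
initial position. -/
theorem IsSEC.exists_return {S : Set Q} (hS : S ∈ dom f) {h : List (A × O)}
    (hh : P.Follows f S h) :
    ∃ g, P.Follows f (P.succs S h) g ∧ P.succs (P.succs S h) g = S ∧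
      ∀ q ∈ S, P.nexts q (h ++ g) = q := by
  obtain ⟨g₀, hg₀, hg₀S⟩ := hf.connected _ (hf.succs_mem hS hh) S hS
  set w := h ++ g₀ with hw
  have hwS : P.succs S w = S := by rw [hw, succs_append, hg₀S]
  have hwf : P.Follows f S w := (P.follows_append f S h g₀).2 ⟨hh, hg₀⟩
  let F : Q → Q := fun q => P.nexts q w
  have hmaps : Set.MapsTo F S S := fun q hq => by
    have := hf.nexts_mem hP hS hwf hq
    rwa [hwS] at this
  have hinj : Function.Injective (hmaps.restrict F S S) :=
    hmaps.restrict_inj.2 (hf.injOn_nexts hP hS hwf)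
  -- The loop `w` permutes `S`, so repeating it as often as the order of this permutation fixes
  -- every state.
  let e : Equiv.Perm S := Equiv.ofBijective _ (Finite.injective_iff_bijective.1 hinj)
  have he (n : ℕ) (q : S) : ((e ^ n) q : Q) = F^[n] q := by
    induction n generalizing q with
    | zero => rfl
    | succ n ih => rw [pow_succ, Equiv.Perm.mul_apply, ih, Function.iterate_succ_apply]; rfl
  have hrep (n : ℕ) : P.Follows f S (List.replicate n w).flatten ∧
      P.succs S (List.replicate n w).flatten = S ∧
      ∀ q, P.nexts q (List.replicate n w).flatten = F^[n] q := by
    induction n with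
    | zero => exact ⟨trivial, rfl, fun _ => rfl⟩
    | succ n ih =>
      rw [List.replicate_succ, List.flatten_cons]
      refine ⟨(P.follows_append _ _ _ _).2 ⟨hwf, hwS.symm ▸ ih.1⟩, ?_, fun q => ?_⟩
      · rw [succs_append, hwS, ih.2.1]
      · rw [nexts_append, ih.2.2, Function.iterate_succ_apply]
  -- One of the `n + 1` loops is `h ++ g₀` itself, which leaves `n` of them for the continuation.
  obtain ⟨n, hn⟩ : ∃ n, orderOf e = n + 1 := Nat.exists_eq_succ_of_ne_zero (orderOf_pos e).ne'
  obtain ⟨hn1, hn2, -⟩ := hrep n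
  refine ⟨g₀ ++ (List.replicate n w).flatten, ?_, ?_, fun q hq => ?_⟩
  · exact (P.follows_append _ _ _ _).2 ⟨hg₀, hg₀S.symm ▸ hn1⟩
  · rw [succs_append, hg₀S, hn2]
  · rw [← List.append_assoc, ← hw, ← List.flatten_cons, ← List.replicate_succ, (hrep (n + 1)).2.2,
      ← he (n + 1) ⟨q, hq⟩, ← hn, pow_orderOf_eq_one]
    rfl

/-! ### Indistinguishability -/

theorem IsSEC.indist_iff {S : Set Q} (hS : S ∈ dom f) {q q' : Q} (hq : q ∈ S) (hq' : q' ∈ S) :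
    P.Indist f S q q' ↔ ∀ h, P.Follows f S h → ∀ a ∈ f (P.succs S h), ∀ o,
      P.obsProb (P.nexts q h) a o = P.obsProb (P.nexts q' h) a o := by
  refine forall₂_congr fun h hh => ?_
  rw [hf.succs_singleton hP hS hh hq, hf.succs_singleton hP hS hh hq']
  simp

theorem IsSEC.indist_refl {S : Set Q} (hS : S ∈ dom f) {q : Q} (hq : q ∈ S) :
    P.Indist f S q q :=
  (hf.indist_iff hP hS hq hq).2 fun _ _ _ _ _ => rfl

theorem IsSEC.indist_symm {S : Set Q} (hS : S ∈ dom f) {q q' : Q} (hq : q ∈ S) (hq' : q' ∈ S)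
    (h : P.Indist f S q q') : P.Indist f S q' q := by
  rw [hf.indist_iff hP hS hq hq'] at h
  exact (hf.indist_iff hP hS hq' hq).2 fun g hg a ha o => (h g hg a ha o).symm

theorem IsSEC.indist_trans {S : Set Q} (hS : S ∈ dom f) {q q' q'' : Q} (hq : q ∈ S) (hq' : q' ∈ S)
    (hq'' : q'' ∈ S) (h : P.Indist f S q q') (h' : P.Indist f S q' q'') : P.Indist f S q q'' := by
  rw [hf.indist_iff hP hS hq hq'] at h
  rw [hf.indist_iff hP hS hq' hq''] at h'
  exact (hf.indist_iff hP hS hq hq'').2 fun g hg a ha o => (h g hg a ha o).trans (h' g hg a ha o)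

theorem IsSEC.indist_nexts {S : Set Q} (hS : S ∈ dom f) {q q' : Q} (hq : q ∈ S) (hq' : q' ∈ S)
    {h : List (A × O)} (hh : P.Follows f S h) (hi : P.Indist f S q q') :
    P.Indist f (P.succs S h) (P.nexts q h) (P.nexts q' h) := by
  rw [hf.indist_iff hP hS hq hq'] at hi
  refine (hf.indist_iff hP (hf.succs_mem hS hh) (hf.nexts_mem hP hS hh hq)
    (hf.nexts_mem hP hS hh hq')).2 fun g hg a ha o => ?_
  rw [← nexts_append, ← nexts_append]
  exact hi (h ++ g) ((P.follows_append _ _ _ _).2 ⟨hh, hg⟩) a (by rwa [succs_append]) o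

/-- Indistinguishability passes to successors, and a history that returns every state to its place
carries it back. -/
theorem IsSEC.indist_of_nexts {S : Set Q} (hS : S ∈ dom f) {q q' : Q} (hq : q ∈ S) (hq' : q' ∈ S)
    {h : List (A × O)} (hh : P.Follows f S h)
    (hi : P.Indist f (P.succs S h) (P.nexts q h) (P.nexts q' h)) : P.Indist f S q q' := by
  obtain ⟨g, hg, hgS, hgq⟩ := hf.exists_return hP hS hh
  have := hf.indist_nexts hP (hf.succs_mem hS hh) (hf.nexts_mem hP hS hh hq)
    (hf.nexts_mem hP hS hh hq') hg hi
  rwa [hgS, ← nexts_append, ← nexts_append, hgq q hq, hgq q' hq'] at this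

/-- If a support end component is distinguishing, then it is so at each of its supports. -/
theorem IsSEC.exists_not_indist (hd : P.Distinguishing f) {T : Set Q} (hT : T ∈ dom f) :
    ∃ q ∈ T, ∃ q' ∈ T, ¬ P.Indist f T q q' := by
  obtain ⟨S, hS, q, hq, q', hq', hi⟩ := hd
  obtain ⟨h, hh, rfl⟩ := hf.connected S hS T hT
  exact ⟨_, hf.nexts_mem hP hS hh hq, _, hf.nexts_mem hP hS hh hq',
    fun h' => hi (hf.indist_of_nexts hP hS hq hq' hh h')⟩

end SEC

/-! ### Maximal support end components -/

/-- Any two supports are connected through the common support `S`. This makes the maximal SEC around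
a support unique. -/
theorem IsSEC.union {P : POMDP Q A O} {f g : Set Q → Set A} (hf : P.IsSEC f) (hg : P.IsSEC g)
    {S : Set Q} (hSf : S ∈ dom f) (hSg : S ∈ dom g) : P.IsSEC fun T => f T ∪ g T := by
  have hdom (T : Set Q) : T ∈ dom (fun T => f T ∪ g T) ↔ T ∈ dom f ∨ T ∈ dom g :=
    Set.union_nonempty
  have hl {T h} : P.Follows f T h → P.Follows (fun T => f T ∪ g T) T h :=
    Follows.mono fun _ => Set.subset_union_left
  have hr {T h} : P.Follows g T h → P.Follows (fun T => f T ∪ g T) T h :=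
    Follows.mono fun _ => Set.subset_union_right
  refine ⟨fun T hT => ?_, fun T hT a ha o hne => ?_, fun T hT U hU => ?_⟩
  · exact ((hdom T).1 hT).elim (hf.nonempty T) (hg.nonempty T)
  · refine (hdom _).2 (ha.imp (fun h => ?_) fun h => ?_)
    · exact hf.closed T ⟨a, h⟩ a h o hne
    · exact hg.closed T ⟨a, h⟩ a h o hne
  · obtain ⟨h, hh, hhS⟩ : S ∈ P.reachSupp (fun T => f T ∪ g T) T := by
      rcases (hdom T).1 hT with hT | hT
      · obtain ⟨h, hh, hhS⟩ := hf.connected T hT S hSf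
        exact ⟨h, hl hh, hhS⟩
      · obtain ⟨h, hh, hhS⟩ := hg.connected T hT S hSg
        exact ⟨h, hr hh, hhS⟩
    obtain ⟨k, hk, hkU⟩ : U ∈ P.reachSupp (fun T => f T ∪ g T) S := by
      rcases (hdom U).1 hU with hU | hU
      · obtain ⟨h, hh, hhS⟩ := hf.connected S hSf U hU
        exact ⟨h, hl hh, hhS⟩
      · obtain ⟨h, hh, hhS⟩ := hg.connected S hSg U hU
        exact ⟨h, hr hh, hhS⟩
    exact ⟨h ++ k, (P.follows_append _ _ _ _).2 ⟨hh, hhS.symm ▸ hk⟩, by rw [succs_append, hhS, hkU]⟩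

theorem IsMaxSEC.eq {P : POMDP Q A O} {f g : Set Q → Set A} (hf : P.IsMaxSEC f)
    (hg : P.IsMaxSEC g) {S : Set Q} (hSf : S ∈ dom f) (hSg : S ∈ dom g) : f = g :=
  (hf.2 _ (hf.1.union hg.1 hSf hSg) fun _ => Set.subset_union_left).trans
    (hg.2 _ (hf.1.union hg.1 hSf hSg) fun _ => Set.subset_union_right).symm

theorem IsSEC.exists_isMaxSEC {P : POMDP Q A O} {f : Set Q → Set A} (hf : P.IsSEC f) :
    ∃ g, P.IsMaxSEC g ∧ ∀ S, f S ⊆ g S := by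
  obtain ⟨g, hfg, hg⟩ := Finite.exists_le_maximal (p := P.IsSEC) hf
  exact ⟨g, ⟨hg.1, fun g' hg' hle => le_antisymm hle (hg.2 hg' hle)⟩, hfg⟩

/-! ### Beliefs supported on indistinguishable states -/

/-- The support of `d` is a set of `(f, S)`-indistinguishable states of `S`. -/
structure IsIndist (P : POMDP Q A O) (f : Set Q → Set A) (S : Set Q) (d : Q → ℝ) : Prop where
  nonneg : 0 ≤ d
  supp_subset : supp d ⊆ S
  indist : ∀ q ∈ supp d, ∀ q' ∈ supp d, P.Indist f S q q'

theorem exists_nexts_eq {P : POMDP Q A O} (hP : P.PosteriorDeterministic) {S : Set Q}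
    {h : List (A × O)} {x : Q} (hx : x ∈ P.succs S h) : ∃ q ∈ S, P.nexts q h = x := by
  induction h generalizing S with
  | nil => exact ⟨x, hx, rfl⟩
  | cons m h ih =>
    obtain ⟨a, o⟩ := m
    obtain ⟨q, ⟨q₀, hq₀, hp⟩, rfl⟩ := ih hx
    exact ⟨q₀, hq₀, by rw [nexts_cons, next_eq hP hp]⟩

theorem IsIndist.obsProb_eq {P : POMDP Q A O} {f : Set Q → Set A} {S : Set Q} {d : Q → ℝ}
    (hd : P.IsIndist f S d) {a : A} (ha : a ∈ f S) {q q' : Q} (hq : q ∈ supp d) (hq' : q' ∈ supp d)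
    (o : O) : P.obsProb q a o = P.obsProb q' a o :=
  hd.indist q hq q' hq' [] trivial q rfl q' rfl a ha o

theorem IsIndist.mass_push {P : POMDP Q A O} {f : Set Q → Set A} {S : Set Q} {d : Q → ℝ}
    (hd : P.IsIndist f S d) {a : A} (ha : a ∈ f S) {q : Q} (hq : q ∈ supp d) (o : O) :
    mass (P.push d a o) = P.obsProb q a o * mass d := by
  rw [POMDP.mass_push, mass, Finset.mul_sum]
  refine Finset.sum_congr rfl fun q' _ => ?_
  by_cases hq' : q' ∈ supp d
  · rw [hd.obsProb_eq ha hq hq', mul_comm]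
  · rw [eq_zero_of_notMem_supp hd.nonneg hq', zero_mul, mul_zero]

section SEC

variable {P : POMDP Q A O} (hP : P.PosteriorDeterministic) {f : Set Q → Set A} (hf : P.IsSEC f)
include hP hf

theorem IsSEC.push_next {S : Set Q} (hS : S ∈ dom f) {a : A} (ha : a ∈ f S) {o : O}
    (hne : (P.succ S a o).Nonempty) {d : Q → ℝ} (hd : 0 ≤ d) (hdS : supp d ⊆ S) {q : Q}
    (hq : q ∈ S) : P.push d a o (P.next q a o) = d q * P.obsProb q a o := by
  obtain ⟨h1, h2⟩ := hf.image_next hP hS ha hne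
  rw [push, Finset.sum_eq_single q (fun x _ hx => ?_) (by simp), POMDP.obsProb_eq hP (h1 q hq)]
  by_cases hxS : x ∈ S
  · rw [mul_eq_zero]
    right
    by_contra h
    exact hx (h2 hxS hq (next_eq hP ((P.prob_nonneg _ _ _ _).lt_of_ne (Ne.symm h))))
  · rw [eq_zero_of_notMem_supp hd fun h => hxS (hdS h), zero_mul]

/-- All states of the support give the observation the same likelihood, so in Bayes' rule this
factor cancels and each mass merely moves to the next state. -/
theorem IsSEC.update_next {S : Set Q} (hS : S ∈ dom f) {a : A} (ha : a ∈ f S) {o : O}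
    (hne : (P.succ S a o).Nonempty) {d : Q → ℝ} (hd : P.IsIndist f S d) {q : Q}
    (hq : q ∈ S) : P.update d a o (P.next q a o) = d q := by
  by_cases h₀ : d q = 0
  · rw [update_eq, Pi.smul_apply, hf.push_next hP hS ha hne hd.nonneg hd.supp_subset hq, h₀]
    simp
  · have hqd : q ∈ supp d := (hd.nonneg q).lt_of_ne (Ne.symm h₀)
    have hm : 0 < mass d := mass_pos hd.nonneg (by rintro rfl; exact h₀ rfl)
    have ht : 0 < P.obsProb q a o := by
      have := (hf.image_next hP hS ha hne).1 q hq
      rwa [POMDP.obsProb_eq hP this]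
    rw [update_eq, Pi.smul_apply, hf.push_next hP hS ha hne hd.nonneg hd.supp_subset hq,
      hd.mass_push ha hqd, smul_eq_mul]
    field_simp

theorem IsSEC.isIndist_succ {S : Set Q} (hS : S ∈ dom f) {a : A} (ha : a ∈ f S) {o : O}
    (hne : (P.succ S a o).Nonempty) {d e : Q → ℝ} (hd : P.IsIndist f S d) (he : 0 ≤ e)
    (hed : supp e = P.succ (supp d) a o) : P.IsIndist f (P.succ S a o) e := by
  refine ⟨he, hed ▸ P.succ_mono hd.supp_subset a o, ?_⟩
  rw [hed]
  rintro x ⟨q, hq, hx⟩ x' ⟨q', hq', hx'⟩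
  rw [← next_eq hP hx, ← next_eq hP hx']
  exact hf.indist_nexts hP hS (hd.supp_subset hq) (hd.supp_subset hq') (h := [(a, o)])
    ⟨ha, hne, trivial⟩ (hd.indist q hq q' hq')

theorem IsSEC.isIndist_update {S : Set Q} (hS : S ∈ dom f) {a : A} (ha : a ∈ f S) {o : O}
    (hne : (P.succ S a o).Nonempty) {d : Q → ℝ} (hd : P.IsIndist f S d) :
    P.IsIndist f (P.succ S a o) (P.update d a o) :=
  hf.isIndist_succ hP hS ha hne hd (P.update_nonneg hd.nonneg a o) (P.supp_update hd.nonneg a o)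

theorem IsSEC.isIndist_push {S : Set Q} (hS : S ∈ dom f) {a : A} (ha : a ∈ f S) {o : O}
    (hne : (P.succ S a o).Nonempty) {d : Q → ℝ} (hd : P.IsIndist f S d) :
    P.IsIndist f (P.succ S a o) (P.push d a o) :=
  hf.isIndist_succ hP hS ha hne hd (P.push_nonneg hd.nonneg a o) (P.supp_push hd.nonneg a o)

theorem IsSEC.updates_nexts {S : Set Q} (hS : S ∈ dom f) {h : List (A × O)}
    (hh : P.Follows f S h) {d : Q → ℝ} (hd : P.IsIndist f S d) :
    P.IsIndist f (P.succs S h) (P.updates d h) ∧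
      ∀ q ∈ S, P.updates d h (P.nexts q h) = d q := by
  induction h generalizing S d with
  | nil => exact ⟨hd, fun _ _ => rfl⟩
  | cons m h ih =>
    obtain ⟨a, o⟩ := m
    obtain ⟨h1, h2⟩ := ih (hf.closed S hS a hh.1 o hh.2.1) hh.2.2
      (hf.isIndist_update hP hS hh.1 hh.2.1 hd)
    refine ⟨h1, fun q hq => ?_⟩
    rw [nexts_cons, ← hf.update_next hP hS hh.1 hh.2.1 hd hq]
    exact h2 _ (hf.next_mem hP hS hh.1 hh.2.1 hq)

/-- Since masses only move, the entries of a reachable belief come from those of `d`. Both the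
finiteness of the set of reachable beliefs and the preservation of the lower bound `η` on entries
follow. -/
theorem IsSEC.updates_eq_zero_or {S : Set Q} (hS : S ∈ dom f) {h : List (A × O)}
    (hh : P.Follows f S h) {d : Q → ℝ} (hd : P.IsIndist f S d) (x : Q) :
    P.updates d h x = 0 ∨ ∃ q ∈ S, P.updates d h x = d q := by
  obtain ⟨h1, h2⟩ := hf.updates_nexts hP hS hh hd
  by_cases hx : x ∈ supp (P.updates d h)
  · obtain ⟨q, hq, rfl⟩ := exists_nexts_eq hP (h1.supp_subset hx)
    exact .inr ⟨q, hq, h2 q hq⟩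
  · exact .inl (eq_zero_of_notMem_supp h1.nonneg hx)

theorem IsSEC.exists_updates_return {S : Set Q} (hS : S ∈ dom f) {h : List (A × O)}
    (hh : P.Follows f S h) {d : Q → ℝ} (hd : P.IsIndist f S d) :
    ∃ g, P.Follows f (P.succs S h) g ∧ P.updates (P.updates d h) g = d := by
  obtain ⟨g, hg, hgS, hgq⟩ := hf.exists_return hP hS hh
  refine ⟨g, hg, ?_⟩
  obtain ⟨h1, h2⟩ := hf.updates_nexts hP hS ((P.follows_append _ _ _ _).2 ⟨hh, hg⟩) hd
  rw [← updates_append]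
  ext q
  by_cases hq : q ∈ S
  · rw [← h2 q hq, hgq q hq]
  · rw [succs_append, hgS] at h1
    rw [eq_zero_of_notMem_supp h1.nonneg fun h => hq (h1.supp_subset h),
      eq_zero_of_notMem_supp hd.nonneg fun h => hq (hd.supp_subset h)]

variable {top : Q} (ht : P.Absorbing top)
include ht

/-- The average of the values after `a` is at most the value of `d`, and by minimality no term of
the average is smaller; so all terms of positive weight are equal to it. -/
theorem IsSEC.val_update_of_min {S : Set Q} (hS : S ∈ dom f) {d : Q → ℝ} (hd : P.IsIndist f S d)
    {a : A} (ha : a ∈ f S)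
    (hmin : ∀ o, (P.succ S a o).Nonempty → P.val {top} d ≤ P.val {top} (P.update d a o)) {o : O}
    (hne : (P.succ S a o).Nonempty) : P.val {top} (P.update d a o) = P.val {top} d := by
  by_cases h₀ : d = 0
  · rw [h₀, update_eq, push_zero, smul_zero]
  have hv (o : O) : P.val {top} (P.push d a o) =
      P.belObsProb d a o * P.val {top} (P.update d a o) := by
    rw [← val_smul ht (P.update_nonneg hd.nonneg a o) (P.belObsProb_nonneg hd.nonneg a o),
      P.belObsProb_smul_update hd.nonneg]
  have hle (o : O) : P.belObsProb d a o * P.val {top} d ≤ P.val {top} (P.push d a o) := by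
    rw [hv]
    by_cases h : (P.succ S a o).Nonempty
    · exact mul_le_mul_of_nonneg_left (hmin o h) (P.belObsProb_nonneg hd.nonneg a o)
    · have : P.push d a o = 0 := by
        refine eq_zero_of_supp_eq_empty (P.push_nonneg hd.nonneg a o) ?_
        rw [P.supp_push hd.nonneg, ← Set.subset_empty_iff, ← Set.not_nonempty_iff_eq_empty.1 h]
        exact P.succ_mono hd.supp_subset a o
      rw [belObsProb_eq, this]
      simp [mass_zero]
  have hsum : ∑ o, P.belObsProb d a o * P.val {top} d = P.val {top} d := by
    rw [← Finset.sum_mul, P.sum_belObsProb (mass_pos hd.nonneg h₀).ne', one_mul]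
  have heq := (Finset.sum_eq_sum_iff_of_le fun o _ => hle o).1
    (le_antisymm (Finset.sum_le_sum fun o _ => hle o)
      ((sum_val_push_le ht hd.nonneg a).trans_eq hsum.symm)) o (Finset.mem_univ o)
  rw [hv] at heq
  refine (mul_left_cancel₀ ?_ heq).symm
  rw [belObsProb_eq]
  obtain ⟨q, hq⟩ : (supp d).Nonempty := by
    by_contra h
    exact h₀ (eq_zero_of_supp_eq_empty hd.nonneg (Set.not_nonempty_iff_eq_empty.1 h))
  have hq' : P.next q a o ∈ supp (P.push d a o) := by
    rw [P.supp_push hd.nonneg]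
    exact ⟨q, hq, (hf.image_next hP hS ha hne).1 q (hd.supp_subset hq)⟩
  refine (div_pos (mass_pos (P.push_nonneg hd.nonneg a o) fun h => ?_)
    (mass_pos hd.nonneg h₀)).ne'
  rw [h, supp_zero] at hq'
  exact hq'

theorem IsSEC.val_updates_of_min {S : Set Q} (hS : S ∈ dom f) {d : Q → ℝ}
    (hd : P.IsIndist f S d)
    (hmin : ∀ g, P.Follows f S g → P.val {top} d ≤ P.val {top} (P.updates d g))
    {h : List (A × O)} (hh : P.Follows f S h) :
    P.val {top} (P.updates d h) = P.val {top} d := by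
  induction h generalizing S d with
  | nil => rfl
  | cons m h ih =>
    obtain ⟨a, o⟩ := m
    have h1 := hf.val_update_of_min hP ht hS hd hh.1
      (fun o hne => hmin [(a, o)] ⟨hh.1, hne, trivial⟩) hh.2.1
    rw [← h1]
    refine ih (hf.closed S hS a hh.1 o hh.2.1) (hf.isIndist_update hP hS hh.1 hh.2.1 hd)
      (fun g hg => ?_) hh.2.2
    rw [h1]
    exact hmin ((a, o) :: g) ⟨hh.1, hh.2.1, hg⟩

/-- Inside a support end component, the value of a belief whose support consists of
indistinguishable states is constant. -/
theorem IsSEC.val_updates {S : Set Q} (hS : S ∈ dom f) {d : Q → ℝ}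
    (hd : P.IsIndist f S d) {h : List (A × O)} (hh : P.Follows f S h) :
    P.val {top} (P.updates d h) = P.val {top} d := by
  let R : Set (Q → ℝ) := {e | ∃ h, P.Follows f S h ∧ P.updates d h = e}
  have hR : R.Finite := by
    refine (Set.Finite.pi' (t := fun _ : Q => insert 0 (Set.range d))
      fun _ => (Set.finite_range d).insert 0).subset ?_
    rintro e ⟨h, hh, rfl⟩ x
    rcases hf.updates_eq_zero_or hP hS hh hd x with h | ⟨q, -, h⟩
    · exact .inl h
    · exact .inr ⟨q, h.symm⟩
  obtain ⟨_, ⟨h₀, hh₀, rfl⟩, hmin⟩ := Set.exists_min_image R (P.val {top}) hR ⟨d, [], trivial, rfl⟩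
  -- The belief `d` is reachable from the minimiser, hence is itself of minimal value, and the
  -- minimality argument can be started again from `d`.
  obtain ⟨g, hg, hgd⟩ := hf.exists_updates_return hP hS hh₀ hd
  have h1 := hf.val_updates_of_min hP ht (hf.succs_mem hS hh₀) (hf.updates_nexts hP hS hh₀ hd).1
    (fun g hg => hmin _ ⟨h₀ ++ g, (P.follows_append _ _ _ _).2 ⟨hh₀, hg⟩, P.updates_append _ _ _⟩) hg
  rw [hgd] at h1
  exact hf.val_updates_of_min hP ht hS hd (fun g hg => h1 ▸ hmin _ ⟨g, hg, rfl⟩) hh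

/-- In general the Bellman inequality loses value when `a` is not optimal; on indistinguishable
states every action of the SEC is free of loss, because all updates keep the value. -/
theorem IsSEC.sum_val_push {S : Set Q} (hS : S ∈ dom f) {d : Q → ℝ}
    (hd : P.IsIndist f S d) {a : A} (ha : a ∈ f S) :
    ∑ o, P.val {top} (P.push d a o) = P.val {top} d := by
  by_cases h₀ : d = 0
  · simp [h₀, push_zero, val_zero ht]
  have h (o : O) : P.val {top} (P.push d a o) = P.belObsProb d a o * P.val {top} d := by
    rw [← P.belObsProb_smul_update hd.nonneg,
      val_smul ht (P.update_nonneg hd.nonneg a o) (P.belObsProb_nonneg hd.nonneg a o)]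
    by_cases hne : (P.succ S a o).Nonempty
    · rw [← hf.val_updates hP ht hS hd (h := [(a, o)]) ⟨ha, hne, trivial⟩]
      rfl
    · have : P.push d a o = 0 := by
        refine eq_zero_of_supp_eq_empty (P.push_nonneg hd.nonneg a o) ?_
        rw [P.supp_push hd.nonneg, ← Set.subset_empty_iff, ← Set.not_nonempty_iff_eq_empty.1 hne]
        exact P.succ_mono hd.supp_subset a o
      rw [belObsProb_eq, this]
      simp [mass_zero]
  simp only [h]
  rw [← Finset.sum_mul, P.sum_belObsProb (mass_pos hd.nonneg h₀).ne', one_mul]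

end SEC

/-! ### Identification of the class of the state -/

theorem obsProb_nonneg (P : POMDP Q A O) (q : Q) (a : A) (o : O) : 0 ≤ P.obsProb q a o :=
  Finset.sum_nonneg fun _ _ => P.prob_nonneg _ _ _ _

theorem sum_obsProb (P : POMDP Q A O) (q : Q) (a : A) : ∑ o, P.obsProb q a o = 1 :=
  P.sum_prob q a

open Classical in
/-- The uniform distribution on `f T`. -/
noncomputable def unif (f : Set Q → Set A) (T : Set Q) (a : A) : ℝ :=
  if a ∈ f T then ((f T).ncard : ℝ)⁻¹ else 0

theorem unif_nonneg (f : Set Q → Set A) (T : Set Q) (a : A) : 0 ≤ unif f T a := by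
  unfold unif
  split_ifs <;> positivity

theorem unif_pos {f : Set Q → Set A} {T : Set Q} {a : A} (ha : a ∈ f T) : 0 < unif f T a := by
  rw [unif, if_pos ha, inv_pos, Nat.cast_pos, Set.ncard_pos]
  exact ⟨a, ha⟩

theorem unif_eq_zero {f : Set Q → Set A} {T : Set Q} {a : A} (ha : a ∉ f T) : unif f T a = 0 :=
  if_neg ha

theorem sum_unif {f : Set Q → Set A} {T : Set Q} (hT : T ∈ dom f) : ∑ a, unif f T a = 1 := by
  classical
  have h : ((f T).ncard : ℝ) ≠ 0 := by
    rw [Nat.cast_ne_zero, ← Nat.pos_iff_ne_zero, Set.ncard_pos]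
    exact hT
  simp only [unif]
  rw [← Finset.sum_filter, Finset.sum_const, nsmul_eq_mul, Set.ncard_eq_toFinset_card',
    ← Set.filter_mem_univ_eq_toFinset]
  rw [Set.ncard_eq_toFinset_card', ← Set.filter_mem_univ_eq_toFinset] at h
  exact mul_inv_cancel₀ h

/-- The Bhattacharyya coefficient of the laws of the `n` first observations from `q` and `q'`, when
actions are chosen uniformly in `f`. -/
noncomputable def bhat (P : POMDP Q A O) (f : Set Q → Set A) : ℕ → Set Q → Q → Q → ℝ
  | 0, _, _, _ => 1
  | n + 1, T, q, q' => ∑ a, unif f T a * ∑ o,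
      P.bhat f n (P.succ T a o) (P.next q a o) (P.next q' a o) *
        √(P.obsProb q a o * P.obsProb q' a o)

theorem bhat_nonneg (P : POMDP Q A O) (f : Set Q → Set A) (n : ℕ) (T : Set Q) (q q' : Q) :
    0 ≤ P.bhat f n T q q' := by
  induction n generalizing T q q' with
  | zero => exact zero_le_one
  | succ n ih =>
    exact Finset.sum_nonneg fun a _ => mul_nonneg (unif_nonneg f T a)
      (Finset.sum_nonneg fun o _ => mul_nonneg (ih _ _ _) (Real.sqrt_nonneg _))

theorem sqrt_mul_le_half_add {x y : ℝ} (hx : 0 ≤ x) (hy : 0 ≤ y) : √(x * y) ≤ (x + y) / 2 := by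
  rw [Real.sqrt_le_left (by positivity)]
  nlinarith [sq_nonneg (x - y)]

theorem eq_of_half_add_le_sqrt_mul {x y : ℝ} (hx : 0 ≤ x) (hy : 0 ≤ y)
    (h : (x + y) / 2 ≤ √(x * y)) : x = y := by
  have h' : ((x + y) / 2) ^ 2 ≤ x * y :=
    (pow_le_pow_left₀ (by positivity) h 2).trans_eq (Real.sq_sqrt (mul_nonneg hx hy))
  have : (x - y) ^ 2 ≤ 0 := by nlinarith
  exact sub_eq_zero.1 ((pow_eq_zero_iff two_ne_zero).1 (le_antisymm this (sq_nonneg _)))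

theorem obsProb_eq_zero_of_succ {P : POMDP Q A O} {T : Set Q} {a : A} {o : O}
    (h : ¬ (P.succ T a o).Nonempty) {q : Q} (hq : q ∈ T) : P.obsProb q a o = 0 := by
  refine Finset.sum_eq_zero fun x _ => ?_
  by_contra h'
  exact h ⟨x, q, hq, (P.prob_nonneg _ _ _ _).lt_of_ne (Ne.symm h')⟩

section SEC

variable {P : POMDP Q A O} (hP : P.PosteriorDeterministic) {f : Set Q → Set A} (hf : P.IsSEC f)
include hP hf

/-- A single step contributes at most 1 by the inequality between the geometric and arithmetic
means. Later steps inherit the comparison through the recursion. -/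
theorem IsSEC.bhat_succ_le (n : ℕ) {T : Set Q} (hT : T ∈ dom f) {q q' : Q} (hq : q ∈ T)
    (hq' : q' ∈ T) : P.bhat f (n + 1) T q q' ≤ P.bhat f n T q q' := by
  induction n generalizing T q q' with
  | zero =>
    change _ ≤ (1 : ℝ)
    rw [← sum_unif hT]
    refine Finset.sum_le_sum fun a _ => mul_le_of_le_one_right (unif_nonneg _ _ _) ?_
    calc ∑ o, P.bhat f 0 (P.succ T a o) (P.next q a o) (P.next q' a o) *
          √(P.obsProb q a o * P.obsProb q' a o)
        ≤ ∑ o, (P.obsProb q a o + P.obsProb q' a o) / 2 := Finset.sum_le_sum fun o _ => by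
          rw [bhat, one_mul]
          exact sqrt_mul_le_half_add (P.obsProb_nonneg _ _ _) (P.obsProb_nonneg _ _ _)
      _ = 1 := by
          rw [← Finset.sum_div, Finset.sum_add_distrib, sum_obsProb, sum_obsProb]
          norm_num
  | succ n ih =>
    refine Finset.sum_le_sum fun a _ => ?_
    by_cases ha : a ∈ f T
    · refine mul_le_mul_of_nonneg_left (Finset.sum_le_sum fun o _ => ?_) (unif_nonneg _ _ _)
      by_cases hne : (P.succ T a o).Nonempty
      · exact mul_le_mul_of_nonneg_right (ih (hf.closed T hT a ha o hne)
          (hf.next_mem hP hT ha hne hq) (hf.next_mem hP hT ha hne hq')) (Real.sqrt_nonneg _)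
      · simp [obsProb_eq_zero_of_succ hne hq]
    · simp [unif_eq_zero ha]

theorem IsSEC.tendsto_bhat {T : Set Q} (hT : T ∈ dom f) {q q' : Q} (hq : q ∈ T) (hq' : q' ∈ T) :
    Filter.Tendsto (fun n => P.bhat f n T q q') Filter.atTop (nhds (⨅ n, P.bhat f n T q q')) :=
  tendsto_atTop_ciInf (antitone_nat_of_succ_le fun n => hf.bhat_succ_le hP n hT hq hq')
    ⟨0, by rintro _ ⟨n, rfl⟩; exact P.bhat_nonneg f n T q q'⟩

theorem IsSEC.iInf_bhat {T : Set Q} (hT : T ∈ dom f) {q q' : Q} (hq : q ∈ T) (hq' : q' ∈ T) :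
    ⨅ n, P.bhat f n T q q' = ∑ a, unif f T a * ∑ o,
      (⨅ n, P.bhat f n (P.succ T a o) (P.next q a o) (P.next q' a o)) *
        √(P.obsProb q a o * P.obsProb q' a o) := by
  refine tendsto_nhds_unique
    ((hf.tendsto_bhat hP hT hq hq').comp (Filter.tendsto_add_atTop_nat 1)) ?_
  refine tendsto_finsetSum _ fun a _ => ?_
  by_cases ha : a ∈ f T
  · refine (tendsto_finsetSum _ fun o _ => ?_).const_mul _
    by_cases hne : (P.succ T a o).Nonempty
    · exact (hf.tendsto_bhat hP (hf.closed T hT a ha o hne) (hf.next_mem hP hT ha hne hq)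
        (hf.next_mem hP hT ha hne hq')).mul_const _
    · simp [obsProb_eq_zero_of_succ hne hq]
  · simp [unif_eq_zero ha]

/-- Equality case of the recursion `IsSEC.iInf_bhat`. The limit at a maximal pair is an average of
terms each bounded by `m` times the mean of the two observation probabilities, and these bounds
average to `m`. Hence all of them are attained: geometric and arithmetic means agree, and the
successors are again maximal pairs. -/
theorem IsSEC.iInf_bhat_step {m : ℝ} (hm : 0 < m)
    (hmax : ∀ T ∈ dom f, ∀ q ∈ T, ∀ q' ∈ T, ¬ P.Indist f T q q' → ⨅ n, P.bhat f n T q q' ≤ m)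
    {T : Set Q} (hT : T ∈ dom f) {q q' : Q} (hq : q ∈ T) (hq' : q' ∈ T)
    (hi : ¬ P.Indist f T q q') (he : ⨅ n, P.bhat f n T q q' = m) {a : A} (ha : a ∈ f T) (o : O) :
    P.obsProb q a o = P.obsProb q' a o ∧ ((P.succ T a o).Nonempty →
      ¬ P.Indist f (P.succ T a o) (P.next q a o) (P.next q' a o) ∧
      ⨅ n, P.bhat f n (P.succ T a o) (P.next q a o) (P.next q' a o) = m) := by
  have hni {a : A} (ha : a ∈ f T) {o : O} (hne : (P.succ T a o).Nonempty) :
      ¬ P.Indist f (P.succ T a o) (P.next q a o) (P.next q' a o) := fun h =>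
    hi (hf.indist_of_nexts hP hT hq hq' (h := [(a, o)]) ⟨ha, hne, trivial⟩ h)
  set κ : A → O → ℝ := fun a o => ⨅ n, P.bhat f n (P.succ T a o) (P.next q a o) (P.next q' a o)
    with hκ
  have hκm {a : A} (ha : a ∈ f T) {o : O} (hne : (P.succ T a o).Nonempty) : κ a o ≤ m :=
    hmax _ (hf.closed T hT a ha o hne) _ (hf.next_mem hP hT ha hne hq) _
      (hf.next_mem hP hT ha hne hq') (hni ha hne)
  have h1 {a : A} (ha : a ∈ f T) (o : O) : κ a o * √(P.obsProb q a o * P.obsProb q' a o) ≤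
      m * ((P.obsProb q a o + P.obsProb q' a o) / 2) := by
    by_cases hne : (P.succ T a o).Nonempty
    · exact mul_le_mul (hκm ha hne)
        (sqrt_mul_le_half_add (P.obsProb_nonneg _ _ _) (P.obsProb_nonneg _ _ _))
        (Real.sqrt_nonneg _) hm.le
    · simp [obsProb_eq_zero_of_succ hne hq, obsProb_eq_zero_of_succ hne hq']
  have h2 (a : A) : ∑ o, m * ((P.obsProb q a o + P.obsProb q' a o) / 2) = m := by
    rw [← Finset.mul_sum, ← Finset.sum_div, Finset.sum_add_distrib, sum_obsProb, sum_obsProb]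
    norm_num
  have h3 (a : A) : unif f T a * ∑ o, κ a o * √(P.obsProb q a o * P.obsProb q' a o) ≤
      unif f T a * m := by
    by_cases ha : a ∈ f T
    · refine mul_le_mul_of_nonneg_left ?_ (unif_nonneg _ _ _)
      rw [← h2 a]
      exact Finset.sum_le_sum fun o _ => h1 ha o
    · simp [unif_eq_zero ha]
  have h4 := (Finset.sum_eq_sum_iff_of_le fun a _ => h3 a).1 (by
    rw [← Finset.sum_mul, sum_unif hT, one_mul, ← hf.iInf_bhat hP hT hq hq', he]) a
    (Finset.mem_univ a)
  have h5 := mul_left_cancel₀ (unif_pos ha).ne' h4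
  have h6 := (Finset.sum_eq_sum_iff_of_le fun o _ => h1 ha o).1 (h5.trans (h2 a).symm) o
    (Finset.mem_univ o)
  by_cases hne : (P.succ T a o).Nonempty
  · have ht0 := P.obsProb_nonneg q a o
    have ht0' := P.obsProb_nonneg q' a o
    have h7 : (P.obsProb q a o + P.obsProb q' a o) / 2 ≤ √(P.obsProb q a o * P.obsProb q' a o) := by
      refine le_of_mul_le_mul_left ?_ hm
      rw [← h6]
      exact mul_le_mul_of_nonneg_right (hκm ha hne) (Real.sqrt_nonneg _)
    have h8 := eq_of_half_add_le_sqrt_mul ht0 ht0' h7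
    refine ⟨h8, fun _ => ⟨hni ha hne, ?_⟩⟩
    -- A nonempty successor support means that the observation is possible from every state of `T`,
    -- so this weight can be cancelled.
    have hpos : 0 < P.obsProb q a o := by
      have := (hf.image_next hP hT ha hne).1 q hq
      rwa [POMDP.obsProb_eq hP this]
    rw [← h8, Real.sqrt_mul_self ht0, add_self_div_two] at h6
    exact mul_right_cancel₀ hpos.ne' h6
  · exact ⟨by rw [obsProb_eq_zero_of_succ hne hq, obsProb_eq_zero_of_succ hne hq'],
      fun h => absurd h hne⟩

theorem IsSEC.obsProb_nexts_eq_of_iInf_bhat {m : ℝ} (hm : 0 < m)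
    (hmax : ∀ T ∈ dom f, ∀ q ∈ T, ∀ q' ∈ T, ¬ P.Indist f T q q' → ⨅ n, P.bhat f n T q q' ≤ m)
    {T : Set Q} (hT : T ∈ dom f) {q q' : Q} (hq : q ∈ T) (hq' : q' ∈ T)
    (hi : ¬ P.Indist f T q q') (he : ⨅ n, P.bhat f n T q q' = m) {h : List (A × O)}
    (hh : P.Follows f T h) {a : A} (ha : a ∈ f (P.succs T h)) (o : O) :
    P.obsProb (P.nexts q h) a o = P.obsProb (P.nexts q' h) a o := by
  induction h generalizing T q q' with
  | nil => exact (hf.iInf_bhat_step hP hm hmax hT hq hq' hi he ha o).1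
  | cons x h ih =>
    obtain ⟨a₁, o₁⟩ := x
    obtain ⟨h1, h2⟩ := (hf.iInf_bhat_step hP hm hmax hT hq hq' hi he hh.1 o₁).2 hh.2.1
    exact ih (hf.closed T hT a₁ hh.1 o₁ hh.2.1) (hf.next_mem hP hT hh.1 hh.2.1 hq)
      (hf.next_mem hP hT hh.1 hh.2.1 hq') h1 h2 hh.2.2 ha

/-- Take the largest limit among the finitely many distinguishable pairs. Were it positive, equality
would propagate along all histories and the observation laws would agree everywhere, so the pair
would be indistinguishable. -/
theorem IsSEC.iInf_bhat_eq_zero {T : Set Q} (hT : T ∈ dom f) {q q' : Q} (hq : q ∈ T)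
    (hq' : q' ∈ T) (hi : ¬ P.Indist f T q q') : ⨅ n, P.bhat f n T q q' = 0 := by
  let Y : Set (Set Q × Q × Q) :=
    {y | y.1 ∈ dom f ∧ y.2.1 ∈ y.1 ∧ y.2.2 ∈ y.1 ∧ ¬ P.Indist f y.1 y.2.1 y.2.2}
  obtain ⟨⟨T₀, q₀, q₀'⟩, ⟨hT₀, hq₀, hq₀', hi₀⟩, hmax⟩ := Set.exists_max_image Y
    (fun y => ⨅ n, P.bhat f n y.1 y.2.1 y.2.2) (Set.toFinite Y) ⟨(T, q, q'), hT, hq, hq', hi⟩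
  refine le_antisymm ((hmax (T, q, q') ⟨hT, hq, hq', hi⟩).trans ?_)
    (Real.iInf_nonneg fun n => P.bhat_nonneg f n T q q')
  by_contra! hm
  exact hi₀ ((hf.indist_iff hP hT₀ hq₀ hq₀').2 fun h hh a ha o =>
    hf.obsProb_nexts_eq_of_iInf_bhat hP hm
      (fun T hT q hq q' hq' hi => hmax (T, q, q') ⟨hT, hq, hq', hi⟩) hT₀ hq₀ hq₀' hi₀ rfl hh ha o)

variable {top : Q} (ht : P.Absorbing top)
include ht

open Classical in
-- The left-hand side is the price of not knowing the index `i`. Play uniformly in `f` for `n` steps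
-- and then bet on the heaviest index: the error is governed by the overlap of the laws of
-- observations, measured by `bhat`.
theorem IsSEC.sum_val_sub_le (n : ℕ) {T : Set Q} (hT : T ∈ dom f) {ι : Type*} [Fintype ι]
    {d : ι → Q → ℝ} (hd : ∀ i, P.IsIndist f T (d i)) {r : ι → Q} (hr : ∀ i, r i ∈ supp (d i)) :
    ∑ i, P.val {top} (d i) - P.val {top} (∑ i, d i) ≤ ∑ i, ∑ j, if i = j then 0 else
      P.bhat f n T (r i) (r j) * √(mass (d i) * mass (d j)) := by
  have hnn (i : ι) : 0 ≤ d i := (hd i).nonneg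
  have hterm (i j : ι) : 0 ≤ if i = j then 0 else
      P.bhat f n T (r i) (r j) * √(mass (d i) * mass (d j)) := by
    split_ifs
    · exact le_rfl
    · exact mul_nonneg (P.bhat_nonneg _ _ _ _ _) (Real.sqrt_nonneg _)
  induction n generalizing T d r with
  | zero =>
    rcases isEmpty_or_nonempty ι with hι | hι
    · simp [val_zero ht]
    -- Without observations, keep only the heaviest part; each other part loses at most its mass,
    -- which is at most the geometric mean of its mass and that of part `k`.
    obtain ⟨k, hk⟩ := Finite.exists_max fun i => mass (d i)
    have h1 : P.val {top} (d k) ≤ P.val {top} (∑ i, d i) :=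
      val_mono ht (hnn k) (Finset.single_le_sum (fun i _ => hnn i) (Finset.mem_univ k))
    have h2 : ∑ i, P.val {top} (d i) - P.val {top} (d k) =
        ∑ i, if i = k then 0 else P.val {top} (d i) := by
      rw [← Finset.add_sum_erase _ _ (Finset.mem_univ k), add_sub_cancel_left,
        Finset.sum_ite, Finset.sum_const_zero, zero_add]
      exact Finset.sum_congr (by ext; simp) fun _ _ => rfl
    calc _ ≤ ∑ i, P.val {top} (d i) - P.val {top} (d k) := by linarith
      _ ≤ ∑ i, if i = k then 0 else P.bhat f 0 T (r i) (r k) * √(mass (d i) * mass (d k)) := by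
        rw [h2]
        refine Finset.sum_le_sum fun i _ => ?_
        split_ifs
        · exact le_rfl
        · rw [bhat, one_mul]
          refine (val_le_mass ht (hnn i)).trans (Real.le_sqrt_of_sq_le ?_)
          rw [sq]
          exact mul_le_mul_of_nonneg_left (hk i) (mass_nonneg (hnn i))
      _ ≤ _ := Finset.sum_le_sum fun i _ => Finset.single_le_sum
        (fun j _ => hterm i j) (Finset.mem_univ k)
  | succ n ih =>
    set D := ∑ i, P.val {top} (d i) - P.val {top} (∑ i, d i) with hD
    have hrT (i : ι) : r i ∈ T := (hd i).supp_subset (hr i)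
    have hstep {a : A} (ha : a ∈ f T) (o : O) :
        ∑ i, P.val {top} (P.push (d i) a o) - P.val {top} (P.push (∑ i, d i) a o) ≤
        ∑ i, ∑ j, if i = j then 0 else
          P.bhat f n (P.succ T a o) (P.next (r i) a o) (P.next (r j) a o) *
            √(P.obsProb (r i) a o * P.obsProb (r j) a o) * √(mass (d i) * mass (d j)) := by
      rw [push_sum]
      by_cases hne : (P.succ T a o).Nonempty
      · refine (ih (hf.closed T hT a ha o hne) (d := fun i => P.push (d i) a o)
          (fun i => hf.isIndist_push hP hT ha hne (hd i)) (r := fun i => P.next (r i) a o)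
          (fun i => ?_) (fun i => P.push_nonneg (hnn i) a o) fun i j => ?_).trans_eq ?_
        · rw [P.supp_push (hnn i)]
          exact ⟨r i, hr i, (hf.image_next hP hT ha hne).1 _ (hrT i)⟩
        · split_ifs
          · exact le_rfl
          · exact mul_nonneg (P.bhat_nonneg _ _ _ _ _) (Real.sqrt_nonneg _)
        · refine Finset.sum_congr rfl fun i _ => Finset.sum_congr rfl fun j _ => ?_
          rw [(hd i).mass_push ha (hr i), (hd j).mass_push ha (hr j), mul_mul_mul_comm,
            Real.sqrt_mul (mul_nonneg (P.obsProb_nonneg _ _ _) (P.obsProb_nonneg _ _ _)), mul_assoc]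
      · have h0 (i : ι) : P.push (d i) a o = 0 := by
          refine eq_zero_of_supp_eq_empty (P.push_nonneg (hnn i) a o) ?_
          rw [P.supp_push (hnn i), ← Set.subset_empty_iff, ← Set.not_nonempty_iff_eq_empty.1 hne]
          exact P.succ_mono (hd i).supp_subset a o
        simp only [h0, obsProb_eq_zero_of_succ hne (hrT _)]
        simp [val_zero ht]
    have hact {a : A} (ha : a ∈ f T) : D ≤ ∑ i, ∑ j, if i = j then 0 else
        (∑ o, P.bhat f n (P.succ T a o) (P.next (r i) a o) (P.next (r j) a o) *
          √(P.obsProb (r i) a o * P.obsProb (r j) a o)) * √(mass (d i) * mass (d j)) := by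
      -- Actions of `f` preserve the values of the parts exactly and cannot raise that of their sum,
      -- so the gap after the step is at least the gap before.
      have h1 : D ≤ ∑ o, (∑ i, P.val {top} (P.push (d i) a o) -
          P.val {top} (P.push (∑ i, d i) a o)) := by
        rw [Finset.sum_sub_distrib, Finset.sum_comm]
        simp only [hf.sum_val_push hP ht hT (hd _) ha]
        have := sum_val_push_le ht (b := ∑ i, d i) (Finset.sum_nonneg fun i _ => hnn i) a
        linarith
      refine h1.trans ((Finset.sum_le_sum fun o _ => hstep ha o).trans_eq ?_)
      rw [Finset.sum_comm]
      refine Finset.sum_congr rfl fun i _ => ?_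
      rw [Finset.sum_comm]
      refine Finset.sum_congr rfl fun j _ => ?_
      split_ifs
      · simp
      · rw [Finset.sum_mul]
    calc D = ∑ a, unif f T a * D := by rw [← Finset.sum_mul, sum_unif hT, one_mul]
      _ ≤ ∑ a, unif f T a * ∑ i, ∑ j, if i = j then 0 else
          (∑ o, P.bhat f n (P.succ T a o) (P.next (r i) a o) (P.next (r j) a o) *
            √(P.obsProb (r i) a o * P.obsProb (r j) a o)) * √(mass (d i) * mass (d j)) := by
        refine Finset.sum_le_sum fun a _ => ?_
        by_cases ha : a ∈ f T
        · exact mul_le_mul_of_nonneg_left (hact ha) (unif_nonneg _ _ _)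
        · simp [unif_eq_zero ha]
      _ = _ := by
        simp only [Finset.mul_sum]
        rw [Finset.sum_comm]
        refine Finset.sum_congr rfl fun i _ => ?_
        rw [Finset.sum_comm]
        refine Finset.sum_congr rfl fun j _ => ?_
        split_ifs
        · simp
        · rw [bhat, Finset.sum_mul]
          refine Finset.sum_congr rfl fun a _ => ?_
          rw [Finset.mul_sum, Finset.sum_mul, Finset.sum_mul, Finset.mul_sum]
          refine Finset.sum_congr rfl fun o _ => ?_
          ring

/-- Let `n` tend to infinity in `IsSEC.sum_val_sub_le`: the off-diagonal coefficients vanish. -/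
theorem IsSEC.sum_val_le {T : Set Q} (hT : T ∈ dom f) {ι : Type*} [Fintype ι]
    {d : ι → Q → ℝ} (hd : ∀ i, P.IsIndist f T (d i)) {r : ι → Q} (hr : ∀ i, r i ∈ supp (d i))
    (hdist : ∀ i j, i ≠ j → ¬ P.Indist f T (r i) (r j)) :
    ∑ i, P.val {top} (d i) ≤ P.val {top} (∑ i, d i) := by
  classical
  have hrT (i : ι) : r i ∈ T := (hd i).supp_subset (hr i)
  have hlim : Filter.Tendsto (fun n : ℕ => ∑ i, ∑ j, if i = j then (0 : ℝ) else
      P.bhat f n T (r i) (r j) * √(mass (d i) * mass (d j))) Filter.atTop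
      (nhds (∑ _i : ι, ∑ _j : ι, (0 : ℝ))) := by
    refine tendsto_finsetSum _ fun i _ => tendsto_finsetSum _ fun j _ => ?_
    split_ifs with hij
    · exact tendsto_const_nhds
    · rw [show (0 : ℝ) = 0 * √(mass (d i) * mass (d j)) by simp,
        ← hf.iInf_bhat_eq_zero hP hT (hrT i) (hrT j) (hdist i j hij)]
      exact (hf.tendsto_bhat hP hT (hrT i) (hrT j)).mul_const _
  have h := ge_of_tendsto' hlim fun n => hf.sum_val_sub_le hP ht n hT hd hr
  simp only [Finset.sum_const_zero] at h
  exact sub_nonpos.1 h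

/-! ### The classes of indistinguishability -/

omit ht in
theorem IsSEC.eq_of_mem_classes {S : Set Q} (hS : S ∈ dom f) {C : Set Q} (hC : C ∈ P.classes f S)
    {q : Q} (hq : q ∈ C) : C = {q' ∈ S | P.Indist f S q q'} := by
  obtain ⟨q₀, hq₀, rfl⟩ := hC
  ext x
  constructor
  · rintro ⟨hx, hxi⟩
    exact ⟨hx, hf.indist_trans hP hS hq.1 hq₀ hx (hf.indist_symm hP hS hq₀ hq.1 hq.2) hxi⟩
  · rintro ⟨hx, hxi⟩
    exact ⟨hx, hf.indist_trans hP hS hq₀ hq.1 hx hq.2 hxi⟩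

omit hP hf ht in
theorem restrict_nonneg {b : Q → ℝ} (hb : 0 ≤ b) (C : Set Q) : 0 ≤ restrict b C := by
  intro q
  simp only [restrict, Pi.zero_apply]
  split_ifs
  · exact hb q
  · exact le_rfl

omit hP hf ht in
theorem supp_restrict (b : Q → ℝ) (C : Set Q) : supp (restrict b C) = supp b ∩ C := by
  ext q
  simp only [supp, restrict, Set.mem_ofPred_eq, Set.mem_inter_iff]
  split_ifs with h <;> simp [h]

open Classical in
omit ht in
theorem IsSEC.sum_restrict {b : Q → ℝ} (hb : 0 ≤ b) (hS : supp b ∈ dom f) :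
    ∑ C : {C // C ∈ P.classes f (supp b)}, restrict b C.1 = b := by
  ext q
  rw [Finset.sum_apply]
  by_cases hq : q ∈ supp b
  · rw [Finset.sum_eq_single ⟨{q' ∈ supp b | P.Indist f (supp b) q q'}, q, hq, rfl⟩]
    · exact if_pos ⟨hq, hf.indist_refl hP hS hq⟩
    · intro C _ hC
      exact if_neg fun h => hC (Subtype.ext (hf.eq_of_mem_classes hP hS C.2 h))
    · simp
  · rw [eq_zero_of_notMem_supp hb hq]
    refine Finset.sum_eq_zero fun C _ => ?_
    rw [restrict, eq_zero_of_notMem_supp hb hq, ite_self]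

omit ht in
theorem IsSEC.supp_restrict_class {b : Q → ℝ} {C : Set Q}
    (hC : C ∈ P.classes f (supp b)) : supp (restrict b C) = C := by
  rw [supp_restrict, Set.inter_eq_right]
  obtain ⟨q, -, rfl⟩ := hC
  exact fun x hx => hx.1

open Classical in
/-- The value of a belief whose support is in a support end component is the sum of the values of
its restrictions to the classes of indistinguishability. -/
theorem IsSEC.sum_val_restrict {b : Q → ℝ} (hb : 0 ≤ b) (hS : supp b ∈ dom f) :
    ∑ C : {C // C ∈ P.classes f (supp b)}, P.val {top} (restrict b C.1) = P.val {top} b := by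
  have hsum := hf.sum_restrict hP hb hS
  -- One inequality is the identification of the class inside the SEC, the other is subadditivity.
  refine le_antisymm ?_ ?_
  · conv_rhs => rw [← hsum]
    choose r hr hrC using fun C : {C // C ∈ P.classes f (supp b)} => C.2
    have hmem (C : {C // C ∈ P.classes f (supp b)}) : r C ∈ C.1 := by
      rw [hrC C]
      exact ⟨hr C, hf.indist_refl hP hS (hr C)⟩
    have hsupp (C : {C // C ∈ P.classes f (supp b)}) := hf.supp_restrict_class hP C.2
    refine hf.sum_val_le hP ht hS (r := r) (fun C => ⟨restrict_nonneg hb C, ?_, ?_⟩)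
      (fun C => ?_) fun C C' hne hi => ?_
    · rw [supp_restrict]
      exact Set.inter_subset_left
    · rw [hsupp C]
      intro q hq q' hq'
      rw [hf.eq_of_mem_classes hP hS C.2 hq] at hq'
      exact hq'.2
    · rw [hsupp C]
      exact hmem C
    · refine hne (Subtype.ext ?_)
      have : r C' ∈ C.1 := by
        rw [hrC C]
        exact ⟨hr C', hi⟩
      rw [hf.eq_of_mem_classes hP hS C.2 this, ← hf.eq_of_mem_classes hP hS C'.2 (hmem C')]
  · conv_lhs => rw [← hsum]
    exact val_sum_le ht _ fun C => restrict_nonneg hb C.1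

/-! ### Leaving a non-distinguishing support end component -/

omit hf ht in
theorem isIndist_of_not_distinguishing (hd : ¬ P.Distinguishing f) {b : Q → ℝ} (hb : 0 ≤ b)
    (hS : supp b ∈ dom f) : P.IsIndist f (supp b) b := by
  refine ⟨hb, subset_rfl, fun q hq q' hq' => ?_⟩
  by_contra h
  exact hd ⟨_, hS, q, hq, q', hq', h⟩

/-- A bound on the values of all exits bounds the value. -/
theorem IsSEC.val_le_of_exits {b : Q → ℝ} (hb : 0 ≤ b) (hS : supp b ∈ dom f)
    (htop : ∀ T ∈ dom f, top ∉ T) {M : ℝ} (hM : 0 ≤ M)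
    (hexit : ∀ c ∈ P.reachBel f b, ∀ a ∉ f (supp c), ∑ o, P.val {top} (P.push c a o) ≤ M) :
    P.val {top} b ≤ M := by
  refine val_le_of_horizonVal_le ht hb fun k => ?_
  -- The bound is proved at all beliefs reachable inside `f` at once. With no steps left the target
  -- has no mass; an action of `f` averages bounds over such beliefs, and any other action is an
  -- exit.
  have key : ∀ h, P.Follows f (supp b) h → P.horizonVal top k (P.updates b h) ≤ M := by
    induction k with
    | zero =>
      intro h hh
      have h1 : top ∉ supp (P.updates b h) := by
        rw [P.supp_updates hb]
        exact htop _ (hf.succs_mem hS hh)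
      exact (eq_zero_of_notMem_supp (P.updates_nonneg hb h) h1).trans_le hM
    | succ k ih =>
      intro h hh
      have hnn := P.updates_nonneg hb h
      refine P.horizonVal_succ_le fun a => ?_
      by_cases ha : a ∈ f (supp (P.updates b h))
      · by_cases h₀ : P.updates b h = 0
        · simpa [h₀, push_zero, P.horizonVal_zero] using hM
        calc ∑ o, P.horizonVal top k (P.push (P.updates b h) a o)
            ≤ ∑ o, P.belObsProb (P.updates b h) a o * M := by
              refine Finset.sum_le_sum fun o _ => ?_
              rw [← P.belObsProb_smul_update hnn,
                P.horizonVal_smul top k (P.belObsProb_nonneg hnn a o)]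
              by_cases hne : (P.succ (supp (P.updates b h)) a o).Nonempty
              · refine mul_le_mul_of_nonneg_left ?_ (P.belObsProb_nonneg hnn a o)
                have := ih (h ++ [(a, o)]) ((P.follows_append _ _ _ _).2 ⟨hh, by
                  rw [← P.supp_updates hb]
                  exact ⟨ha, hne, trivial⟩⟩)
                rwa [updates_append] at this
              · have : P.push (P.updates b h) a o = 0 := by
                  refine eq_zero_of_supp_eq_empty (P.push_nonneg hnn a o) ?_
                  rw [P.supp_push hnn, Set.not_nonempty_iff_eq_empty.1 hne]
                rw [belObsProb_eq, this]
                simp [mass_zero]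
          _ = M := by
              rw [← Finset.sum_mul, P.sum_belObsProb (mass_pos hnn h₀).ne', one_mul]
      · exact (Finset.sum_le_sum fun o _ => horizonVal_le_val ht (P.push_nonneg hnn a o) k).trans
          (hexit _ ⟨h, hh, rfl⟩ a ha)
  exact key [] trivial

end SEC

/-! ### Rank -/

theorem below_refl (P : POMDP Q A O) (S : Set Q) : P.Below S S := ⟨[], rfl⟩

theorem Below.trans {P : POMDP Q A O} {S T U : Set Q} (h : P.Below S T) (h' : P.Below T U) :
    P.Below S U := by
  obtain ⟨g, rfl⟩ := h
  obtain ⟨g', rfl⟩ := h'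
  exact ⟨g' ++ g, P.succs_append _ _ _⟩

/-- The strict order of `BelowTot`. -/
def StrictBelow (P : POMDP Q A O) (S T : Set Q) : Prop := P.BelowTot S T ∧ ¬ P.BelowTot T S

/-- Strictly increasing chains of supports, of length `n` and ending in `S`. -/
def IsChainTo (P : POMDP Q A O) (S : Set Q) (n : ℕ) (s : ℕ → Set Q) : Prop :=
  s n = S ∧ (∀ i ≤ n, (s i).Nonempty) ∧ ∀ i < n, P.StrictBelow (s i) (s (i + 1))

theorem rankSupp_eq (P : POMDP Q A O) (S : Set Q) :
    P.rankSupp S = sSup {n | ∃ s, P.IsChainTo S n s} := rfl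

section PosteriorDeterministic

variable {P : POMDP Q A O} (hP : P.PosteriorDeterministic)
include hP

theorem Below.ncard_le {S T : Set Q} (h : P.Below S T) : S.ncard ≤ T.ncard := by
  obtain ⟨g, rfl⟩ := h
  exact ncard_succs_le hP _ _

theorem BelowTot.ncard_le {S T : Set Q} (h : P.BelowTot S T) : S.ncard ≤ T.ncard :=
  h.elim (fun h => h.ncard_le hP) le_of_lt

theorem BelowTot.trans {S T U : Set Q} (h : P.BelowTot S T) (h' : P.BelowTot T U) :
    P.BelowTot S U := by
  rcases h with h | h
  · rcases h' with h' | h'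
    · exact .inl (h.trans h')
    · exact .inr ((h.ncard_le hP).trans_lt h')
  · exact .inr (h.trans_le (h'.ncard_le hP))

theorem strictBelow_of_ncard_lt {S T : Set Q} (h : S.ncard < T.ncard) : P.StrictBelow S T :=
  ⟨.inr h, fun h' => (h'.ncard_le hP).not_gt h⟩

theorem IsChainTo.strictBelow {S : Set Q} {n : ℕ} {s : ℕ → Set Q} (hs : P.IsChainTo S n s)
    {i j : ℕ} (hij : i < j) (hj : j ≤ n) : P.StrictBelow (s i) (s j) := by
  induction j, hij using Nat.le_induction with
  | base => exact hs.2.2 i (by omega)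
  | succ j hij ih =>
    have h1 := ih (by omega)
    have h2 := hs.2.2 j (by omega)
    exact ⟨h1.1.trans hP h2.1, fun h => h1.2 (h2.1.trans hP h)⟩

/-- The `n + 1` members of a strict chain are distinct nonempty subsets of `Q`. -/
theorem IsChainTo.add_two_le {S : Set Q} {n : ℕ} {s : ℕ → Set Q} (hs : P.IsChainTo S n s) :
    n + 2 ≤ 2 ^ Fintype.card Q := by
  classical
  have hinj : Set.InjOn s (Finset.range (n + 1)) := by
    intro i hi j hj he
    rw [Finset.mem_coe, Finset.mem_range] at hi hj
    by_contra hne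
    rcases lt_or_gt_of_ne hne with h | h
    · have := hs.strictBelow hP h (by omega)
      rw [he] at this
      exact this.2 this.1
    · have := hs.strictBelow hP h (by omega)
      rw [he] at this
      exact this.2 this.1
  have h1 : ((Finset.range (n + 1)).image s).card ≤ (Finset.univ.erase (∅ : Set Q)).card := by
    refine Finset.card_le_card fun T hT => ?_
    obtain ⟨i, hi, rfl⟩ := Finset.mem_image.1 hT
    rw [Finset.mem_range] at hi
    exact Finset.mem_erase.2 ⟨(hs.2.1 i (by omega)).ne_empty, Finset.mem_univ _⟩
  rw [Finset.card_image_of_injOn hinj, Finset.card_range, Finset.card_erase_of_mem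
    (Finset.mem_univ _), Finset.card_univ, Fintype.card_set] at h1
  have := Nat.one_le_two_pow (n := Fintype.card Q)
  omega

theorem bddAbove_isChainTo (S : Set Q) : BddAbove {n | ∃ s, P.IsChainTo S n s} :=
  ⟨2 ^ Fintype.card Q, by rintro n ⟨s, hs⟩; have := hs.add_two_le hP; omega⟩

theorem IsChainTo.le_rankSupp {S : Set Q} {n : ℕ} {s : ℕ → Set Q} (hs : P.IsChainTo S n s) :
    n ≤ P.rankSupp S :=
  le_csSup (bddAbove_isChainTo hP S) ⟨s, hs⟩

theorem exists_isChainTo_rankSupp {S : Set Q} (hS : S.Nonempty) :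
    ∃ s, P.IsChainTo S (P.rankSupp S) s :=
  Nat.sSup_mem (s := {n | ∃ s, P.IsChainTo S n s}) ⟨0, fun _ => S, rfl, fun _ _ => hS, fun _ h => absurd h (Nat.not_lt_zero _)⟩
    (bddAbove_isChainTo hP S)

theorem rankSupp_empty : P.rankSupp ∅ = 0 := by
  have : {n | ∃ s, P.IsChainTo ∅ n s} = ∅ := by
    ext n
    simp only [Set.mem_ofPred_eq, Set.mem_empty_iff_false, iff_false, not_exists]
    intro s hs
    exact (hs.2.1 n le_rfl).ne_empty hs.1
  rw [rankSupp_eq, this, csSup_empty]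
  rfl

theorem rankSupp_add_two_le {S : Set Q} (hS : S.Nonempty) :
    P.rankSupp S + 2 ≤ 2 ^ Fintype.card Q := by
  obtain ⟨s, hs⟩ := exists_isChainTo_rankSupp hP hS
  exact hs.add_two_le hP

theorem rankSupp_lt {S T : Set Q} (hS : S.Nonempty) (hT : T.Nonempty) (h : P.StrictBelow S T) :
    P.rankSupp S + 1 ≤ P.rankSupp T := by
  obtain ⟨s, hs⟩ := exists_isChainTo_rankSupp hP hS
  set n := P.rankSupp S
  refine IsChainTo.le_rankSupp hP (s := fun i => if i ≤ n then s i else T)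
    ⟨if_neg (by omega), fun i _ => ?_, fun i hi => ?_⟩
  · by_cases h : i ≤ n
    · simpa only [if_pos h] using hs.2.1 i h
    · simpa only [if_neg h] using hT
  · rcases Nat.lt_or_ge i n with h' | h'
    · simpa only [if_pos h'.le, if_pos (Nat.succ_le_of_lt h')] using hs.2.2 i h'
    · obtain rfl : i = n := by omega
      simpa only [if_pos le_rfl, if_neg (Nat.not_succ_le_self n), hs.1] using h

/-- Replace the last member `S` of a longest chain by `T`. The last step remains strict because `S`
is below `T`. -/
theorem rankSupp_mono {S T : Set Q} (h : P.Below S T) : P.rankSupp S ≤ P.rankSupp T := by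
  rcases S.eq_empty_or_nonempty with rfl | hS
  · rw [rankSupp_empty hP]
    exact Nat.zero_le _
  obtain ⟨s, hs⟩ := exists_isChainTo_rankSupp hP hS
  have hT : T.Nonempty := by
    rw [← Set.ncard_pos]
    exact ((Set.ncard_pos).2 hS).trans_le (h.ncard_le hP)
  set n := P.rankSupp S
  refine IsChainTo.le_rankSupp hP (s := fun i => if i < n then s i else T)
    ⟨if_neg (lt_irrefl n), fun i hi => ?_, fun i hi => ?_⟩
  · by_cases h : i < n
    · simpa only [if_pos h] using hs.2.1 i hi
    · simpa only [if_neg h] using hT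
  · rcases Nat.lt_or_ge (i + 1) n with h' | h'
    · simpa only [if_pos h', if_pos hi] using hs.2.2 i hi
    · have hn : n = i + 1 := by omega
      have h1 := hs.2.2 i hi
      rw [← hn, hs.1] at h1
      simp only [if_pos hi, if_neg (show ¬ i + 1 < n by omega)]
      exact ⟨h1.1.trans hP (.inl h), fun h2 => h1.2 (BelowTot.trans hP (.inl h) h2)⟩

/-- A member of a chain just before `{s}` would be nonempty and either smaller than a singleton or
reachable from `{s}`, so it would be `{s}` itself. -/
theorem rankSupp_absorbing {s : Q} (hs : P.Absorbing s) : P.rankSupp {s} = 0 := by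
  obtain ⟨c, hc⟩ := exists_isChainTo_rankSupp hP (Set.singleton_nonempty s)
  by_contra hn
  obtain ⟨n, hn⟩ := Nat.exists_eq_succ_of_ne_zero hn
  rw [hn] at hc
  have h1 := hc.2.2 n (by omega)
  have h2 := hc.2.1 n (by omega)
  rw [Nat.succ_eq_add_one, IsChainTo] at hc
  rw [hc.1] at h1
  have h3 : c n = {s} := by
    rcases h1.1 with ⟨g, hg⟩ | h
    · exact (Set.subset_singleton_iff_eq.1 (hg ▸ succs_subset_of_absorbing hs g)).resolve_left
        h2.ne_empty
    · rw [Set.ncard_singleton, Nat.lt_one_iff, Set.ncard_eq_zero] at h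
      exact absurd h h2.ne_empty
  rw [h3] at h1
  exact h1.2 h1.1

end PosteriorDeterministic

/-! ### Positive rank outside the leaves, and absence of the target from SECs -/

theorem exists_mem_succs_of_horizonVal_pos {P : POMDP Q A O} {top : Q} {k : ℕ} {b : Q → ℝ}
    (hb : 0 ≤ b) (h : 0 < P.horizonVal top k b) : ∃ g, top ∈ P.succs (supp b) g := by
  induction k generalizing b with
  | zero => exact ⟨[], h⟩
  | succ k ih =>
    by_contra! hc
    refine h.not_ge (P.horizonVal_succ_le fun a => Finset.sum_nonpos fun o _ => ?_)
    by_contra! hpos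
    obtain ⟨g, hg⟩ := ih (P.push_nonneg hb a o) hpos
    rw [P.supp_push hb] at hg
    exact hc ((a, o) :: g) hg

theorem IsStandard.val_eq_zero {P : POMDP Q A O} {top bot : Q} (hs : P.IsStandard top bot)
    {b : Q → ℝ} (hb : 0 ≤ b) (h : supp b ⊆ {bot}) : P.val {top} b = 0 := by
  classical
  have h1 : (0 : Q → ℝ) ≤ Pi.single bot 1 := Pi.single_nonneg.2 zero_le_one
  have h2 : b = b bot • Pi.single bot 1 := by
    ext q
    by_cases hq : q = bot
    · subst hq
      simp
    · rw [eq_zero_of_notMem_supp hb fun h' => hq (h h')]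
      simp [Pi.single_eq_of_ne hq]
  rw [h2, val_smul hs.absorbing_top h1 (hb bot), (hs.val_eq_zero_iff bot).2 rfl, mul_zero]

/-- If there are several states, a singleton is strictly below by cardinality. A single state other
than `bot` has positive value, so it can reach `top`, and `{top}` is strictly below because nothing
leaves it. -/
theorem IsStandard.one_le_rankSupp {P : POMDP Q A O} (hP : P.PosteriorDeterministic) {top bot : Q}
    (hs : P.IsStandard top bot) {S : Set Q} (hS : S.Nonempty) (h1 : S ≠ {top}) (h2 : S ≠ {bot}) :
    1 ≤ P.rankSupp S := by
  classical
  obtain ⟨q, hq⟩ := hS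
  suffices h : ∃ T : Set Q, T.Nonempty ∧ P.StrictBelow T S by
    obtain ⟨T, hT, hTS⟩ := h
    exact le_trans (by omega) (rankSupp_lt hP hT ⟨q, hq⟩ hTS)
  by_cases hc : 1 < S.ncard
  · exact ⟨{q}, Set.singleton_nonempty q, strictBelow_of_ncard_lt hP (by rwa [Set.ncard_singleton])⟩
  · have hSq : S = {q} := by
      refine (Set.eq_of_subset_of_ncard_le (Set.singleton_subset_iff.2 hq) ?_).symm
      rw [Set.ncard_singleton]
      omega
    subst hSq
    have hsing : supp (Pi.single q 1 : Q → ℝ) = {q} := by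
      ext x
      by_cases hx : x = q
      · subst hx
        simp [supp]
      · simp [supp, hx]
    have h3 : (0 : Q → ℝ) ≤ Pi.single q 1 := Pi.single_nonneg.2 zero_le_one
    have h4 : ¬ P.val {top} (Pi.single q 1) ≤ 0 := fun h => h2 (by
      rw [(hs.val_eq_zero_iff q).1 (le_antisymm h (val_nonneg hs.absorbing_top h3))])
    obtain ⟨k, hk⟩ : ∃ k, 0 < P.horizonVal top k (Pi.single q 1) := by
      by_contra! hc
      exact h4 (val_le_of_horizonVal_le hs.absorbing_top h3 hc)
    obtain ⟨g, hg⟩ := exists_mem_succs_of_horizonVal_pos h3 hk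
    rw [hsing] at hg
    have h5 : P.succs {q} g = {top} := by
      refine (Set.eq_of_subset_of_ncard_le (Set.singleton_subset_iff.2 hg) ?_).symm
      refine (ncard_succs_le hP _ _).trans ?_
      rw [Set.ncard_singleton, Set.ncard_singleton]
    refine ⟨{top}, Set.singleton_nonempty _, .inl ⟨g, h5⟩, ?_⟩
    rintro (⟨g', hg'⟩ | h)
    · have := hg' ▸ succs_subset_of_absorbing hs.absorbing_top g'
      exact h1 (by rw [Set.singleton_subset_iff.1 this])
    · rw [Set.ncard_singleton, Set.ncard_singleton] at h
      exact lt_irrefl _ h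

/-- If `top` belonged to `T`, the observation that signals `top` would shrink the support to
`{top}`, from where the SEC could not return to `S`. -/
theorem IsStandard.notMem_of_mem_dom {P : POMDP Q A O} {top bot : Q} (hs : P.IsStandard top bot)
    {f : Set Q → Set A} (hf : P.IsSEC f) {S : Set Q} (hS : S ∈ dom f) (hne : S ≠ {top}) {T : Set Q}
    (hT : T ∈ dom f) : top ∉ T := by
  intro htop
  have key : ∀ U ∈ dom f, U ≠ {top} → {top} ∉ dom f := by
    intro U hU hU' h
    obtain ⟨g, -, hg⟩ := hf.connected _ h U hU
    refine hU' ((Set.subset_singleton_iff_eq.1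
      (hg ▸ succs_subset_of_absorbing hs.absorbing_top g)).resolve_left ?_)
    exact (hf.nonempty U hU).ne_empty
  obtain ⟨o₀, ho₀⟩ := hs.observable_top
  obtain ⟨a, ha⟩ := hT
  obtain ⟨⟨o, q⟩, hoq⟩ := (P.trans top a).support_nonempty
  have h1 : 0 < P.prob top a o q :=
    ENNReal.toReal_pos hoq (PMF.apply_ne_top _ _)
  obtain rfl : q = top := hs.absorbing_top _ _ _ h1
  obtain rfl : o = o₀ := (ho₀ _ _ _ _ h1).2 rfl
  have h2 : P.succ T a o = {q} := by
    ext x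
    constructor
    · rintro ⟨y, -, hy⟩
      exact (ho₀ _ _ _ _ hy).1 rfl
    · rintro rfl
      exact ⟨x, htop, h1⟩
  refine key S hS hne ?_
  rw [← h2]
  exact hf.closed T ⟨a, ha⟩ a ha o (h2 ▸ Set.singleton_nonempty _)

/-! ### Plays that avoid leaves and the identification of classes -/

/-- A max node whose support is `S` may have a child whose support is `S'` and whose action is
`a`. -/
def IsExit (P : POMDP Q A O) (S S' : Set Q) (a : A) : Prop :=
  (∃ f, P.IsMaxSEC f ∧ S ∈ dom f ∧ S' ∈ P.reachSupp f S ∧ a ∉ f S') ∨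
    (¬ ∃ f, P.IsMaxSEC f ∧ S ∈ dom f) ∧ S' = S

theorem mem_reachSupp_self (P : POMDP Q A O) (f : Set Q → Set A) (S : Set Q) :
    S ∈ P.reachSupp f S := ⟨[], trivial, rfl⟩

theorem reachSupp_trans {P : POMDP Q A O} {f : Set Q → Set A} {S T U : Set Q}
    (hT : T ∈ P.reachSupp f S) (hU : U ∈ P.reachSupp f T) : U ∈ P.reachSupp f S := by
  obtain ⟨h, hh, rfl⟩ := hT
  obtain ⟨g, hg, rfl⟩ := hU
  exact ⟨h ++ g, (P.follows_append _ _ _ _).2 ⟨hh, hg⟩, P.succs_append _ _ _⟩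

theorem succ_mem_reachSupp {P : POMDP Q A O} {f : Set Q → Set A} {S : Set Q} {a : A} {o : O}
    (ha : a ∈ f S) (hne : (P.succ S a o).Nonempty) : P.succ S a o ∈ P.reachSupp f S :=
  ⟨[(a, o)], ⟨ha, hne, trivial⟩, rfl⟩

theorem Follows.of_closed {P : POMDP Q A O} {f g : Set Q → Set A} {Y : Set (Set Q)}
    (hY : ∀ T ∈ Y, ∀ a ∈ f T, ∀ o, (P.succ T a o).Nonempty → P.succ T a o ∈ Y)
    (hfg : ∀ T ∈ Y, f T ⊆ g T) {S : Set Q} (hS : S ∈ Y) {h : List (A × O)} (hh : P.Follows f S h) :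
    P.Follows g S h ∧ P.succs S h ∈ Y := by
  induction h generalizing S with
  | nil => exact ⟨trivial, hS⟩
  | cons m h ih =>
    obtain ⟨h1, h2⟩ := ih (hY S hS _ hh.1 _ hh.2.1) hh.2.2
    exact ⟨⟨hfg S hS hh.1, hh.2.1, h1⟩, h2⟩

/-- One cannot exit maximal support end components forever. -/
theorem eq_empty_of_exits {P : POMDP Q A O} {Z : Set (Set Q)} (hne : ∀ S ∈ Z, S.Nonempty)
    (hZ : ∀ S ∈ Z, ∃ S' a, P.IsExit S S' a ∧
      ∀ o, (P.succ S' a o).Nonempty → P.succ S' a o ∈ Z) : Z = ∅ := by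
  by_contra hZe
  obtain ⟨S₀, hS₀⟩ := Set.nonempty_iff_ne_empty.2 hZe
  -- `Z` is enlarged by everything that can be visited inside the maximal SECs met in `Z`.
  let Y : Set (Set Q) := {T | T ∈ Z ∨ ∃ S ∈ Z, ∃ f, P.IsMaxSEC f ∧ S ∈ dom f ∧ T ∈ P.reachSupp f S}
  have hYne : ∀ T ∈ Y, T.Nonempty := by
    rintro T (hT | ⟨S, -, f, hf, hSf, h, hh, rfl⟩)
    · exact hne T hT
    · exact hf.1.nonempty _ (hf.1.succs_mem hSf hh)
  have hYclosed : ∀ T ∈ Y, ∀ f, P.IsMaxSEC f → T ∈ dom f → ∀ U ∈ P.reachSupp f T, U ∈ Y := by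
    rintro T (hT | ⟨S, hS, f', hf', hSf', hT'⟩) f hf hTf U hU
    · exact .inr ⟨T, hT, f, hf, hTf, hU⟩
    · have hTf' : T ∈ dom f' := by
        obtain ⟨h, hh, rfl⟩ := hT'
        exact hf'.1.succs_mem hSf' hh
      obtain rfl := hf.eq hf' hTf hTf'
      exact .inr ⟨S, hS, f, hf, hSf', reachSupp_trans hT' hU⟩
  have hYexit : ∀ T ∈ Y, ∃ S' a, P.IsExit T S' a ∧ S' ∈ Y ∧
      ∀ o, (P.succ S' a o).Nonempty → P.succ S' a o ∈ Y := by
    intro T hT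
    rcases id hT with hTZ | ⟨S, hS, f, hf, hSf, hTf⟩
    · obtain ⟨S', a, hex, ho⟩ := hZ T hTZ
      refine ⟨S', a, hex, ?_, fun o h => .inl (ho o h)⟩
      rcases hex with ⟨f, hf, hTf, hS', -⟩ | ⟨-, rfl⟩
      · exact hYclosed T hT f hf hTf S' hS'
      · exact hT
    · obtain ⟨S', a, hex, ho⟩ := hZ S hS
      have hTd : T ∈ dom f := by
        obtain ⟨h, hh, rfl⟩ := hTf
        exact hf.1.succs_mem hSf hh
      rcases hex with ⟨f', hf', hSf', hS', ha⟩ | ⟨h, -⟩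
      · obtain rfl := hf.eq hf' hSf hSf'
        have hS'd : S' ∈ dom f := by
          obtain ⟨h, hh, rfl⟩ := hS'
          exact hf.1.succs_mem hSf hh
        have h1 := hf.1.connected T hTd S' hS'd
        -- By connectedness, an exit available from `S` is available from every support of the same
        -- SEC.
        exact ⟨S', a, .inl ⟨f, hf, hTd, h1, ha⟩, hYclosed T hT f hf hTd S' h1,
          fun o h => .inl (ho o h)⟩
      · exact absurd ⟨f, hf, hSf⟩ h
  -- `g` allows all actions that surely remain in `Y`: it includes the actions of maximal SECs as
  -- well as the chosen exit actions.
  let g : Set Q → Set A := fun T => {a | T ∈ Y ∧ ∀ o, (P.succ T a o).Nonempty → P.succ T a o ∈ Y}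
  have hfg : ∀ f, P.IsMaxSEC f → ∀ T ∈ Y, f T ⊆ g T := fun f hf T hT a ha =>
    ⟨hT, fun o ho => hYclosed T hT f hf ⟨a, ha⟩ _ (succ_mem_reachSupp ha ho)⟩
  have hgne : ∀ T ∈ Y, (g T).Nonempty := by
    intro T hT
    obtain ⟨S', a, hex, hS', ho⟩ := hYexit T hT
    rcases hex with ⟨f, hf, hTf, -, -⟩ | ⟨-, rfl⟩
    · exact hTf.mono (hfg f hf T hT)
    · exact ⟨a, hT, ho⟩
  have hgY : ∀ T ∈ Y, ∀ a ∈ g T, ∀ o, (P.succ T a o).Nonempty → P.succ T a o ∈ Y :=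
    fun T _ a ha => ha.2
  -- A smallest reachable set under `g` is a bottom component: each of its members reaches all of
  -- it. The restriction of `g` to it is therefore an SEC.
  obtain ⟨T₀, hT₀, hmin⟩ := Set.exists_min_image Y (fun T => (P.reachSupp g T).ncard)
    (Set.toFinite Y) ⟨S₀, .inl hS₀⟩
  set B := P.reachSupp g T₀ with hB
  have hBY : B ⊆ Y := by
    rintro T ⟨h, hh, rfl⟩
    exact (Follows.of_closed hgY (fun _ _ => subset_rfl) hT₀ hh).2
  have hBclosed : ∀ T ∈ B, ∀ a ∈ g T, ∀ o, (P.succ T a o).Nonempty → P.succ T a o ∈ B :=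
    fun T hT a ha o ho => reachSupp_trans hT (succ_mem_reachSupp ha ho)
  have hBeq : ∀ T ∈ B, P.reachSupp g T = B := fun T hT =>
    Set.eq_of_subset_of_ncard_le (fun U hU => reachSupp_trans hT hU) (hmin T (hBY hT))
  let gB : Set Q → Set A := fun T => {a | T ∈ B ∧ a ∈ g T}
  have hdom : ∀ T, T ∈ dom gB → T ∈ B := by
    rintro T ⟨a, ha⟩
    exact ha.1
  have hdom' : ∀ T ∈ B, T ∈ dom gB := fun T hT => (hgne T (hBY hT)).imp fun a ha => ⟨hT, ha⟩
  have hSEC : P.IsSEC gB := by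
    refine ⟨fun T hT => hYne T (hBY (hdom T hT)), fun T hT a ha o ho => ?_, fun T hT U hU => ?_⟩
    · exact hdom' _ (hBclosed T ha.1 a ha.2 o ho)
    · have hU' := hdom U hU
      rw [← hBeq T (hdom T hT)] at hU'
      obtain ⟨h, hh, hhU⟩ := hU'
      exact ⟨h, (Follows.of_closed (g := gB) hBclosed (fun T hT a ha => ⟨hT, ha⟩) (hdom T hT) hh).1, hhU⟩
  obtain ⟨f', hf', hle⟩ := hSEC.exists_isMaxSEC
  have hT₀B : T₀ ∈ B := P.mem_reachSupp_self g T₀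
  have hT₀f' : T₀ ∈ dom f' := (hdom' T₀ hT₀B).mono (hle T₀)
  obtain ⟨S', a, hex, hS', ho⟩ := hYexit T₀ hT₀
  -- The exit action from `T₀` is allowed by `g` within the bottom component, hence by the maximal
  -- SEC that contains it, which is `f`: contradiction. Nor can `T₀` lie outside all maximal SECs.
  rcases hex with ⟨f, hf, hTf, ⟨h, hh, rfl⟩, ha⟩ | ⟨h, -⟩
  · obtain rfl := hf.eq hf' hTf hT₀f'
    refine ha (hle _ ⟨?_, hS', ho⟩)
    exact ⟨h, (Follows.of_closed (fun T hT a ha o ho => hYclosed T hT f hf ⟨a, ha⟩ _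
      (succ_mem_reachSupp ha ho)) (hfg f hf) hT₀ hh).1, rfl⟩
  · exact h ⟨f', hf', hT₀f'⟩

/-- The supports from which `k` choices can be made such that, whatever is observed, neither a leaf
nor an identification of classes is met. -/
def avoid (P : POMDP Q A O) (top bot : Q) : ℕ → Set (Set Q)
  | 0 => {S | S.Nonempty ∧ S ≠ {top} ∧ S ≠ {bot} ∧
      ∀ f, P.IsMaxSEC f → S ∈ dom f → ¬ P.Distinguishing f}
  | k + 1 => {S | S ∈ P.avoid top bot 0 ∧ ∃ S' a, P.IsExit S S' a ∧
      ∀ o, (P.succ S' a o).Nonempty → P.succ S' a o ∈ P.avoid top bot k}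

theorem mem_avoid_zero {P : POMDP Q A O} {top bot : Q} {S : Set Q} :
    S ∈ P.avoid top bot 0 ↔ S.Nonempty ∧ S ≠ {top} ∧ S ≠ {bot} ∧
      ∀ f, P.IsMaxSEC f → S ∈ dom f → ¬ P.Distinguishing f := by
  rw [avoid, Set.mem_ofPred_eq]

theorem mem_avoid_succ {P : POMDP Q A O} {top bot : Q} {k : ℕ} {S : Set Q} :
    S ∈ P.avoid top bot (k + 1) ↔ S ∈ P.avoid top bot 0 ∧ ∃ S' a, P.IsExit S S' a ∧
      ∀ o, (P.succ S' a o).Nonempty → P.succ S' a o ∈ P.avoid top bot k := by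
  conv_lhs => rw [avoid, Set.mem_ofPred_eq]

theorem avoid_succ_subset (P : POMDP Q A O) (top bot : Q) (k : ℕ) :
    P.avoid top bot (k + 1) ⊆ P.avoid top bot k := by
  induction k with
  | zero => exact fun S hS => (mem_avoid_succ.1 hS).1
  | succ k ih =>
    intro S hS
    obtain ⟨h, S', a, hex, ho⟩ := mem_avoid_succ.1 hS
    exact mem_avoid_succ.2 ⟨h, S', a, hex, fun o hne => ih (ho o hne)⟩

theorem nonempty_of_mem_avoid {P : POMDP Q A O} {top bot : Q} {k : ℕ} {S : Set Q}
    (h : S ∈ P.avoid top bot k) : S.Nonempty := by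
  cases k with
  | zero => exact (mem_avoid_zero.1 h).1
  | succ k => exact (mem_avoid_zero.1 (mem_avoid_succ.1 h).1).1

/-- These sets decrease. As soon as two consecutive ones agree, exits can continue forever, so they
are empty by `eq_empty_of_exits`; until then an element is lost at each round. At the start `∅` is
missing from the power set, which accounts for the `+ 1`. -/
theorem avoid_eq_empty_or (P : POMDP Q A O) (top bot : Q) (k : ℕ) :
    P.avoid top bot k = ∅ ∨ (P.avoid top bot k).ncard + k + 1 ≤ 2 ^ Fintype.card Q := by
  induction k with
  | zero =>
    right
    have h : P.avoid top bot 0 ⊂ Set.univ :=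
      Set.ssubset_univ_iff.2 fun h => Set.not_nonempty_empty
        (nonempty_of_mem_avoid (k := 0) (h ▸ Set.mem_univ (∅ : Set Q)))
    have := Set.ncard_lt_ncard h
    rwa [Set.ncard_univ, Nat.card_eq_fintype_card, Fintype.card_set] at this
  | succ k ih =>
    by_cases he : P.avoid top bot (k + 1) = P.avoid top bot k
    · left
      exact eq_empty_of_exits (fun S hS => nonempty_of_mem_avoid hS) fun S hS => by
        obtain ⟨-, S', a, hex, ho⟩ := mem_avoid_succ.1 hS
        exact ⟨S', a, hex, fun o hne => he ▸ ho o hne⟩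
    · have hlt := Set.ncard_lt_ncard ((P.avoid_succ_subset top bot k).ssubset_of_ne he)
      rcases ih with ih | ih
      · rw [ih, Set.ncard_empty] at hlt
        omega
      · right
        omega

theorem avoid_eq_empty (P : POMDP Q A O) (top bot : Q) :
    P.avoid top bot (2 ^ Fintype.card Q - 1) = ∅ := by
  have h1 := Nat.one_le_two_pow (n := Fintype.card Q)
  refine (P.avoid_eq_empty_or top bot _).elim id fun h => ?_
  rw [← Set.ncard_eq_zero]
  omega

/-! ### Backward induction in the unfolding -/

/-- The statistic obtained by backward induction from the values `φ` of the leaves. -/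
noncomputable def UTree.eval (φ : Label Q A → ℝ) : UTree Q A → ℝ
  | .leaf x => φ x
  | @UTree.sum _ _ _ _ _ weight child => ∑ i, weight i * (child i).eval φ
  | .cut _ child => child.eval φ
  | .max _ _ child => ⨆ i, (child i).eval φ

open Classical in
/-- The value at a leaf. -/
noncomputable def leafVal (top : Q) (x : Label Q A) : ℝ :=
  if supp x.belief = {top} then mass x.belief else 0

/-- The rank at a leaf. -/
noncomputable def leafRank (P : POMDP Q A O) (x : Label Q A) : ℝ := P.rank x.belief

theorem value_eq_eval (top : Q) (t : UTree Q A) : t.value top = t.eval (leafVal top) := by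
  induction t with
  | leaf x => rfl
  | sum x ι w c ih => simp only [UTree.value, UTree.eval, ih]
  | cut x c ih => simp only [UTree.value, UTree.eval, ih]
  | max x ι c ih => simp only [UTree.value, UTree.eval, ih]

theorem rank_eq_eval (P : POMDP Q A O) (t : UTree Q A) : t.rank P = t.eval P.leafRank := by
  induction t with
  | leaf x => rfl
  | sum x ι w c ih => simp only [UTree.rank, UTree.eval, ih]
  | cut x c ih => simp only [UTree.rank, UTree.eval, ih]
  | max x ι c ih => simp only [UTree.rank, UTree.eval, ih]

theorem UTree.eval_smul {r : ℝ} (hr : 0 ≤ r) (φ : Label Q A → ℝ) (t : UTree Q A) :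
    t.eval (fun x => r * φ x) = r * t.eval φ := by
  induction t with
  | leaf x => rfl
  | sum x ι w c ih =>
    simp only [UTree.eval, ih, Finset.mul_sum]
    exact Finset.sum_congr rfl fun i _ => by ring
  | cut x c ih => simp only [UTree.eval, ih]
  | max x ι c ih => simp only [UTree.eval, ih, Real.mul_iSup_of_nonneg hr]

/-- The statistic of the root of the truncated unfolding. -/
noncomputable def stat (P : POMDP Q A O) (top bot : Q) (η : ℝ) (φ : Label Q A → ℝ) (n : ℕ)
    (x : Label Q A) : ℝ :=
  (P.unfolding top bot η n x).eval φ

section Unfolding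

variable (P : POMDP Q A O) (top bot : Q) (η : ℝ) (φ : Label Q A → ℝ)

theorem stat_zero : P.stat top bot η φ 0 = φ := by
  ext x
  cases x <;> rfl

theorem stat_leaf (n : ℕ) {b : Q → ℝ} (h : supp b = {top} ∨ supp b = {bot}) :
    P.stat top bot η φ n (.bel b) = φ (.bel b) := by
  cases n with
  | zero => rfl
  | succ n =>
    rw [stat, unfolding, if_pos h]
    rfl

/-- The deeper tree is the truncation at `m` whose leaves are evaluated by truncations at `n`. With
`m = 1` or `n = 1`, all estimates reduce to a single level of the tree. -/
theorem stat_add (m n : ℕ) (x : Label Q A) :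
    P.stat top bot η φ (m + n) x = P.stat top bot η (P.stat top bot η φ n) m x := by
  induction m generalizing x with
  | zero => rw [zero_add, stat_zero]
  | succ m ih =>
    rw [Nat.succ_add]
    cases x with
    | act b a =>
      simp only [stat, unfolding, UTree.eval] at ih ⊢
      simp only [ih]
    | bel b =>
      by_cases h : supp b = {top} ∨ supp b = {bot}
      · rw [stat_leaf _ _ _ _ _ _ h, stat_leaf _ _ _ _ _ _ h, stat_leaf _ _ _ _ _ _ h]
      simp only [stat, unfolding] at ih ⊢
      rw [if_neg h, if_neg h]
      split_ifs <;> simp only [UTree.eval, ih]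

theorem stat_succ (n : ℕ) (x : Label Q A) :
    P.stat top bot η φ (n + 1) x = P.stat top bot η (P.stat top bot η φ n) 1 x := by
  rw [add_comm, stat_add]

/-- The node labelled `b` is a max node. -/
structure IsMaxNode (b : Q → ℝ) : Prop where
  not_leaf : ¬ (supp b = {top} ∨ supp b = {bot})
  large : ∀ q, b q ≠ 0 → η ≤ b q
  not_dist : ∀ f, P.IsMaxSEC f → supp b ∈ dom f → ¬ P.Distinguishing f

/-- The node labelled `b` is split into the classes of the support end component `f`. -/
structure IsSplitNode (f : Set Q → Set A) (b : Q → ℝ) : Prop where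
  not_leaf : ¬ (supp b = {top} ∨ supp b = {bot})
  large : ∀ q, b q ≠ 0 → η ≤ b q
  isMaxSEC : P.IsMaxSEC f
  mem : supp b ∈ dom f
  dist : P.Distinguishing f

theorem node_cases (b : Q → ℝ) : (supp b = {top} ∨ supp b = {bot}) ∨
    (¬ (supp b = {top} ∨ supp b = {bot}) ∧ ∃ q, b q ≠ 0 ∧ b q < η) ∨
    (∃ f, P.IsSplitNode top bot η f b) ∨ P.IsMaxNode top bot η b := by
  by_cases h1 : supp b = {top} ∨ supp b = {bot}
  · exact .inl h1
  by_cases h2 : ∃ q, b q ≠ 0 ∧ b q < η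
  · exact .inr (.inl ⟨h1, h2⟩)
  push Not at h2
  by_cases h3 : ∃ f, P.IsMaxSEC f ∧ supp b ∈ dom f ∧ P.Distinguishing f
  · obtain ⟨f, hf, hb, hd⟩ := h3
    exact .inr (.inr (.inl ⟨f, h1, h2, hf, hb, hd⟩))
  · exact .inr (.inr (.inr ⟨h1, h2, fun f hf hb hd => h3 ⟨f, hf, hb, hd⟩⟩))

/-- The children of a max node. -/
def exits (b : Q → ℝ) : Set ((Q → ℝ) × A) :=
  {y | (∃ f, P.IsMaxSEC f ∧ supp b ∈ dom f ∧ y.1 ∈ P.reachBel f b ∧ y.2 ∉ f (supp y.1)) ∨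
    (¬ ∃ f, P.IsMaxSEC f ∧ supp b ∈ dom f) ∧ y.1 = b}

theorem stat_one_act {b : Q → ℝ} (hb : 0 ≤ b) (a : A) :
    P.stat top bot η φ 1 (.act b a) =
      ∑ o, P.belObsProb b a o * φ (.bel (P.update b a o)) := by
  classical
  simp only [stat, unfolding, UTree.eval]
  rw [← Finset.sum_filter_of_ne (p := fun o => 0 < P.belObsProb b a o)]
  · rw [Finset.sum_subtype (Finset.univ.filter fun o => 0 < P.belObsProb b a o)
      (p := fun o => 0 < P.belObsProb b a o) (by simp)]
  · intro o _ h
    exact (P.belObsProb_nonneg hb a o).lt_of_ne fun h' => h (by rw [← h', zero_mul])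

theorem stat_one_cut {b : Q → ℝ} (h1 : ¬ (supp b = {top} ∨ supp b = {bot}))
    (h2 : ∃ q, b q ≠ 0 ∧ b q < η) :
    P.stat top bot η φ 1 (.bel b) = φ (.bel (POMDP.cut η b)) := by
  simp only [stat, unfolding]
  rw [if_neg h1, if_pos h2]
  rfl

variable {P top bot η}

open Classical in
-- The SEC picked by choice in the unfolding is `f`, by uniqueness of the maximal SEC around a
-- support.
theorem IsSplitNode.stat_one {f : Set Q → Set A} {b : Q → ℝ} (h : P.IsSplitNode top bot η f b) :
    P.stat top bot η φ 1 (.bel b) = ∑ C : {C // C ∈ P.classes f (supp b)},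
      (mass (restrict b C.1) / mass b) *
        φ (.bel ((mass b / mass (restrict b C.1)) • restrict b C.1)) := by
  simp only [stat, unfolding]
  have h2 : ¬ ∃ q, b q ≠ 0 ∧ b q < η := by
    push Not
    exact h.large
  have h3 : ∃ f, P.IsMaxSEC f ∧ supp b ∈ dom f := ⟨f, h.isMaxSEC, h.mem⟩
  have h4 : h3.choose = f := h3.choose_spec.1.eq h.isMaxSEC h3.choose_spec.2 h.mem
  rw [if_neg h.not_leaf, if_neg h2, dif_pos h3, if_pos (h4.symm ▸ h.dist), h4]
  rfl

/-- The set `exits` treats both kinds of max node alike: exits from a maximal SEC, or all actions at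
`b` itself. -/
theorem IsMaxNode.stat_one {b : Q → ℝ} (h : P.IsMaxNode top bot η b) :
    P.stat top bot η φ 1 (.bel b) = ⨆ y : P.exits b, φ (.act y.1.1 y.1.2) := by
  simp only [stat, unfolding]
  have h2 : ¬ ∃ q, b q ≠ 0 ∧ b q < η := by
    push Not
    exact h.large
  rw [if_neg h.not_leaf, if_neg h2]
  by_cases h3 : ∃ f, P.IsMaxSEC f ∧ supp b ∈ dom f
  · rw [dif_pos h3, if_neg (h.not_dist _ h3.choose_spec.1 h3.choose_spec.2)]
    refine Function.Surjective.iSup_congr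
      (fun y => ⟨y.1, .inl ⟨_, h3.choose_spec.1, h3.choose_spec.2, y.2⟩⟩) ?_ fun _ => rfl
    rintro ⟨y, ⟨f, hf, hfb, hy⟩ | ⟨h', -⟩⟩
    · obtain rfl := hf.eq h3.choose_spec.1 hfb h3.choose_spec.2
      exact ⟨⟨y, hy⟩, rfl⟩
    · exact absurd h3 h'
  · rw [dif_neg h3]
    refine Function.Surjective.iSup_congr (fun a => ⟨(b, a), .inr ⟨h3, rfl⟩⟩) ?_ fun _ => rfl
    rintro ⟨⟨c, a⟩, ⟨f, hf, hfb, -⟩ | ⟨-, hc⟩⟩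
    · exact absurd ⟨f, hf, hfb⟩ h3
    · obtain rfl : c = b := hc
      exact ⟨a, rfl⟩

end Unfolding

/-! ### The children of the nodes -/

section Children

variable {P : POMDP Q A O} {top bot : Q} {η : ℝ}

theorem IsSubBelief.nonneg' {b : Q → ℝ} (hb : IsSubBelief b) : 0 ≤ b := hb.nonneg

theorem IsSubBelief.of_mass_eq {b c : Q → ℝ} (hb : IsSubBelief b) (hc : 0 ≤ c)
    (h : mass c = mass b) : IsSubBelief c :=
  ⟨hc, h.trans_le hb.mass_le_one⟩

theorem isSubBelief_zero : IsSubBelief (0 : Q → ℝ) :=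
  ⟨fun _ => le_rfl, by rw [mass_zero]; exact zero_le_one⟩

theorem mass_updates {f : Set Q → Set A} {b : Q → ℝ} (hb : 0 ≤ b) {h : List (A × O)}
    (hh : P.Follows f (supp b) h) : mass (P.updates b h) = mass b := by
  induction h generalizing b with
  | nil => rfl
  | cons m h ih =>
    obtain ⟨a, o⟩ := m
    obtain ⟨ha, hne, hh⟩ := hh
    have h1 : mass (P.push b a o) ≠ 0 := by
      intro h
      rw [← P.supp_push hb, eq_zero_of_mass_eq_zero (P.push_nonneg hb a o) h, supp_zero] at hne
      exact Set.not_nonempty_empty hne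
    rw [← P.mass_update b a o h1]
    refine ih (P.update_nonneg hb a o) ?_
    rwa [P.supp_update hb]

theorem isSubBelief_update {b : Q → ℝ} (hb : IsSubBelief b) (a : A) (o : O) :
    IsSubBelief (P.update b a o) := by
  by_cases h : mass (P.push b a o) = 0
  · rw [update_eq, eq_zero_of_mass_eq_zero (P.push_nonneg hb.nonneg' a o) h, smul_zero]
    exact isSubBelief_zero
  · exact hb.of_mass_eq (P.update_nonneg hb.nonneg' a o) (P.mass_update b a o h)

theorem cut_nonneg {b : Q → ℝ} (hb : 0 ≤ b) : 0 ≤ POMDP.cut η b := by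
  intro q
  simp only [POMDP.cut, Pi.zero_apply]
  split_ifs
  · exact le_rfl
  · exact hb q

theorem cut_le {b : Q → ℝ} (hb : 0 ≤ b) : POMDP.cut η b ≤ b := by
  intro q
  simp only [POMDP.cut]
  split_ifs
  · exact hb q
  · exact le_rfl

theorem mass_mono {b c : Q → ℝ} (h : b ≤ c) : mass b ≤ mass c := Finset.sum_le_sum fun q _ => h q

theorem isSubBelief_cut {b : Q → ℝ} (hb : IsSubBelief b) : IsSubBelief (POMDP.cut η b) :=
  ⟨cut_nonneg hb.nonneg', (mass_mono (cut_le hb.nonneg')).trans hb.mass_le_one⟩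

theorem ncard_supp_cut {b : Q → ℝ} (hb : 0 ≤ b) (h : ∃ q, b q ≠ 0 ∧ b q < η) :
    (supp (POMDP.cut η b)).ncard + 1 ≤ (supp b).ncard := by
  obtain ⟨q, hq, hqη⟩ := h
  refine Set.ncard_lt_ncard ⟨fun x hx => ?_, fun hsub => ?_⟩
  · exact lt_of_lt_of_le hx (cut_le hb x)
  · have : q ∈ supp (POMDP.cut η b) := hsub ((hb q).lt_of_ne (Ne.symm hq))
    simp [supp, POMDP.cut, hqη] at this

/-- A child of a split node. -/
structure IsSplitChild (b c : Q → ℝ) : Prop where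
  nonneg : 0 ≤ c
  mass_eq : mass c = mass b
  nonempty : (supp c).Nonempty
  ncard_lt : (supp c).ncard < (supp b).ncard

section Split

variable {f : Set Q → Set A} {b : Q → ℝ} (hP : P.PosteriorDeterministic)
  (h : P.IsSplitNode top bot η f b) (hb : 0 ≤ b)
include hP h hb

theorem IsSplitNode.mass_pos : 0 < mass b := by
  refine POMDP.mass_pos hb ?_
  rintro rfl
  have := h.isMaxSEC.1.nonempty _ h.mem
  rw [supp_zero] at this
  exact Set.not_nonempty_empty this

theorem IsSplitNode.mass_restrict_pos {C : Set Q} (hC : C ∈ P.classes f (supp b)) :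
    0 < mass (restrict b C) := by
  refine POMDP.mass_pos (restrict_nonneg hb C) fun h0 => ?_
  have h1 := h.isMaxSEC.1.supp_restrict_class hP hC
  rw [h0, supp_zero] at h1
  obtain ⟨q, hq, rfl⟩ := hC
  exact (h1.symm ▸ Set.notMem_empty q) (⟨hq, h.isMaxSEC.1.indist_refl hP h.mem hq⟩ :
    q ∈ {q' ∈ supp b | P.Indist f (supp b) q q'})

/-- A distinguishing SEC separates two states at each of its supports, so no class is the whole
support. -/
theorem IsSplitNode.isSplitChild {C : Set Q} (hC : C ∈ P.classes f (supp b)) :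
    IsSplitChild b ((mass b / mass (restrict b C)) • restrict b C) := by
  have h1 := h.mass_pos hP hb
  have h2 := h.mass_restrict_pos hP hb hC
  have h3 : supp ((mass b / mass (restrict b C)) • restrict b C) = C := by
    rw [supp_smul (div_pos h1 h2), h.isMaxSEC.1.supp_restrict_class hP hC]
  refine ⟨smul_nonneg (div_pos h1 h2).le (restrict_nonneg hb C), ?_, ?_, ?_⟩
  · rw [mass_smul, div_mul_cancel₀ _ h2.ne']
  · rw [h3]
    obtain ⟨q, hq, rfl⟩ := hC
    exact ⟨q, hq, h.isMaxSEC.1.indist_refl hP h.mem hq⟩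
  · rw [h3]
    obtain ⟨q₀, hq₀, rfl⟩ := hC
    refine Set.ncard_lt_ncard ⟨fun x hx => hx.1, fun hsub => ?_⟩
    obtain ⟨q, hq, q', hq', hi⟩ := h.isMaxSEC.1.exists_not_indist hP h.dist h.mem
    exact hi (h.isMaxSEC.1.indist_trans hP h.mem hq hq₀ hq'
      (h.isMaxSEC.1.indist_symm hP h.mem hq₀ hq (hsub hq).2) (hsub hq').2)

open Classical in
theorem IsSplitNode.sum_weight :
    ∑ C : {C // C ∈ P.classes f (supp b)}, mass (restrict b C.1) / mass b = 1 := by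
  rw [← Finset.sum_div, ← mass_sum, h.isMaxSEC.1.sum_restrict hP hb h.mem,
    div_self (h.mass_pos hP hb).ne']

end Split

/-- A child of a max node. -/
structure IsExitChild (P : POMDP Q A O) (η : ℝ) (b c : Q → ℝ) (a : A) : Prop where
  nonneg : 0 ≤ c
  mass_eq : mass c = mass b
  large : ∀ q, c q ≠ 0 → η ≤ c q
  below : P.Below (supp c) (supp b)
  isExit : P.IsExit (supp b) (supp c) a

/-- Inside a non-distinguishing SEC, a reachable belief has entries among those of `b` and 0, so the
non-zero ones stay above the threshold `η`. -/
theorem IsMaxNode.isExitChild (hP : P.PosteriorDeterministic) {b : Q → ℝ}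
    (h : P.IsMaxNode top bot η b) (hb : 0 ≤ b) {y : (Q → ℝ) × A} (hy : y ∈ P.exits b) :
    P.IsExitChild η b y.1 y.2 := by
  obtain ⟨c, a⟩ := y
  rcases hy with ⟨f, hf, hfb, ⟨g, hg, rfl⟩, ha⟩ | ⟨hn, hc⟩
  · have hind := isIndist_of_not_distinguishing hP (h.not_dist f hf hfb) hb hfb
    refine ⟨P.updates_nonneg hb g, mass_updates hb hg, fun q hq => ?_, ⟨g, ?_⟩,
      .inl ⟨f, hf, hfb, ⟨g, hg, ?_⟩, ha⟩⟩
    · rcases hf.1.updates_eq_zero_or hP hfb hg hind q with h0 | ⟨q', -, hq'⟩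
      · exact absurd h0 hq
      · simp only [hq'] at hq ⊢
        exact h.large q' hq
    · exact (P.supp_updates hb g).symm
    · exact (P.supp_updates hb g).symm
  · obtain rfl : c = b := hc
    exact ⟨hb, rfl, h.large, P.below_refl _, .inr ⟨hn, rfl⟩⟩

/-- The value of the sub-belief of a node, or of a sub-belief after a given first action. -/
noncomputable def labelVal (P : POMDP Q A O) (top : Q) : Label Q A → ℝ
  | .bel b => P.val {top} b
  | .act b a => ∑ o, P.val {top} (P.push b a o)

theorem IsMaxNode.labelVal_le (hP : P.PosteriorDeterministic) (ht : P.Absorbing top) {b : Q → ℝ}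
    (h : P.IsMaxNode top bot η b) (hb : 0 ≤ b) {y : (Q → ℝ) × A} (hy : y ∈ P.exits b) :
    P.labelVal top (.act y.1 y.2) ≤ P.val {top} b := by
  obtain ⟨c, a⟩ := y
  refine (sum_val_push_le ht (h.isExitChild hP hb hy).nonneg a).trans_eq ?_
  rcases hy with ⟨f, hf, hfb, ⟨g, hg, rfl⟩, ha⟩ | ⟨hn, hc⟩
  · exact hf.1.val_updates hP ht hfb
      (isIndist_of_not_distinguishing hP (h.not_dist f hf hfb) hb hfb) hg
  · obtain rfl : c = b := hc
    rfl

theorem IsMaxNode.val_le (hP : P.PosteriorDeterministic) (hs : P.IsStandard top bot) {b : Q → ℝ}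
    (h : P.IsMaxNode top bot η b) (hb : 0 ≤ b) {M : ℝ} (hM : 0 ≤ M)
    (hexit : ∀ y ∈ P.exits b, P.labelVal top (.act y.1 y.2) ≤ M) : P.val {top} b ≤ M := by
  by_cases h3 : ∃ f, P.IsMaxSEC f ∧ supp b ∈ dom f
  · obtain ⟨f, hf, hfb⟩ := h3
    exact hf.1.val_le_of_exits hP hs.absorbing_top hb hfb
      (fun T hT => hs.notMem_of_mem_dom hf.1 hfb (fun h' => h.not_leaf (.inl h')) hT) hM
      fun c hc a ha => hexit (c, a) (.inl ⟨f, hf, hfb, hc, ha⟩)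
  · exact val_le_of_sum_val_push_le hs.absorbing_top hb fun a => hexit (b, a) (.inr ⟨h3, rfl⟩)

/-- The labels of the nodes that are reachable in the unfolding satisfy these bounds. -/
def Label.Good (η : ℝ) : Label Q A → Prop
  | .bel b => IsSubBelief b
  | .act b _ => IsSubBelief b ∧ ∀ q, b q ≠ 0 → η ≤ b q

theorem IsExitChild.good {b c : Q → ℝ} {a : A} (h : P.IsExitChild η b c a) (hb : IsSubBelief b) :
    (Label.act c a).Good η :=
  ⟨hb.of_mass_eq h.nonneg h.mass_eq, h.large⟩

theorem IsSplitChild.isSubBelief {b c : Q → ℝ} (h : IsSplitChild b c) (hb : IsSubBelief b) :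
    IsSubBelief c :=
  hb.of_mass_eq h.nonneg h.mass_eq

/-- The bound `K` is needed at max nodes, since a real supremum over an unbounded family has the
default value 0. -/
theorem stat_one_mono (hP : P.PosteriorDeterministic) {φ ψ : Label Q A → ℝ}
    (h : ∀ x : Label Q A, x.Good η → φ x ≤ ψ x) {K : ℝ} (hK : ∀ x : Label Q A, x.Good η → ψ x ≤ K)
    {x : Label Q A} (hx : x.Good η) : P.stat top bot η φ 1 x ≤ P.stat top bot η ψ 1 x := by
  classical
  cases x with
  | act b a =>
    have hb : IsSubBelief b := hx.1
    rw [stat_one_act _ _ _ _ _ hb.nonneg', stat_one_act _ _ _ _ _ hb.nonneg']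
    exact Finset.sum_le_sum fun o _ => mul_le_mul_of_nonneg_left (h _ (isSubBelief_update hb a o))
      (P.belObsProb_nonneg hb.nonneg' a o)
  | bel b =>
    have hb : IsSubBelief b := hx
    rcases P.node_cases top bot η b with h1 | ⟨h1, h2⟩ | ⟨f, h1⟩ | h1
    · rw [stat_leaf _ _ _ _ _ _ h1, stat_leaf _ _ _ _ _ _ h1]
      exact h _ hx
    · rw [stat_one_cut _ _ _ _ _ h1 h2, stat_one_cut _ _ _ _ _ h1 h2]
      exact h _ (isSubBelief_cut hb)
    · rw [h1.stat_one, h1.stat_one]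
      exact Finset.sum_le_sum fun C _ => mul_le_mul_of_nonneg_left
        (h _ ((h1.isSplitChild hP hb.nonneg' C.2).isSubBelief hb))
        (div_nonneg (mass_nonneg (restrict_nonneg hb.nonneg' _)) (mass_nonneg hb.nonneg'))
    · rw [h1.stat_one, h1.stat_one]
      have hg (y : P.exits b) := (h1.isExitChild hP hb.nonneg' y.2).good hb
      refine ciSup_mono ⟨K, ?_⟩ fun y => h _ (hg y)
      rintro _ ⟨y, rfl⟩
      exact hK _ (hg y)

end Children

/-! ### The value of the truncated unfolding -/

section Bounds

variable {P : POMDP Q A O} {top bot : Q} {η : ℝ}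

theorem Label.Good.isSubBelief {x : Label Q A} (hx : x.Good η) : IsSubBelief x.belief := by
  cases x with
  | bel b => exact hx
  | act b a => exact hx.1

theorem stat_const_zero (n : ℕ) (x : Label Q A) : P.stat top bot η (fun _ => 0) n x = 0 := by
  have := UTree.eval_smul le_rfl (fun _ => 0) (P.unfolding top bot η n x)
  simpa [stat] using this

theorem stat_smul {r : ℝ} (hr : 0 ≤ r) (φ : Label Q A → ℝ) (n : ℕ) (x : Label Q A) :
    P.stat top bot η (fun y => r * φ y) n x = r * P.stat top bot η φ n x :=
  UTree.eval_smul hr φ _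

theorem stat_nonneg (hP : P.PosteriorDeterministic) {φ : Label Q A → ℝ}
    (hφ : ∀ x : Label Q A, x.Good η → 0 ≤ φ x) {K : ℝ}
    (hK : ∀ n, ∀ x : Label Q A, x.Good η → P.stat top bot η φ n x ≤ K) (n : ℕ)
    {x : Label Q A} (hx : x.Good η) : 0 ≤ P.stat top bot η φ n x := by
  induction n generalizing x with
  | zero =>
    rw [stat_zero]
    exact hφ x hx
  | succ n ih =>
    rw [stat_succ, ← stat_const_zero (P := P) (top := top) (bot := bot) (η := η) 1 x]
    exact stat_one_mono hP (fun y hy => ih hy) (hK n) hx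

/-- The sum is 0 rather than 1 for the zero sub-belief, which arises when a cut removes every entry.
-/
theorem sum_belObsProb_le_one (P : POMDP Q A O) (b : Q → ℝ) (a : A) :
    ∑ o, P.belObsProb b a o ≤ 1 := by
  by_cases h : mass b = 0
  · simp [belObsProb_eq, h]
  · exact (P.sum_belObsProb h a).le

theorem val_push (ht : P.Absorbing top) {b : Q → ℝ} (hb : 0 ≤ b) (a : A) (o : O) :
    P.val {top} (P.push b a o) = P.belObsProb b a o * P.val {top} (P.update b a o) := by
  rw [← val_smul ht (P.update_nonneg hb a o) (P.belObsProb_nonneg hb a o),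
    P.belObsProb_smul_update hb]

theorem IsSplitNode.sum_val (hP : P.PosteriorDeterministic) (ht : P.Absorbing top)
    {f : Set Q → Set A} {b : Q → ℝ} (h : P.IsSplitNode top bot η f b) (hb : 0 ≤ b) :
    P.stat top bot η (P.labelVal top) 1 (.bel b) = P.val {top} b := by
  classical
  rw [h.stat_one, ← h.isMaxSEC.1.sum_val_restrict hP ht hb h.mem]
  refine Finset.sum_congr (by ext; simp) fun C _ => ?_
  have h1 := h.mass_pos hP hb
  have h2 := h.mass_restrict_pos hP hb C.2
  rw [labelVal, val_smul ht (restrict_nonneg hb _) (div_pos h1 h2).le]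
  field_simp

theorem labelVal_le_val (ht : P.Absorbing top) {x : Label Q A} (hx : x.Good η) :
    P.labelVal top x ≤ P.val {top} x.belief := by
  cases x with
  | bel b => exact le_rfl
  | act b a => exact sum_val_push_le ht hx.isSubBelief.nonneg' a

theorem labelVal_le_mass (ht : P.Absorbing top) {x : Label Q A} (hx : x.Good η) :
    P.labelVal top x ≤ mass x.belief :=
  (labelVal_le_val ht hx).trans (val_le_mass ht hx.isSubBelief.nonneg')

theorem labelVal_nonneg (ht : P.Absorbing top) {x : Label Q A} (hx : x.Good η) :
    0 ≤ P.labelVal top x := by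
  cases x with
  | bel b => exact val_nonneg ht hx.isSubBelief.nonneg'
  | act b a =>
    exact Finset.sum_nonneg fun o _ => val_nonneg ht (P.push_nonneg hx.isSubBelief.nonneg' a o)

theorem labelVal_le_one (ht : P.Absorbing top) {x : Label Q A} (hx : x.Good η) :
    P.labelVal top x ≤ 1 :=
  (labelVal_le_mass ht hx).trans hx.isSubBelief.mass_le_one

theorem leafVal_nonneg {x : Label Q A} (hx : x.Good η) : 0 ≤ leafVal top x := by
  rw [leafVal]
  split_ifs
  · exact mass_nonneg hx.isSubBelief.nonneg'
  · exact le_rfl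

theorem leafVal_le_labelVal (ht : P.Absorbing top) {x : Label Q A} (hx : x.Good η) :
    leafVal top x ≤ P.labelVal top x := by
  have hb := hx.isSubBelief.nonneg'
  rw [leafVal]
  split_ifs with h
  · cases x with
    | bel b => exact (val_eq_mass_of_supp_eq ht hb h.subset).ge
    | act b a =>
      change mass b ≤ ∑ o, P.val {top} (P.push b a o)
      rw [← P.sum_mass_push b a]
      refine Finset.sum_le_sum fun o _ => (val_eq_mass_of_supp_eq ht (P.push_nonneg hb a o) ?_).ge
      rw [P.supp_push hb]
      rintro q ⟨q', hq', hp⟩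
      obtain rfl : q' = top := h.subset hq'
      exact ht _ _ _ hp
  · exact labelVal_nonneg ht hx

/-- Observations and splits preserve the value, a cut lowers it by monotonicity, and an exit of a
max node cannot beat the value, which is constant inside the SEC. -/
theorem stat_one_labelVal_le (hP : P.PosteriorDeterministic) (ht : P.Absorbing top)
    {x : Label Q A} (hx : x.Good η) :
    P.stat top bot η (P.labelVal top) 1 x ≤ P.labelVal top x := by
  have hb := hx.isSubBelief.nonneg'
  cases x with
  | act b a =>
    change 0 ≤ b at hb
    rw [stat_one_act _ _ _ _ _ hb]
    exact Finset.sum_le_sum fun o _ => (val_push ht hb a o).ge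
  | bel b =>
    rcases P.node_cases top bot η b with h | ⟨h, h'⟩ | ⟨f, h⟩ | h
    · rw [stat_leaf _ _ _ _ _ _ h]
    · rw [stat_one_cut _ _ _ _ _ h h']
      exact val_mono ht (cut_nonneg hb) (cut_le hb)
    · exact (h.sum_val hP ht hb).le
    · rw [h.stat_one]
      exact Real.iSup_le (fun y => h.labelVal_le hP ht hb y.2) (val_nonneg ht hb)

theorem stat_leafVal_le (hP : P.PosteriorDeterministic) (ht : P.Absorbing top) (n : ℕ)
    {x : Label Q A} (hx : x.Good η) :
    P.stat top bot η (leafVal top) n x ≤ P.labelVal top x := by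
  induction n generalizing x with
  | zero =>
    rw [stat_zero]
    exact leafVal_le_labelVal ht hx
  | succ n ih =>
    rw [stat_succ]
    exact (stat_one_mono hP (fun y hy => ih hy) (fun y hy => labelVal_le_one ht hy) hx).trans
      (stat_one_labelVal_le hP ht hx)

/-! ### The rank of the truncated unfolding -/

theorem leafRank_nonneg {x : Label Q A} (hx : x.Good η) : 0 ≤ P.leafRank x :=
  mul_nonneg (mass_nonneg hx.isSubBelief.nonneg') (Nat.cast_nonneg _)

theorem rankSupp_le (hP : P.PosteriorDeterministic) (S : Set Q) :
    P.rankSupp S ≤ 2 ^ Fintype.card Q := by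
  rcases S.eq_empty_or_nonempty with rfl | hS
  · rw [rankSupp_empty hP]
    exact Nat.zero_le _
  · have := rankSupp_add_two_le hP hS
    omega

theorem leafRank_le (hP : P.PosteriorDeterministic) {x : Label Q A} (hx : x.Good η) :
    P.leafRank x ≤ 2 ^ Fintype.card Q := by
  have h : (P.rankSupp (supp x.belief) : ℝ) ≤ 2 ^ Fintype.card Q := by
    exact_mod_cast rankSupp_le hP _
  exact (mul_le_of_le_one_left (Nat.cast_nonneg _) hx.isSubBelief.mass_le_one).trans h

theorem rankSupp_supp_update (hP : P.PosteriorDeterministic) {b : Q → ℝ} (hb : 0 ≤ b) (a : A)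
    (o : O) : P.rankSupp (supp (P.update b a o)) ≤ P.rankSupp (supp b) := by
  rw [P.supp_update hb]
  exact rankSupp_mono hP ⟨[(a, o)], rfl⟩

theorem mass_update_le {b : Q → ℝ} (hb : 0 ≤ b) (a : A) (o : O) :
    mass (P.update b a o) ≤ mass b := by
  by_cases h : mass (P.push b a o) = 0
  · rw [update_eq, h, div_zero, zero_smul, mass_zero]
    exact mass_nonneg hb
  · exact (P.mass_update b a o h).le

theorem leafRank_update_le (hP : P.PosteriorDeterministic) {b : Q → ℝ} (hb : 0 ≤ b) (a : A)
    (o : O) : P.leafRank (.bel (P.update b a o) : Label Q A) ≤ P.rank b :=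
  mul_le_mul (mass_update_le hb a o) (Nat.cast_le.2 (rankSupp_supp_update hP hb a o))
    (Nat.cast_nonneg _) (mass_nonneg hb)

/-- At a cut node or split node, the rank of the support decreases. -/
theorem stat_one_leafRank_le_of_cut (hP : P.PosteriorDeterministic) {b : Q → ℝ} (hb : 0 ≤ b)
    (h : ¬ (supp b = {top} ∨ supp b = {bot})) (h' : ∃ q, b q ≠ 0 ∧ b q < η) {R : ℕ}
    (hR : P.rankSupp (supp b) ≤ R) (hR1 : 1 ≤ R) :
    P.stat top bot η P.leafRank 1 (.bel b : Label Q A) ≤ mass b * (R - 1) := by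
  rw [stat_one_cut _ _ _ _ _ h h']
  have h1 : P.rankSupp (supp (POMDP.cut η b)) + 1 ≤ R := by
    rcases (supp (POMDP.cut η b)).eq_empty_or_nonempty with h0 | h0
    · rw [h0, rankSupp_empty hP]
      exact hR1
    · have hlt := ncard_supp_cut hb h'
      have hne : (supp b).Nonempty := by
        rw [← Set.ncard_pos]
        omega
      exact (rankSupp_lt hP h0 hne (strictBelow_of_ncard_lt hP hlt)).trans hR
  have h2 : (P.rankSupp (supp (POMDP.cut η b)) : ℝ) + 1 ≤ R := by exact_mod_cast h1
  exact mul_le_mul (mass_mono (cut_le hb)) (le_sub_iff_add_le.2 h2) (Nat.cast_nonneg _) (mass_nonneg hb)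

theorem stat_one_leafRank_le_of_split (hP : P.PosteriorDeterministic) {b : Q → ℝ} (hb : 0 ≤ b)
    {f : Set Q → Set A} (h : P.IsSplitNode top bot η f b) {R : ℕ}
    (hR : P.rankSupp (supp b) ≤ R) :
    P.stat top bot η P.leafRank 1 (.bel b : Label Q A) ≤ mass b * (R - 1) := by
  classical
  have hw : mass b * ((R : ℝ) - 1) = ∑ C : {C // C ∈ P.classes f (supp b)},
      mass (restrict b C.1) / mass b * (mass b * ((R : ℝ) - 1)) := by
    rw [← Finset.sum_mul, h.sum_weight hP hb, one_mul]
  rw [h.stat_one, hw]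
  refine Finset.sum_le_sum fun C _ => mul_le_mul_of_nonneg_left ?_
    (div_nonneg (mass_nonneg (restrict_nonneg hb _)) (mass_nonneg hb))
  have hc := h.isSplitChild hP hb C.2
  have h1 := (rankSupp_lt hP hc.nonempty (h.isMaxSEC.1.nonempty _ h.mem)
    (strictBelow_of_ncard_lt hP hc.ncard_lt)).trans hR
  have h2 : (P.rankSupp (supp ((mass b / mass (restrict b C.1)) • restrict b C.1)) : ℝ) + 1 ≤ R := by
    exact_mod_cast h1
  change mass ((mass b / mass (restrict b C.1)) • restrict b C.1) * (P.rankSupp _ : ℝ) ≤ _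
  rw [hc.mass_eq]
  exact mul_le_mul_of_nonneg_left (le_sub_iff_add_le.2 h2) (mass_nonneg hb)

theorem stat_one_leafRank_le (hP : P.PosteriorDeterministic) (hs : P.IsStandard top bot)
    {x : Label Q A} (hx : x.Good η) :
    P.stat top bot η P.leafRank 1 x ≤ P.leafRank x := by
  have hb := hx.isSubBelief.nonneg'
  cases x with
  | act b a =>
    change 0 ≤ b at hb
    rw [stat_one_act _ _ _ _ _ hb]
    calc _ ≤ ∑ o, P.belObsProb b a o * P.rank b := Finset.sum_le_sum fun o _ =>
          mul_le_mul_of_nonneg_left (leafRank_update_le hP hb a o) (P.belObsProb_nonneg hb a o)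
      _ ≤ P.rank b := by
          rw [← Finset.sum_mul]
          exact mul_le_of_le_one_left (leafRank_nonneg hx) (P.sum_belObsProb_le_one b a)
  | bel b =>
    have hle : b ≠ 0 → ¬ (supp b = {top} ∨ supp b = {bot}) → 1 ≤ P.rankSupp (supp b) := by
      intro h0 h
      refine hs.one_le_rankSupp hP ?_ (fun h' => h (.inl h')) (fun h' => h (.inr h'))
      by_contra hne
      exact h0 (eq_zero_of_supp_eq_empty hb (Set.not_nonempty_iff_eq_empty.1 hne))
    have hsub : mass b * ((P.rankSupp (supp b) : ℝ) - 1) ≤ P.leafRank (.bel b : Label Q A) :=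
      mul_le_mul_of_nonneg_left (sub_le_self _ zero_le_one) (mass_nonneg hb)
    rcases P.node_cases top bot η b with h | ⟨h, h'⟩ | ⟨f, h⟩ | h
    · rw [stat_leaf _ _ _ _ _ _ h]
    · have h0 : b ≠ 0 := by
        rintro rfl
        obtain ⟨q, hq, -⟩ := h'
        exact hq rfl
      exact (stat_one_leafRank_le_of_cut hP hb h h' le_rfl (hle h0 h)).trans hsub
    · exact (stat_one_leafRank_le_of_split hP hb h le_rfl).trans hsub
    · rw [h.stat_one]
      refine Real.iSup_le (fun y => ?_) (leafRank_nonneg hx)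
      have hy := h.isExitChild hP hb y.2
      change mass y.1.1 * (P.rankSupp (supp y.1.1) : ℝ) ≤ mass b * (P.rankSupp (supp b) : ℝ)
      rw [hy.mass_eq]
      exact mul_le_mul_of_nonneg_left (Nat.cast_le.2 (rankSupp_mono hP hy.below)) (mass_nonneg hb)

theorem stat_leafRank_succ_le (hP : P.PosteriorDeterministic) (hs : P.IsStandard top bot) (n : ℕ)
    {x : Label Q A} (hx : x.Good η) :
    P.stat top bot η P.leafRank (n + 1) x ≤ P.stat top bot η P.leafRank n x ∧
      P.stat top bot η P.leafRank n x ≤ P.leafRank x := by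
  induction n generalizing x with
  | zero =>
    rw [stat_zero]
    exact ⟨stat_one_leafRank_le hP hs hx, le_rfl⟩
  | succ n ih =>
    refine ⟨?_, (ih hx).1.trans (ih hx).2⟩
    rw [stat_succ, stat_succ (n := n)]
    exact stat_one_mono hP (fun y hy => (ih hy).1)
      (fun y hy => (ih hy).2.trans (leafRank_le hP hy)) hx

theorem stat_leafRank_le (hP : P.PosteriorDeterministic) (hs : P.IsStandard top bot) (n : ℕ)
    {x : Label Q A} (hx : x.Good η) : P.stat top bot η P.leafRank n x ≤ P.leafRank x :=
  (stat_leafRank_succ_le hP hs n hx).2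

theorem stat_leafRank_antitone (hP : P.PosteriorDeterministic) (hs : P.IsStandard top bot)
    {m n : ℕ} (hmn : m ≤ n) {x : Label Q A} (hx : x.Good η) :
    P.stat top bot η P.leafRank n x ≤ P.stat top bot η P.leafRank m x :=
  antitone_nat_of_succ_le (f := fun n => P.stat top bot η P.leafRank n x)
    (fun n => (stat_leafRank_succ_le hP hs n hx).1) hmn

/-! ### The gap between the value and the value of the truncated unfolding -/

open Classical in
theorem sum_indicator (S : Set Q) : ∑ q, (if q ∈ S then (1 : ℝ) else 0) = S.ncard := by
  rw [Finset.sum_boole, Set.ncard_eq_toFinset_card', ← Set.filter_mem_univ_eq_toFinset]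

/-- Entry by entry: a removed entry is below `η` and takes its state out of the support. -/
theorem mass_le_mass_cut {b : Q → ℝ} (hb : 0 ≤ b) :
    mass b + η * (supp (POMDP.cut η b)).ncard ≤ mass (POMDP.cut η b) + η * (supp b).ncard := by
  classical
  rw [← sum_indicator, ← sum_indicator, mass, mass, Finset.mul_sum, Finset.mul_sum,
    ← Finset.sum_add_distrib, ← Finset.sum_add_distrib]
  refine Finset.sum_le_sum fun q _ => ?_
  have hq : 0 ≤ b q := hb q
  by_cases h : b q < η
  · have h1 : POMDP.cut η b q = 0 := if_pos h
    have h2 : q ∉ supp (POMDP.cut η b) := by simp [supp, h1]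
    rw [if_neg h2, h1]
    split_ifs with h3
    · linarith
    · rw [eq_zero_of_notMem_supp hb h3]
  · have h1 : POMDP.cut η b q = b q := if_neg h
    have h2 : q ∈ supp (POMDP.cut η b) ↔ q ∈ supp b := by simp [supp, h1]
    simp only [h1, h2]
    exact le_rfl

theorem val_le_val_cut (ht : P.Absorbing top) {b : Q → ℝ} (hb : 0 ≤ b) :
    P.val {top} b + η * (supp (POMDP.cut η b)).ncard ≤
      P.val {top} (POMDP.cut η b) + η * (supp b).ncard := by
  have h1 := mass_le_mass_cut (η := η) hb
  have h2 : (0 : Q → ℝ) ≤ b - POMDP.cut η b := sub_nonneg.2 (cut_le hb)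
  have h3 := val_add_le (P := P) ht (cut_nonneg (η := η) hb) h2
  rw [add_sub_cancel] at h3
  have h4 := val_le_mass (P := P) ht h2
  have h5 : mass (b - POMDP.cut η b) = mass b - mass (POMDP.cut η b) := Finset.sum_sub_distrib _ _
  linarith

/-- At supports `{top}` and `{bot}` the leaf value is correct. At any other nonempty support the
rank is at least 1, so the rank statistic alone is at least the mass, hence at least the value. -/
theorem labelVal_le_leaf (hP : P.PosteriorDeterministic) (hs : P.IsStandard top bot)
    {x : Label Q A} (hx : x.Good η) : P.labelVal top x ≤ leafVal top x + P.leafRank x := by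
  have hb := hx.isSubBelief.nonneg'
  by_cases h1 : supp x.belief = {top}
  · rw [leafVal, if_pos h1]
    linarith [labelVal_le_mass hs.absorbing_top hx, leafRank_nonneg (P := P) hx]
  have h0 := leafVal_nonneg (top := top) hx
  by_cases h2 : supp x.belief = {bot}
  · have := labelVal_le_val hs.absorbing_top hx
    rw [hs.val_eq_zero hb h2.subset] at this
    linarith [leafRank_nonneg (P := P) hx]
  by_cases h3 : (supp x.belief).Nonempty
  · have h4 : (1 : ℝ) ≤ P.rankSupp (supp x.belief) := by
      exact_mod_cast hs.one_le_rankSupp hP h3 h1 h2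
    have h5 : mass x.belief ≤ P.leafRank x := le_mul_of_one_le_right (mass_nonneg hb) h4
    linarith [labelVal_le_mass hs.absorbing_top hx]
  · have h4 := labelVal_le_mass hs.absorbing_top hx
    rw [eq_zero_of_supp_eq_empty hb (Set.not_nonempty_iff_eq_empty.1 h3), mass_zero] at h4
    linarith [leafRank_nonneg (P := P) hx]

/-- The three terms are an invariant of the tree. The loss at a cut is paid by the drop of `η` times
the size of the support; at all other inner nodes this size does not increase and the value is
recovered from the children. -/
theorem labelVal_le_stat (hP : P.PosteriorDeterministic) (hs : P.IsStandard top bot) (hη : 0 ≤ η)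
    (n : ℕ) {x : Label Q A} (hx : x.Good η) :
    P.labelVal top x ≤ P.stat top bot η (leafVal top) n x + P.stat top bot η P.leafRank n x +
      η * (supp x.belief).ncard := by
  classical
  have ht := hs.absorbing_top
  induction n generalizing x with
  | zero =>
    rw [stat_zero, stat_zero]
    have := labelVal_le_leaf hP hs hx
    have : 0 ≤ η * (supp x.belief).ncard := by positivity
    linarith
  | succ n ih =>
    rw [stat_succ, stat_succ _ _ _ _ P.leafRank]
    have hv1 {y : Label Q A} (hy : y.Good η) : P.stat top bot η (leafVal top) n y ≤ 1 :=
      (stat_leafVal_le hP ht n hy).trans (labelVal_le_one ht hy)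
    have hr1 {y : Label Q A} (hy : y.Good η) : P.stat top bot η P.leafRank n y ≤
        2 ^ Fintype.card Q := (stat_leafRank_le hP hs n hy).trans (leafRank_le hP hy)
    have hv0 {y : Label Q A} (hy : y.Good η) : 0 ≤ P.stat top bot η (leafVal top) n y :=
      stat_nonneg hP (fun y hy => leafVal_nonneg hy)
        (fun n y hy => (stat_leafVal_le hP ht n hy).trans (labelVal_le_one ht hy)) n hy
    have hr0 {y : Label Q A} (hy : y.Good η) : 0 ≤ P.stat top bot η P.leafRank n y :=
      stat_nonneg hP (fun y hy => leafRank_nonneg hy)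
        (fun n y hy => (stat_leafRank_le hP hs n hy).trans (leafRank_le hP hy)) n hy
    generalize P.stat top bot η (leafVal top) n = φ at *
    generalize P.stat top bot η P.leafRank n = ψ at *
    have hbs := hx.isSubBelief
    have hb := hbs.nonneg'
    cases x with
    | act b a =>
      change IsSubBelief b at hbs
      change 0 ≤ b at hb
      rw [stat_one_act _ _ _ _ _ hb, stat_one_act _ _ _ _ _ hb]
      have hd : 0 ≤ η * (supp b).ncard := by positivity
      calc ∑ o, P.val {top} (P.push b a o)
          ≤ ∑ o, (P.belObsProb b a o * φ (.bel (P.update b a o)) +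
            P.belObsProb b a o * ψ (.bel (P.update b a o)) +
            P.belObsProb b a o * (η * (supp b).ncard)) := by
            refine Finset.sum_le_sum fun o _ => ?_
            rw [val_push ht hb, ← mul_add, ← mul_add]
            refine mul_le_mul_of_nonneg_left ?_ (P.belObsProb_nonneg hb a o)
            refine (ih (x := .bel (P.update b a o)) (isSubBelief_update hbs a o)).trans ?_
            have h1 : ((supp (P.update b a o)).ncard : ℝ) ≤ (supp b).ncard := by
              rw [P.supp_update hb]
              exact_mod_cast ncard_succ_le hP _ _ _
            exact add_le_add le_rfl (mul_le_mul_of_nonneg_left h1 hη)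
        _ ≤ _ := by
            rw [Finset.sum_add_distrib, Finset.sum_add_distrib, ← Finset.sum_mul]
            exact add_le_add le_rfl (mul_le_of_le_one_left hd (P.sum_belObsProb_le_one b a))
    | bel b =>
      change IsSubBelief b at hbs
      change 0 ≤ b at hb
      rcases P.node_cases top bot η b with h | ⟨h, h'⟩ | ⟨f, h⟩ | h
      · rw [stat_leaf _ _ _ _ _ _ h, stat_leaf _ _ _ _ _ _ h]
        exact ih hx
      · rw [stat_one_cut _ _ _ _ _ h h', stat_one_cut _ _ _ _ _ h h']
        have h1 := ih (x := .bel (POMDP.cut η b)) (isSubBelief_cut hbs)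
        have h2 := val_le_val_cut (P := P) (η := η) ht hb
        simp only [labelVal, Label.belief] at h1 ⊢
        linarith
      · change P.val {top} b ≤ _
        rw [← h.sum_val hP ht hb, h.stat_one, h.stat_one, h.stat_one]
        have hd : η * (supp b).ncard = ∑ C : {C // C ∈ P.classes f (supp b)},
            mass (restrict b C.1) / mass b * (η * (supp b).ncard) := by
          rw [← Finset.sum_mul, h.sum_weight hP hb, one_mul]
        change _ ≤ _ + _ + η * (supp b).ncard
        rw [hd, ← Finset.sum_add_distrib, ← Finset.sum_add_distrib]
        refine Finset.sum_le_sum fun C _ => ?_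
        rw [← mul_add, ← mul_add]
        refine mul_le_mul_of_nonneg_left ?_
          (div_nonneg (mass_nonneg (restrict_nonneg hb _)) (mass_nonneg hb))
        have hc := h.isSplitChild hP hb C.2
        refine (ih (x := .bel _) (hc.isSubBelief hbs)).trans ?_
        have h1 : ((supp ((mass b / mass (restrict b C.1)) • restrict b C.1)).ncard : ℝ) ≤
            (supp b).ncard := by exact_mod_cast hc.ncard_lt.le
        exact add_le_add le_rfl (mul_le_mul_of_nonneg_left h1 hη)
      · rw [h.stat_one, h.stat_one]
        have hg (y : P.exits b) := (h.isExitChild hP hb y.2).good hbs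
        have hd : 0 ≤ η * (supp b).ncard := by positivity
        have hsv : 0 ≤ ⨆ y : P.exits b, φ (.act y.1.1 y.1.2) := Real.iSup_nonneg fun y => hv0 (hg y)
        have hsr : 0 ≤ ⨆ y : P.exits b, ψ (.act y.1.1 y.1.2) := Real.iSup_nonneg fun y => hr0 (hg y)
        refine h.val_le hP hs hb (by change 0 ≤ _ + _ + η * (supp b).ncard; linarith) fun y hy => ?_
        have hy' := h.isExitChild hP hb hy
        refine (ih (hg ⟨y, hy⟩)).trans (add_le_add (add_le_add ?_ ?_) ?_)
        · refine le_ciSup (f := fun y : P.exits b => φ (.act y.1.1 y.1.2)) ⟨1, ?_⟩ ⟨y, hy⟩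
          rintro _ ⟨y, rfl⟩
          exact hv1 (hg y)
        · refine le_ciSup (f := fun y : P.exits b => ψ (.act y.1.1 y.1.2))
            ⟨2 ^ Fintype.card Q, ?_⟩ ⟨y, hy⟩
          rintro _ ⟨y, rfl⟩
          exact hr1 (hg y)
        · exact mul_le_mul_of_nonneg_left (Nat.cast_le.2 (hy'.below.ncard_le hP)) hη

end Bounds

/-! ### Decrease of the rank -/

theorem pMin_le (P : POMDP Q A O) {q : Q} {a : A} {o : O} {q' : Q} (h : 0 < P.prob q a o q') :
    P.pMin ≤ P.prob q a o q' :=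
  csInf_le ⟨0, by rintro _ ⟨q, a, o, q', rfl, h⟩; exact h.le⟩ ⟨q, a, o, q', rfl, h⟩

theorem pMin_mem (P : POMDP Q A O) (q : Q) :
    P.pMin ∈ {p : ℝ | ∃ q a o q', p = P.prob q a o q' ∧ 0 < P.prob q a o q'} := by
  refine Set.Nonempty.csInf_mem ?_ ?_
  · obtain ⟨a⟩ := ‹Nonempty A›
    obtain ⟨⟨o, q'⟩, h⟩ := (P.trans q a).support_nonempty
    exact ⟨_, q, a, o, q', rfl, ENNReal.toReal_pos h (PMF.apply_ne_top _ _)⟩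
  · refine (Set.finite_range fun x : Q × A × O × Q => P.prob x.1 x.2.1 x.2.2.1 x.2.2.2).subset ?_
    rintro _ ⟨q, a, o, q', rfl, -⟩
    exact ⟨(q, a, o, q'), rfl⟩

theorem pMin_pos (P : POMDP Q A O) (q : Q) : 0 < P.pMin := by
  obtain ⟨q, a, o, q', h, h'⟩ := P.pMin_mem q
  rwa [h]

theorem pMin_le_one (P : POMDP Q A O) (q : Q) : P.pMin ≤ 1 := by
  obtain ⟨q, a, o, q', h, -⟩ := P.pMin_mem q
  rw [h, prob, ← ENNReal.toReal_one]
  exact ENNReal.toReal_mono ENNReal.one_ne_top (PMF.coe_le_one _ _)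

section Rank

variable {P : POMDP Q A O} {top bot : Q} {η : ℝ}

/-- Some state that can produce `o` has mass at least `η` and a transition of probability at least
`pMin`; dividing by a total mass that is at most 1 only helps. -/
theorem le_belObsProb (hη : 0 < η) {c : Q → ℝ} (hc : IsSubBelief c)
    (hl : ∀ q, c q ≠ 0 → η ≤ c q) {a : A} {o : O} (hne : (P.succ (supp c) a o).Nonempty) :
    P.pMin * η ≤ P.belObsProb c a o := by
  obtain ⟨q', q, hq, hp⟩ := hne
  have hcq : 0 < c q := hq
  have hm : 0 < mass c := hcq.trans_le (le_mass hc.nonneg' q)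
  have hpm := P.pMin_pos q
  rw [belObsProb_eq, le_div_iff₀ hm]
  calc P.pMin * η * mass c ≤ P.pMin * η := mul_le_of_le_one_right (by positivity) hc.mass_le_one
    _ ≤ P.prob q a o q' * c q := mul_le_mul (P.pMin_le hp) (hl q hcq.ne') hη.le hp.le
    _ = c q * P.prob q a o q' := mul_comm _ _
    _ ≤ P.push c a o q' := Finset.single_le_sum (f := fun q => c q * P.prob q a o q')
        (fun q _ => mul_nonneg (hc.nonneg q) (P.prob_nonneg _ _ _ _)) (Finset.mem_univ q)
    _ ≤ mass (P.push c a o) := le_mass (P.push_nonneg hc.nonneg' a o) q'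

theorem rankSupp_of_leaf (hP : P.PosteriorDeterministic) (hs : P.IsStandard top bot)
    {S : Set Q} (h : S = {top} ∨ S = {bot}) : P.rankSupp S = 0 := by
  rcases h with rfl | rfl
  · exact rankSupp_absorbing hP hs.absorbing_top
  · exact rankSupp_absorbing hP hs.absorbing_bot

theorem stat_one_leafRank_le_of_notMem_avoid (hP : P.PosteriorDeterministic)
    (hs : P.IsStandard top bot) {b : Q → ℝ} (hb : IsSubBelief b) {R : ℕ} (hR1 : 1 ≤ R)
    (hR : P.rankSupp (supp b) ≤ R) (h : supp b ∉ P.avoid top bot 0) :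
    P.stat top bot η P.leafRank 1 (.bel b) ≤ mass b * (R - 1) := by
  have hR1' : (1 : ℝ) ≤ R := by exact_mod_cast hR1
  have hnn : 0 ≤ mass b * ((R : ℝ) - 1) :=
    mul_nonneg (mass_nonneg hb.nonneg') (sub_nonneg.2 hR1')
  rcases P.node_cases top bot η b with h1 | ⟨h1, h2⟩ | ⟨f, h1⟩ | h1
  · rw [stat_leaf _ _ _ _ _ _ h1]
    change mass b * (P.rankSupp (supp b) : ℝ) ≤ _
    rwa [rankSupp_of_leaf hP hs h1, Nat.cast_zero, mul_zero]
  · exact stat_one_leafRank_le_of_cut hP hb.nonneg' h1 h2 hR hR1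
  · exact stat_one_leafRank_le_of_split hP hb.nonneg' h1 hR
  -- A max node outside `avoid` has an empty support, so its rank is 0.
  · have hne : ¬ (supp b).Nonempty := fun hne => h (mem_avoid_zero.2
      ⟨hne, fun h' => h1.not_leaf (.inl h'), fun h' => h1.not_leaf (.inr h'), h1.not_dist⟩)
    refine (stat_one_leafRank_le hP hs (x := .bel b) hb).trans ?_
    change mass b * (P.rankSupp (supp b) : ℝ) ≤ _
    rwa [Set.not_nonempty_iff_eq_empty.1 hne, rankSupp_empty hP, Nat.cast_zero, mul_zero]

/-- Each round takes two levels, a choice of exit and an observation, and the last level performs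
the leaf, cut or split that gains 1. At each round some observation leads out of `avoid` for the
remaining rounds, with probability at least `pMin * η`. The bound `R` on the ranks is kept fixed, so
that the gain is measured against the initial rank. -/
theorem stat_leafRank_le_of_notMem_avoid (hP : P.PosteriorDeterministic)
    (hs : P.IsStandard top bot) (hη : 0 < η) (hx1 : P.pMin * η ≤ 1) (k : ℕ) {b : Q → ℝ}
    (hb : IsSubBelief b) {R : ℕ} (hR1 : 1 ≤ R) (hR : P.rankSupp (supp b) ≤ R)
    (h : supp b ∉ P.avoid top bot k) :
    P.stat top bot η P.leafRank (2 * k + 1) (.bel b) ≤ mass b * (R - (P.pMin * η) ^ k) := by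
  classical
  have hx0 : 0 ≤ P.pMin * η := mul_nonneg (P.pMin_pos top).le hη.le
  induction k generalizing b with
  | zero =>
    rw [pow_zero]
    exact stat_one_leafRank_le_of_notMem_avoid hP hs hb hR1 hR h
  | succ k ih =>
    have hmb := mass_nonneg hb.nonneg'
    have hle1 : P.stat top bot η P.leafRank 1 (.bel b) ≤ mass b * (R - 1) →
        P.stat top bot η P.leafRank (2 * (k + 1) + 1) (.bel b) ≤
          mass b * (R - (P.pMin * η) ^ (k + 1)) := fun h1 =>
      ((stat_leafRank_antitone hP hs (by omega) (x := .bel b) hb).trans h1).trans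
        (mul_le_mul_of_nonneg_left (sub_le_sub_left (pow_le_one₀ hx0 hx1) _) hmb)
    by_cases h0 : supp b ∈ P.avoid top bot 0
    swap
    · exact hle1 (stat_one_leafRank_le_of_notMem_avoid hP hs hb hR1 hR h0)
    rcases P.node_cases top bot η b with h1 | ⟨h1, h2⟩ | ⟨f, h1⟩ | h1
    · obtain ⟨-, h2, h3, -⟩ := mem_avoid_zero.1 h0
      exact absurd h1 (by simp [h2, h3])
    · exact hle1 (stat_one_leafRank_le_of_cut hP hb.nonneg' h1 h2 hR hR1)
    · exact hle1 (stat_one_leafRank_le_of_split hP hb.nonneg' h1 hR)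
    have hR1' : (1 : ℝ) ≤ R := by exact_mod_cast hR1
    rw [stat_succ, h1.stat_one]
    refine Real.iSup_le (fun y => ?_)
      (mul_nonneg hmb (sub_nonneg.2 ((pow_le_one₀ hx0 hx1).trans hR1')))
    obtain ⟨⟨c, a⟩, hy⟩ := y
    have hy := h1.isExitChild hP hb.nonneg' hy
    have hc : IsSubBelief c := hb.of_mass_eq hy.nonneg hy.mass_eq
    have hmc : mass c = mass b := hy.mass_eq
    have hRc : P.rankSupp (supp c) ≤ R := (rankSupp_mono hP hy.below).trans hR
    obtain ⟨o₀, hne, ho₀⟩ : ∃ o, (P.succ (supp c) a o).Nonempty ∧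
        P.succ (supp c) a o ∉ P.avoid top bot k := by
      by_contra! hcon
      exact h (mem_avoid_succ.2 ⟨h0, supp c, a, hy.isExit, hcon⟩)
    change P.stat top bot η P.leafRank (2 * k + 1 + 1) (.act c a) ≤ _
    rw [stat_succ, stat_one_act _ _ _ _ _ hc.nonneg']
    -- The induction hypothesis is used for `o₀` alone; for the other observations the rank just
    -- does not increase.
    have hterm (o : O) : P.belObsProb c a o *
        P.stat top bot η P.leafRank (2 * k + 1) (.bel (P.update c a o)) ≤
        P.belObsProb c a o * (mass b * R) -
          if o = o₀ then P.belObsProb c a o₀ * (mass b * (P.pMin * η) ^ k) else 0 := by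
      have hp := P.belObsProb_nonneg hc.nonneg' a o
      split_ifs with ho
      · subst ho
        rw [← mul_sub, ← mul_sub]
        refine mul_le_mul_of_nonneg_left ?_ hp
        have hmu : mass (P.update c a o) = mass b := by
          rw [P.mass_update, hmc]
          intro h'
          rw [← P.supp_push hc.nonneg', eq_zero_of_mass_eq_zero (P.push_nonneg hc.nonneg' a o) h',
            supp_zero] at hne
          exact Set.not_nonempty_empty hne
        rw [← hmu]
        refine ih (isSubBelief_update hc a o) ((rankSupp_supp_update hP hc.nonneg' a o).trans hRc) ?_
        rwa [P.supp_update hc.nonneg']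
      · rw [sub_zero]
        refine mul_le_mul_of_nonneg_left ?_ hp
        refine ((stat_leafRank_le hP hs _ (x := .bel (P.update c a o))
          (isSubBelief_update hc a o)).trans (leafRank_update_le hP hc.nonneg' a o)).trans ?_
        rw [rank, hmc]
        exact mul_le_mul_of_nonneg_left (Nat.cast_le.2 hRc) hmb
    refine (Finset.sum_le_sum fun o _ => hterm o).trans ?_
    rw [Finset.sum_sub_distrib, ← Finset.sum_mul, Finset.sum_ite_eq', if_pos (Finset.mem_univ _)]
    have h2 : (∑ o, P.belObsProb c a o) * (mass b * R) ≤ mass b * R :=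
      mul_le_of_le_one_left (by positivity) (P.sum_belObsProb_le_one c a)
    have h3 : P.pMin * η * (mass b * (P.pMin * η) ^ k) ≤
        P.belObsProb c a o₀ * (mass b * (P.pMin * η) ^ k) :=
      mul_le_mul_of_nonneg_right (le_belObsProb hη hc hy.large hne) (by positivity)
    rw [pow_succ]
    linarith

theorem stat_leafRank_le_of_small (hP : P.PosteriorDeterministic) (hs : P.IsStandard top bot)
    (hη : 0 < η) (hx1 : P.pMin * η ≤ 1) {x : Label Q A} (hx : x.Good η)
    (hR1 : 1 ≤ P.rankSupp (supp x.belief)) :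
    P.stat top bot η P.leafRank (2 ^ (Fintype.card Q + 1)) x ≤
      mass x.belief * (P.rankSupp (supp x.belief) - (P.pMin * η) ^ 2 ^ (Fintype.card Q + 1)) := by
  have hx0 : 0 ≤ P.pMin * η := mul_nonneg (P.pMin_pos top).le hη.le
  have hpow := Nat.one_le_two_pow (n := Fintype.card Q)
  obtain ⟨K, hK⟩ : ∃ K, K = 2 ^ Fintype.card Q - 1 := ⟨_, rfl⟩
  -- `2 * K + 1` levels suffice from a belief, and one more is needed when the root is labelled by a
  -- belief and an action.
  have hN : 2 ^ (Fintype.card Q + 1) = 2 * K + 1 + 1 := by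
    rw [pow_succ]
    omega
  have hav : P.avoid top bot K = ∅ := hK ▸ P.avoid_eq_empty top bot
  have hdrop {b : Q → ℝ} (hb : IsSubBelief b) (hR : P.rankSupp (supp b) ≤
      P.rankSupp (supp x.belief)) := stat_leafRank_le_of_notMem_avoid hP hs hη hx1 K hb hR1 hR
        (by rw [hav]; exact Set.notMem_empty _)
  have hbs := hx.isSubBelief
  have hmb := mass_nonneg hbs.nonneg'
  rw [hN]
  refine le_trans ?_ (mul_le_mul_of_nonneg_left
    (sub_le_sub_left (pow_le_pow_of_le_one hx0 hx1 (show K ≤ 2 * K + 1 + 1 by omega)) _) hmb)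
  cases x with
  | bel b =>
    exact (stat_leafRank_antitone hP hs (Nat.le_succ _) hx).trans (hdrop hbs le_rfl)
  | act b a =>
    change IsSubBelief b at hbs
    have hR1' : (1 : ℝ) ≤ P.rankSupp (supp b) := by exact_mod_cast hR1
    have h1 : 0 ≤ (P.rankSupp (supp b) : ℝ) - (P.pMin * η) ^ K :=
      sub_nonneg.2 ((pow_le_one₀ hx0 hx1).trans hR1')
    rw [stat_succ, stat_one_act _ _ _ _ _ hbs.nonneg']
    calc _ ≤ ∑ o, P.belObsProb b a o * (mass b * (P.rankSupp (supp b) - (P.pMin * η) ^ K)) :=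
          Finset.sum_le_sum fun o _ => mul_le_mul_of_nonneg_left
            ((hdrop (isSubBelief_update hbs a o) (rankSupp_supp_update hP hbs.nonneg' a o)).trans
              (mul_le_mul_of_nonneg_right (mass_update_le hbs.nonneg' a o) h1))
            (P.belObsProb_nonneg hbs.nonneg' a o)
      _ ≤ _ := by
        rw [← Finset.sum_mul]
        exact mul_le_of_le_one_left (mul_nonneg (mass_nonneg hbs.nonneg') h1)
          (P.sum_belObsProb_le_one b a)

/-- Ranks of supports are at most `2 ^ |Q|`, so dividing the additive gain by this number makes it a
proportion of the rank. -/
theorem stat_leafRank_two_pow_le (hP : P.PosteriorDeterministic) (hs : P.IsStandard top bot)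
    (hη : 0 < η) {c : ℝ}
    (hc : c = (P.pMin * η) ^ 2 ^ (Fintype.card Q + 1) / 2 ^ Fintype.card Q) (hc1 : c ≤ 1)
    {x : Label Q A} (hx : x.Good η) :
    P.stat top bot η P.leafRank (2 ^ (Fintype.card Q + 1)) x ≤ (1 - c) * P.leafRank x := by
  have hpm := P.pMin_pos top
  have hbs := hx.isSubBelief
  have hmb := mass_nonneg hbs.nonneg'
  have hnn : 0 ≤ (1 - c) * P.leafRank x := mul_nonneg (sub_nonneg.2 hc1) (leafRank_nonneg hx)
  have hzero : P.leafRank x = 0 → P.stat top bot η P.leafRank (2 ^ (Fintype.card Q + 1)) x ≤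
      (1 - c) * P.leafRank x := fun h =>
    (stat_leafRank_le hP hs _ hx).trans (h.trans_le hnn)
  rcases Nat.eq_zero_or_pos (P.rankSupp (supp x.belief)) with h0 | hR1
  · exact hzero (by rw [leafRank, rank, h0, Nat.cast_zero, mul_zero])
  rcases le_or_gt (P.pMin * η) 1 with hx1 | hx1
  · refine (stat_leafRank_le_of_small hP hs hη hx1 hx hR1).trans ?_
    have h1 : (P.rankSupp (supp x.belief) : ℝ) ≤ 2 ^ Fintype.card Q := by
      exact_mod_cast rankSupp_le hP _
    have h2 : c * P.rankSupp (supp x.belief) ≤ (P.pMin * η) ^ 2 ^ (Fintype.card Q + 1) := by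
      have h3 : 0 ≤ c := by rw [hc]; positivity
      refine (mul_le_mul_of_nonneg_left h1 h3).trans_eq ?_
      rw [hc, div_mul_cancel₀ _ (by positivity)]
    calc _ ≤ mass x.belief * (P.rankSupp (supp x.belief) - c * P.rankSupp (supp x.belief)) :=
          mul_le_mul_of_nonneg_left (sub_le_sub_left h2 _) hmb
      _ = _ := by
          rw [leafRank, rank]
          ring
  -- Here `η` exceeds all possible entries: a belief that is not a leaf is cut to 0 at once, and a
  -- good label with an action has the zero belief.
  · have hη1 : 1 < η := hx1.trans_le (mul_le_of_le_one_left hη.le (P.pMin_le_one top))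
    have hle (q : Q) : x.belief q < η :=
      ((le_mass hbs.nonneg' q).trans hbs.mass_le_one).trans_lt hη1
    have hb0 : x.belief = 0 → P.leafRank x = 0 := fun h => by
      rw [leafRank, rank, h, mass_zero, zero_mul]
    cases x with
    | act b a =>
      refine hzero (hb0 ?_)
      ext q
      by_contra hq
      exact (hx.2 q hq).not_gt (hle q)
    | bel b =>
      by_cases hb : b = 0
      · exact hzero (hb0 hb)
      by_cases hl : supp b = {top} ∨ supp b = {bot}
      · exact absurd (rankSupp_of_leaf hP hs hl) hR1.ne'
      obtain ⟨q, hq⟩ := Function.ne_iff.1 hb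
      refine ((stat_leafRank_antitone hP hs Nat.one_le_two_pow hx).trans_eq ?_).trans hnn
      have hcut : POMDP.cut η b = 0 := by
        ext q
        exact if_pos (hle q)
      rw [stat_one_cut _ _ _ _ _ hl ⟨q, hq, hle q⟩, leafRank, rank]
      simp only [Label.belief, hcut, mass_zero, zero_mul]

/-! ### Geometric decay of the rank statistic -/

theorem stat_leafRank_add_le (hP : P.PosteriorDeterministic) (hs : P.IsStandard top bot) {c : ℝ}
    (hc1 : c ≤ 1) {N : ℕ} (hN : ∀ x : Label Q A, x.Good η →
      P.stat top bot η P.leafRank N x ≤ (1 - c) * P.leafRank x) (n : ℕ) {x : Label Q A}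
    (hx : x.Good η) :
    P.stat top bot η P.leafRank (n + N) x ≤ (1 - c) * P.stat top bot η P.leafRank n x := by
  induction n generalizing x with
  | zero =>
    rw [zero_add, stat_zero]
    exact hN x hx
  | succ n ih =>
    -- The decrease over the last `N` levels is carried up to the root, since one level of the tree
    -- is monotone and homogeneous.
    rw [Nat.succ_add, stat_succ, stat_succ (n := n), ← stat_smul (sub_nonneg.2 hc1)]
    exact stat_one_mono hP (fun y hy => ih hy) (fun y hy => mul_le_mul_of_nonneg_left
      ((stat_leafRank_le hP hs n hy).trans (leafRank_le hP hy)) (sub_nonneg.2 hc1)) hx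

theorem stat_leafRank_mul_le (hP : P.PosteriorDeterministic) (hs : P.IsStandard top bot) {c : ℝ}
    (hc1 : c ≤ 1) {N : ℕ} (hN : ∀ x : Label Q A, x.Good η →
      P.stat top bot η P.leafRank N x ≤ (1 - c) * P.leafRank x) (k : ℕ) {x : Label Q A}
    (hx : x.Good η) :
    P.stat top bot η P.leafRank (k * N) x ≤ (1 - c) ^ k * P.leafRank x := by
  induction k with
  | zero => rw [zero_mul, stat_zero, pow_zero, one_mul]
  | succ k ih =>
    rw [Nat.succ_mul, pow_succ', mul_assoc]
    exact (stat_leafRank_add_le hP hs hc1 hN _ hx).trans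
      (mul_le_mul_of_nonneg_left ih (sub_nonneg.2 hc1))

theorem leafRank_add_two_le (hP : P.PosteriorDeterministic) (hs : P.IsStandard top bot)
    {b : Q → ℝ} (hb : IsSubBelief b) :
    P.leafRank (.bel b : Label Q A) ≤ 2 ^ Fintype.card Q - 2 := by
  have h : P.rankSupp (supp b) + 2 ≤ 2 ^ Fintype.card Q := by
    rcases (supp b).eq_empty_or_nonempty with h | h
    · rw [h, rankSupp_empty hP]
      exact (rankSupp_absorbing hP hs.absorbing_top) ▸
        rankSupp_add_two_le hP (Set.singleton_nonempty top)
    · exact rankSupp_add_two_le hP h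
  have h' : (P.rankSupp (supp b) : ℝ) + 2 ≤ 2 ^ Fintype.card Q := by exact_mod_cast h
  exact (mul_le_of_le_one_left (Nat.cast_nonneg _) hb.mass_le_one).trans (le_sub_iff_add_le.2 h')

end Rank

/-- The number of iterations in terms of the depth. -/
theorem one_sub_pow_mul_le {ε c : ℝ} (hε : 0 < ε) (hc : 0 < c) (hc1 : c ≤ 1) {m N n : ℕ}
    (hN : 0 < N) (hcm : c ≤ 1 / 2 ^ m) (hm : (2 : ℝ) ≤ 2 ^ m)
    (hn : N / c * ((m + 1) * Real.log 2 + Real.log (1 / ε)) ≤ n) :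
    (1 - c) ^ (n / N) * (2 ^ m - 2) ≤ ε / 2 := by
  have hN' : (0 : ℝ) < N := by exact_mod_cast hN
  have hD : (0 : ℝ) < 2 ^ m := by positivity
  set L := (m + 1) * Real.log 2 + Real.log (1 / ε) with hL
  have hexp : Real.exp (-L) = ε / (2 * 2 ^ m) := by
    have h1 : L = Real.log (2 ^ (m + 1) * (1 / ε)) := by
      rw [Real.log_mul (by positivity) (by positivity), Real.log_pow, hL]
      push_cast
      ring
    rw [Real.exp_neg, h1, Real.exp_log (by positivity), pow_succ]
    field_simp
  -- Rounding `n / N` down loses at most one iteration, that is, a factor `exp c` in the estimate.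
  have hk : (n : ℝ) ≤ ((n / N : ℕ) + 1) * N := by
    exact_mod_cast (Nat.lt_div_mul_add hN).le.trans_eq (by ring)
  have hck : L - c ≤ c * (n / N : ℕ) := by
    have h1 : N * L ≤ c * n := by
      rw [div_mul_eq_mul_div, div_le_iff₀ hc] at hn
      linarith
    have h2 : N * L ≤ N * (c * ((n / N : ℕ) + 1)) :=
      h1.trans ((mul_le_mul_of_nonneg_left hk hc.le).trans_eq (by ring))
    have h3 := le_of_mul_le_mul_left h2 hN'
    linarith
  have hpow : (1 - c) ^ (n / N) ≤ Real.exp c * (ε / (2 * 2 ^ m)) := by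
    calc (1 - c) ^ (n / N) ≤ Real.exp (-c) ^ (n / N) :=
          pow_le_pow_left₀ (sub_nonneg.2 hc1) (Real.one_sub_le_exp_neg c) _
      _ = Real.exp (-(c * (n / N : ℕ))) := by
          rw [← Real.exp_nat_mul]
          congr 1
          ring
      _ ≤ Real.exp (c + -L) := Real.exp_le_exp.2 (by linarith)
      _ = _ := by rw [Real.exp_add, hexp]
  -- The factor lost by rounding is absorbed by the improved bound `2 ^ m - 2` on ranks, since `c`
  -- is smaller than `2 / 2 ^ m`.
  have hfac : Real.exp c * (1 - 2 / 2 ^ m) ≤ 1 := by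
    calc _ ≤ Real.exp c * Real.exp (-(2 / 2 ^ m)) :=
          mul_le_mul_of_nonneg_left (Real.one_sub_le_exp_neg _) (Real.exp_pos c).le
      _ = Real.exp (c - 2 / 2 ^ m) := by rw [← Real.exp_add, sub_eq_add_neg]
      _ ≤ 1 := Real.exp_le_one_iff.2 (by
          have : 1 / (2 : ℝ) ^ m ≤ 2 / 2 ^ m := by gcongr; norm_num
          linarith)
  calc _ ≤ Real.exp c * (ε / (2 * 2 ^ m)) * (2 ^ m - 2) :=
        mul_le_mul_of_nonneg_right hpow (by linarith)
    _ = ε / 2 * (Real.exp c * (1 - 2 / 2 ^ m)) := by field_simp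
    _ ≤ ε / 2 := mul_le_of_le_one_right (by positivity) hfac

end POMDP

/-! ### The termination theorem -/

theorem mainTheorem5 {Q A O : Type u} [Fintype Q] [Fintype A] [Nonempty A] [Fintype O]
    (P : POMDP Q A O) (hP : P.PosteriorDeterministic) (top bot : Q) (hs : P.IsStandard top bot)
    (ε : ℝ) (hε : 0 < ε) (η : ℝ) (hη : η = ε / (2 * Fintype.card Q))
    (N : ℕ) (hN : N = 2 ^ (Fintype.card Q + 1))
    (c : ℝ) (hc : c = (P.pMin * η) ^ N / 2 ^ Fintype.card Q)
    (b : Q → ℝ) (hb : POMDP.IsSubBelief b) :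
    (∀ n : ℕ, N / c * ((Fintype.card Q + 1) * Real.log 2 + Real.log (1 / ε)) ≤ n →
      (P.unfolding top bot η n (.bel b)).value top ≤ P.val {top} b ∧
      P.val {top} b ≤ (P.unfolding top bot η n (.bel b)).value top + ε) ∧
    (c ≤ 1 → ∀ n : ℕ, (P.unfolding top bot η (n + N) (.bel b)).rank P ≤
      (1 - c) * (P.unfolding top bot η n (.bel b)).rank P) := by
  have ht := hs.absorbing_top
  have hcard : (1 : ℝ) ≤ Fintype.card Q := by
    exact_mod_cast Fintype.card_pos_iff.2 ⟨top⟩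
  have hη0 : 0 < η := by
    rw [hη]
    positivity
  have hgood : (POMDP.Label.bel b : POMDP.Label Q A).Good η := hb
  have hdec (hc1 : c ≤ 1) : ∀ x : POMDP.Label Q A, x.Good η →
      P.stat top bot η P.leafRank N x ≤ (1 - c) * P.leafRank x := fun x hx => by
    subst hN
    exact POMDP.stat_leafRank_two_pow_le hP hs hη0 hc hc1 hx
  constructor
  · intro n hn
    rw [POMDP.value_eq_eval]
    change P.stat top bot η (POMDP.leafVal top) n _ ≤ _ ∧ _ ≤ P.stat top bot η _ n _ + ε
    refine ⟨POMDP.stat_leafVal_le hP ht n hgood, ?_⟩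
    have h0 : 0 ≤ P.stat top bot η (POMDP.leafVal top) n (.bel b) :=
      POMDP.stat_nonneg hP (fun y hy => POMDP.leafVal_nonneg hy) (fun n y hy =>
        (POMDP.stat_leafVal_le hP ht n hy).trans (POMDP.labelVal_le_one ht hy)) n hgood
    -- For `ε ≥ 1` the upper bound is trivial, as values are at most 1. Otherwise `η ≤ 1`, which
    -- yields `c ≤ 1`.
    rcases le_or_gt 1 ε with h1 | h1
    · have := (POMDP.val_le_mass (P := P) ht hb.nonneg').trans hb.mass_le_one
      linarith
    have hpm := P.pMin_pos top
    have hη1 : η ≤ 1 := by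
      rw [hη, div_le_one (by positivity)]
      linarith
    have hpow : (P.pMin * η) ^ N ≤ 1 :=
      pow_le_one₀ (by positivity) (mul_le_one₀ (P.pMin_le_one top) hη0.le hη1)
    have hcm : c ≤ 1 / 2 ^ Fintype.card Q := by
      rw [hc]
      gcongr
    have hc1 : c ≤ 1 := hcm.trans (div_le_one_of_le₀ (one_le_pow₀ one_le_two) (by positivity))
    have hc0 : 0 < c := by
      rw [hc]
      positivity
    have h2m : (2 : ℝ) ≤ 2 ^ Fintype.card Q :=
      le_self_pow₀ one_le_two (Fintype.card_pos_iff.2 ⟨top⟩).ne'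
    have hrank : P.stat top bot η P.leafRank n (.bel b) ≤ ε / 2 :=
      calc _ ≤ P.stat top bot η P.leafRank (n / N * N) (.bel b) :=
            POMDP.stat_leafRank_antitone hP hs (Nat.div_mul_le_self n N) hgood
        _ ≤ (1 - c) ^ (n / N) * P.leafRank (.bel b) :=
            POMDP.stat_leafRank_mul_le hP hs hc1 (hdec hc1) _ hgood
        _ ≤ (1 - c) ^ (n / N) * (2 ^ Fintype.card Q - 2) := mul_le_mul_of_nonneg_left
            (POMDP.leafRank_add_two_le hP hs hb) (pow_nonneg (sub_nonneg.2 hc1) _)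
        _ ≤ ε / 2 := POMDP.one_sub_pow_mul_le hε hc0 hc1 (by rw [hN]; positivity) hcm h2m hn
    -- The value of `η` shares `ε / 2` equally among the states that cuts may remove; the other half
    -- of `ε` pays for the rank.
    have hcut : η * (POMDP.supp b).ncard ≤ ε / 2 := by
      have h2 : ((POMDP.supp b).ncard : ℝ) ≤ Fintype.card Q := by
        exact_mod_cast (Set.ncard_le_card _).trans_eq Nat.card_eq_fintype_card
      refine (mul_le_mul_of_nonneg_left h2 hη0.le).trans_eq ?_
      rw [hη]
      field_simp
    have := POMDP.labelVal_le_stat hP hs hη0.le n hgood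
    simp only [POMDP.labelVal, POMDP.Label.belief] at this
    linarith
  · intro hc1 n
    rw [POMDP.rank_eq_eval, POMDP.rank_eq_eval]
    exact POMDP.stat_leafRank_add_le hP hs hc1 (hdec hc1) n hgood
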